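/- Let $d\ge1$ and $0<s<d$. A Hartree–Fock state of density $\rho>0$ is a measurable function $\gamma$ from $\mathbb R^d$ to the Hermitian $2\times2$ complex matrices with $0\le\gamma(k)\le\mathbb I_2$ for a.e. $k$ and $(2\pi)^{-d}\int_{\mathbb R^d}\mathrm{tr}\,\gamma(k)\,dk=\rho$. Its zero-temperature energy, for the Riesz interaction $$w(k)=\frac{c_{d,s}}{|k|^{d-s}},\qquad c_{d,s}=\frac{1}{(2\pi)^{d/2}}\,\frac{2^{(d-s)/2}}{2^{s/2}}\,\frac{\Gamma(\frac{d-s}{2})}{\Gamma(\frac s2)},$$ is $$\mathcal E(\gamma)=\frac1{2(2\pi)^d}\int_{\mathbb R^d}|k|^2\,\mathrm{tr}\,\gamma(k)\,dk-\frac1{2(2\pi)^d}\iint_{\mathbb R^d\times\mathbb R^d}w(k-k')\,\mathrm{tr}[\gamma(k)\gamma(k')]\,dk\,dk'\in(-\infty,+\infty],$$ and $E(\rho)$ is the infimum of $\mathcal E$ over the states of density $\rho$; a minimiser is a state of density $\rho$ whose energy is $E(\rho)$. States are identified when they agree a.e. Put $$c_{\rm TF}=4\pi^2\Big(\frac d{|\mathbb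 S^{d-1}|}\Big)^{2/d},\qquad \kappa=\frac{2\pi^2d}{d+2}\Big(\frac d{|\mathbb S^{d-1}|}\Big)^{2/d},$$ $$\lambda=\frac1{2\pi^{\frac d2-s}}\Big(\frac d{|\mathbb S^{d-1}|}\Big)^{\frac{d+s}d}\frac{\Gamma(\frac{d-s}2)}{\Gamma(\frac s2)}\iint_{|k|<1,\,|k'|<1}\frac{dk\,dk'}{|k-k'|^{d-s}},$$ and, for a unit vector $\nu\in\mathbb C^2$, $U\in SU(2)$ and $t\in[0,1/2]$, $$\gamma_{\rm ferro}^{\nu}(k)=\mathbf 1\big(k^2\le c_{\rm TF}\rho^{2/d}\big)|\nu\rangle\langle\nu|,\qquad \gamma_{\rm para}(k)=\mathbf 1\big(k^2\le c_{\rm TF}(\rho/2)^{2/d}\big)\mathbb I_2,$$ $$\gamma_{\rm mixed}^{t,U}(k)=U\begin{pmatrix}\mathbf 1(k^2\le c_{\rm TF}[t\rho]^{2/d})&0\\0&\mathbf 1(k^2\le c_{\rm TF}[(1-t)\rho]^{2/d})\end{pmatrix}U^*.$$ **(First-order phase transition.)** Suppose $0<s<\min(2,d)$ and let $$\rho_c=\Big(\frac\lambda\kappa\,\frac{1-2^{-s/d}}{1-2^{-2/d}}\Big)^{\frac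 d{2-s}}>0.$$ For $0<\rho<\rho_c$ the minimisers are exactly the states $\gamma^\nu_{\rm ferro}$, $\|\nu\|=1$. For $\rho>\rho_c$ there is a unique minimiser, $\gamma_{\rm para}$. For $\rho=\rho_c$ the minimisers are exactly the states $\gamma^\nu_{\rm ferro}$, $\|\nu\|=1$, together with $\gamma_{\rm para}$. The function $E$ is finite on $(0,\infty)$ and differentiable on $(0,\infty)\setminus\{\rho_c\}$, and its first derivative has a jump at $\rho_c$: the one-sided derivatives of $E$ at $\rho_c$ exist, are the one-sided limits of $E'$ there, and are different. **(Second-order, i.e. smooth, phase transition.)** Suppose $d\ge3$ and $2<s<d$, and let $$\rho_{c,\min}=2\Big(\frac\kappa\lambda\,\frac{2(d+2)}{s(d+s)}\Big)^{\frac d{s-2}},\qquad \rho_{c,\max}=\Big(\frac\kappa\lambda\,\frac{d+2}{d+s}\Big)^{\frac d{s-2}}.$$ Then $0<\rho_{c,\min}<\rho_{c,\max}$. For $0<\rho\le\rho_{c,\min}$ there is a unique minimiser, $\gamma_{\rm para}$. For $\rho_{c,\min}<\rho<\rho_{c,\max}$ there is a $t_\rho\in(0,1/2)$ such that the minimisers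 are exactly the states $\gamma^{t_\rho,U}_{\rm mixed}$, $U\in SU(2)$, and $t_\rho$ is the only $t\in[0,1/2]$ for which some $\gamma^{t,U}_{\rm mixed}$ is a minimiser; the map $\rho\mapsto t_\rho$ is $C^\infty$ on $(\rho_{c,\min},\rho_{c,\max})$, with $t_\rho\to1/2$ as $\rho\to\rho_{c,\min}^+$ and $t_\rho\to0$ as $\rho\to\rho_{c,\max}^-$. For $\rho\ge\rho_{c,\max}$ the minimisers are exactly the states $\gamma^\nu_{\rm ferro}$, $\|\nu\|=1$. -/

import Mathlib

open MeasureTheory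
open scoped ComplexOrder

noncomputable section

/-- The Fourier (momentum) space `ℝᵈ`. -/
abbrev Momentum (d : ℕ) : Type := EuclideanSpace ℝ (Fin d)

/-- A spin-polarised translation-invariant one-particle density matrix, in Fourier space. -/
abbrev DensityMatrix (d : ℕ) : Type := Momentum d → Matrix (Fin 2) (Fin 2) ℂ

/-- Admissible Hartree-Fock states of density `ρ`: measurable, `0 ≤ γ = γ* ≤ 1` (almost everywhere),
and `(2π)⁻ᵈ ∫ tr γ = ρ`. -/
structure IsHFState (d : ℕ) (ρ : ℝ) (γ : DensityMatrix d) : Prop where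
  aemeasurable : ∀ i j, AEMeasurable (fun k => γ k i j) volume
  nonneg : ∀ᵐ k, (γ k).PosSemidef
  le_one : ∀ᵐ k, (1 - γ k).PosSemidef
  integrable : Integrable (fun k => (γ k).trace.re) volume
  density : 1 / (2 * Real.pi) ^ d * ∫ k, (γ k).trace.re = ρ

/-- Kinetic energy per unit volume, `(2 (2π)ᵈ)⁻¹ ∫ |k|² tr γ(k) dk`, possibly infinite. -/
def kineticEnergy (d : ℕ) (γ : DensityMatrix d) : ENNReal :=
  ENNReal.ofReal (1 / (2 * (2 * Real.pi) ^ d)) *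
    ∫⁻ k, ENNReal.ofReal (‖k‖ ^ 2 * (γ k).trace.re)

/-- Exchange energy per unit volume, `(2 (2π)ᵈ)⁻¹ ∬ w(k - k') tr[γ(k) γ(k')] dk dk'`, for an
interaction `w ≥ 0`. It is finite on all admissible states if `w ∈ L¹ + L^∞`. -/
def exchangeEnergy (d : ℕ) (w : Momentum d → ℝ) (γ : DensityMatrix d) : ENNReal :=
  ENNReal.ofReal (1 / (2 * (2 * Real.pi) ^ d)) *
    ∫⁻ k, ∫⁻ k', ENNReal.ofReal (w (k - k') * (γ k * γ k').trace.re)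

/-- The Hartree-Fock energy per unit volume at zero temperature; it is `⊤` if the kinetic energy is
infinite (the exchange energy being finite). -/
def hfEnergy (d : ℕ) (w : Momentum d → ℝ) (γ : DensityMatrix d) : EReal :=
  (kineticEnergy d γ : EReal) - (exchangeEnergy d w γ : EReal)

/-- The ground state energy `E^HF(ρ)`. -/
def hfGroundEnergy (d : ℕ) (w : Momentum d → ℝ) (ρ : ℝ) : EReal :=
  sInf (hfEnergy d w '' {γ | IsHFState d ρ γ})

/-- `γ` is a minimiser for `E^HF(ρ)`. -/
def IsHFMinimiser (d : ℕ) (w : Momentum d → ℝ) (ρ : ℝ) (γ : DensityMatrix d) : Prop :=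
  IsHFState d ρ γ ∧ ∀ γ', IsHFState d ρ γ' → hfEnergy d w γ ≤ hfEnergy d w γ'

/-- The area `|𝕊^{d-1}|` of the unit sphere (equal to `2` for `d = 1`). -/
def sphereArea (d : ℕ) : ℝ :=
  (volume : Measure (Momentum d)).toSphere.real Set.univ

/-- The Thomas-Fermi constant `c_TF = 4π² (d / |𝕊^{d-1}|)^{2/d}`. -/
def thomasFermiConst (d : ℕ) : ℝ :=
  4 * Real.pi ^ 2 * ((d : ℝ) / sphereArea d) ^ (2 / (d : ℝ))

/-- The constant `c_{d,s}`. -/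
def rieszConst (d : ℕ) (s : ℝ) : ℝ :=
  1 / (2 * Real.pi) ^ ((d : ℝ) / 2) * ((2 : ℝ) ^ (((d : ℝ) - s) / 2) / (2 : ℝ) ^ (s / 2)) *
    (Real.Gamma (((d : ℝ) - s) / 2) / Real.Gamma (s / 2))

/-- The Riesz interaction `w(k) = c_{d,s} |k|^{s-d}` in Fourier space. -/
def rieszInteraction (d : ℕ) (s : ℝ) (k : Momentum d) : ℝ :=
  rieszConst d s * ‖k‖ ^ (s - (d : ℝ))

/-- The Dirac-type constant `∬_{|k|<1, |k'|<1} |k - k'|^{s-d} dk dk'`. -/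
def diracConst (d : ℕ) (s : ℝ) : ℝ :=
  ∫ k in Metric.ball (0 : Momentum d) 1, ∫ k' in Metric.ball (0 : Momentum d) 1,
    ‖k - k'‖ ^ (s - (d : ℝ))

/-- The kinetic constant `κ(d)`. -/
def kappaConst (d : ℕ) : ℝ :=
  2 * Real.pi ^ 2 * d / ((d : ℝ) + 2) * ((d : ℝ) / sphereArea d) ^ (2 / (d : ℝ))

/-- The exchange constant `λ(d,s)`. -/
def lambdaConst (d : ℕ) (s : ℝ) : ℝ :=
  1 / (2 * Real.pi ^ ((d : ℝ) / 2 - s)) *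
    ((d : ℝ) / sphereArea d) ^ (((d : ℝ) + s) / (d : ℝ)) *
    (Real.Gamma (((d : ℝ) - s) / 2) / Real.Gamma (s / 2)) * diracConst d s

/-- The critical density of the first-order transition. -/
def rhoC (d : ℕ) (s : ℝ) : ℝ :=
  (lambdaConst d s / kappaConst d *
    ((1 - (2 : ℝ) ^ (-s / (d : ℝ))) / (1 - (2 : ℝ) ^ (-2 / (d : ℝ))))) ^ ((d : ℝ) / (2 - s))

/-- The lower critical density of the smooth transition. -/
def rhoCMin (d : ℕ) (s : ℝ) : ℝ :=
  2 * (kappaConst d / lambdaConst d s *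
    (2 * ((d : ℝ) + 2) / (s * ((d : ℝ) + s)))) ^ ((d : ℝ) / (s - 2))

/-- The upper critical density of the smooth transition. -/
def rhoCMax (d : ℕ) (s : ℝ) : ℝ :=
  (kappaConst d / lambdaConst d s * (((d : ℝ) + 2) / ((d : ℝ) + s))) ^ ((d : ℝ) / (s - 2))

open scoped Classical in
/-- The indicator function `𝟙(k² ≤ c_TF ρ^{2/d})` of the Fermi ball of density `ρ`. -/
def fermiBall (d : ℕ) (ρ : ℝ) (k : Momentum d) : ℂ :=
  if ‖k‖ ^ 2 ≤ thomasFermiConst d * ρ ^ (2 / (d : ℝ)) then 1 else 0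

/-- The pure ferromagnetic state `𝟙(k² ≤ c_TF ρ^{2/d}) |ν⟩⟨ν|`. -/
def ferroState (d : ℕ) (ρ : ℝ) (ν : EuclideanSpace ℂ (Fin 2)) : DensityMatrix d :=
  fun k => fermiBall d ρ k • Matrix.vecMulVec ν.ofLp (star ν.ofLp)

/-- The paramagnetic state `𝟙(k² ≤ c_TF (ρ/2)^{2/d}) 𝕀₂`. -/
def paraState (d : ℕ) (ρ : ℝ) : DensityMatrix d :=
  fun k => fermiBall d (ρ / 2) k • (1 : Matrix (Fin 2) (Fin 2) ℂ)

/-- The state of polarisation `t` with spin axis given by `U`: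
`U diag(𝟙(k² ≤ c_TF (tρ)^{2/d}), 𝟙(k² ≤ c_TF ((1-t)ρ)^{2/d})) U*`. -/
def mixedState (d : ℕ) (ρ t : ℝ) (U : Matrix (Fin 2) (Fin 2) ℂ) : DensityMatrix d :=
  fun k => U * Matrix.diagonal ![fermiBall d (t * ρ) k, fermiBall d ((1 - t) * ρ) k] * star U

end

/-! The energy is bounded below by a function of one number `t`, the share of the mass carried by
the smaller eigenvalue of `γ(k)`. Let `g ≤ f` be the eigenvalue functions. By Cauchy-Schwarz for
Bloch vectors, `tr[γ(k)γ(k')] ≤ f f' + g g'` (`trace_mul_re_le`), so aligning the spins does not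
lower the exchange energy and leaves the kinetic energy alone. For `f` and `g` separately, with
values in `[0, 1]` and fixed mass, the centred ball has the least kinetic energy (bathtub principle)
and the largest exchange energy (`radialEnergy_le_ball`). Hence each state is compared with a mixed
state (`exists_mixed_comparison`). In the equality case the kinetic term alone forces `f` and `g` to
be balls, and since `w > 0` the exchange term then forces a common spin axis.

The rearrangement inequality uses two-point symmetrisation: `transfer v` moves mass across a mirror
towards the origin, without lowering the interaction energy. Mass outside the ball leaves an equal
hole inside, and averaging over mirrors finds one that moves a definite amount into the ball. So the
outside mass can be made arbitrarily small without losing energy, and the error is linear in that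
mass.

For the mixed states the sign of the `t`-derivative is governed by the quotient `polRatio` of
differences `(1 - t)^a - t^a` and `(1 - t)^b - t^b`, where `b < a ≤ 1` are, essentially, the
exponents `2 / d` and `s / d` in increasing order. This quotient is strictly increasing on `[0,
1/2)`. If `s < 2`, the energy can only rise and then fall, so the minimum is at `t = 0` or `t =
1/2`; the two energies cross at `rhoC`, where their slopes in `ρ` differ. If `s > 2`, the energy
falls and then rises, with its unique minimum where `polRatio` equals `polCoupling`, a decreasing
power of `ρ`. The critical densities are those at which `polCoupling` meets the end values of
`polRatio`, and the inverse function theorem makes `t` smooth in between. -/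

/-! ### Reflections exchanging the origin with a point -/

/-- `‖x - v‖ ^ 2 - ‖x‖ ^ 2`, positive on the side of the origin of the bisector of `0` and `v`. -/
noncomputable def mirrorSide {d : ℕ} (v x : Momentum d) : ℝ := ‖v‖ ^ 2 - 2 * inner ℝ v x

/-- The reflection exchanging `0` and `v`. -/
noncomputable def mirror {d : ℕ} (v x : Momentum d) : Momentum d := x + (mirrorSide v x / ‖v‖ ^ 2) • v

section Mirror

variable {d : ℕ} {v : Momentum d}

lemma mirrorSide_eq (v x : Momentum d) : mirrorSide v x = ‖x - v‖ ^ 2 - ‖x‖ ^ 2 := by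
  rw [mirrorSide, norm_sub_sq_real, real_inner_comm]; ring

lemma mirrorSide_mirror (hv : v ≠ 0) (x : Momentum d) :
    mirrorSide v (mirror v x) = - mirrorSide v x := by
  have : ‖v‖ ^ 2 ≠ 0 := by simpa using hv
  unfold mirror
  generalize hl : mirrorSide v x = l
  unfold mirrorSide at *
  rw [inner_add_right, real_inner_smul_right, real_inner_self_eq_norm_sq]
  field_simp
  linarith

lemma mirror_mirror (hv : v ≠ 0) (x : Momentum d) : mirror v (mirror v x) = x := by
  conv_lhs => rw [mirror]
  rw [mirrorSide_mirror hv, mirror, neg_div, neg_smul]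
  abel

lemma mirror_involutive (hv : v ≠ 0) : Function.Involutive (mirror v) := mirror_mirror hv

/-- This identity drives the reflection argument: for two points on the same side of the bisector,
reflecting one of them increases their distance; for points on opposite sides it decreases it. -/
lemma norm_sub_mirror_sq (hv : v ≠ 0) (x y : Momentum d) :
    ‖x - mirror v y‖ ^ 2 = ‖x - y‖ ^ 2 + mirrorSide v x * mirrorSide v y / ‖v‖ ^ 2 := by
  have hn : ‖v‖ ^ 2 ≠ 0 := by simpa using hv
  have h1 : x - mirror v y = (x - y) - (mirrorSide v y / ‖v‖ ^ 2) • v := by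
    rw [mirror]; abel
  have h2 : 2 * inner ℝ (x - y) v = mirrorSide v y - mirrorSide v x := by
    rw [mirrorSide, mirrorSide, inner_sub_left, real_inner_comm v x, real_inner_comm v y]; ring
  rw [h1, norm_sub_sq_real, real_inner_smul_right, norm_smul, mul_pow, Real.norm_eq_abs, sq_abs,
    show 2 * (mirrorSide v y / ‖v‖ ^ 2 * inner ℝ (x - y) v) =
      mirrorSide v y / ‖v‖ ^ 2 * (2 * inner ℝ (x - y) v) by ring, h2]
  field_simp
  ring

lemma norm_mirror_sub_mirror (hv : v ≠ 0) (x y : Momentum d) :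
    ‖mirror v x - mirror v y‖ = ‖x - y‖ := by
  have h := norm_sub_mirror_sq hv (mirror v x) y
  have h' := norm_sub_mirror_sq hv y x
  rw [norm_sub_rev y (mirror v x), norm_sub_rev y x] at h'
  rw [mirrorSide_mirror hv, h'] at h
  rw [← sq_eq_sq₀ (norm_nonneg _) (norm_nonneg _), h]
  ring

lemma norm_mirror_sub (hv : v ≠ 0) (x y : Momentum d) :
    ‖mirror v x - y‖ = ‖x - mirror v y‖ := by
  rw [← norm_mirror_sub_mirror hv, mirror_mirror hv]

lemma mirror_zero (hv : v ≠ 0) : mirror v 0 = v := by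
  have hn : ‖v‖ ^ 2 ≠ 0 := by simpa using hv
  simp [mirror, mirrorSide, hn]

lemma norm_mirror (hv : v ≠ 0) (x : Momentum d) : ‖mirror v x‖ = ‖x - v‖ := by
  simpa [mirror_zero hv] using norm_mirror_sub hv x 0

lemma mirrorSide_pos_iff (hv : v ≠ 0) (x : Momentum d) : 0 < mirrorSide v x ↔ ‖x‖ < ‖mirror v x‖ := by
  rw [norm_mirror hv, mirrorSide_eq, sub_pos, sq_lt_sq₀ (norm_nonneg _) (norm_nonneg _)]

lemma isometry_mirror (hv : v ≠ 0) : Isometry (mirror v) :=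
  Isometry.of_dist_eq fun x y => by simp only [dist_eq_norm, norm_mirror_sub_mirror hv]

lemma continuous_mirrorSide : Continuous fun p : Momentum d × Momentum d => mirrorSide p.1 p.2 := by
  unfold mirrorSide; fun_prop

lemma measurable_mirror : Measurable fun p : Momentum d × Momentum d => mirror p.1 p.2 := by
  unfold mirror
  have := (continuous_mirrorSide (d := d)).measurable
  fun_prop

/-- Hausdorff measure is invariant under isometries and controlled under Lipschitz maps; volume,
being a multiple of it, inherits both properties. -/
lemma volume_eq_smul_hausdorffMeasure (d : ℕ) : ∃ c : NNReal, 
    (volume : Measure (Momentum d)) = c • (Measure.hausdorffMeasure (d : ℝ)) := by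
  have : Measure.IsAddHaarMeasure (Measure.hausdorffMeasure (d : ℝ) : Measure (Momentum d)) := by
    have := isAddHaarMeasure_hausdorffMeasure (E := Momentum d)
    rwa [finrank_euclideanSpace_fin] at this
  exact ⟨_, Measure.isAddLeftInvariant_eq_smul _ _⟩

lemma measurePreserving_mirror (hv : v ≠ 0) : MeasurePreserving (mirror v) volume volume := by
  obtain ⟨c, hc⟩ := volume_eq_smul_hausdorffMeasure d
  have h := (isometry_mirror hv).map_hausdorffMeasure (d := d) (Or.inl (by positivity))
  rw [(mirror_involutive hv).surjective.range_eq, Measure.restrict_univ] at h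
  have h' : MeasurePreserving (mirror v) (Measure.hausdorffMeasure (d : ℝ))
    (Measure.hausdorffMeasure (d : ℝ)) := ⟨(isometry_mirror hv).continuous.measurable, h⟩
  rw [hc]
  exact h'.smul_measure _

lemma measurableEmbedding_mirror (hv : v ≠ 0) : MeasurableEmbedding (mirror v) :=
  (isometry_mirror hv).isClosedEmbedding.measurableEmbedding

lemma volume_image_le_of_lipschitzOnWith {K : NNReal} {F : Momentum d → Momentum d}
    {A : Set (Momentum d)} (hF : LipschitzOnWith K F A) :
    volume (F '' A) ≤ (K : ENNReal) ^ d * volume A := by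
  obtain ⟨c, hc⟩ := volume_eq_smul_hausdorffMeasure d
  have h := hF.hausdorffMeasure_image_le (d := d) (by positivity)
  rw [hc]
  simp only [Measure.smul_apply, ENNReal.smul_def, smul_eq_mul, ENNReal.rpow_natCast] at h ⊢
  calc _ ≤ (c : ENNReal) * _ := mul_le_mul_right h _
    _ = _ := by ring

/-- Two points at different distances from the origin are exchanged by some `mirror v`. -/
lemma exists_mirror_eq {x y : Momentum d} (hxy : ‖y‖ < ‖x‖) :
    ∃ v : Momentum d, mirror v x = y ∧ ‖x‖ - ‖y‖ ≤ ‖v‖ ∧ ‖v‖ ≤ ‖x‖ + ‖y‖ := by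
  have h0 : 0 < ‖x - y‖ := by
    have := norm_sub_norm_le x y
    linarith
  have h1 : 0 < ‖x‖ ^ 2 - ‖y‖ ^ 2 := by nlinarith [norm_nonneg y]
  -- The reflection exchanging `x` and `y` has normal `x - y` and sends the origin to `a • (x - y)`.
  -- The length of this vector is then bounded on both sides by the triangle inequality.
  set a := (‖x‖ ^ 2 - ‖y‖ ^ 2) / ‖x - y‖ ^ 2 with ha
  have hapos : 0 < a := by positivity
  have hv : ‖a • (x - y)‖ = (‖x‖ - ‖y‖) * (‖x‖ + ‖y‖) / ‖x - y‖ := by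
    rw [norm_smul, Real.norm_of_nonneg hapos.le, ha]
    field_simp
    ring
  refine ⟨a • (x - y), ?_, ?_, ?_⟩
  · have h2 : mirrorSide (a • (x - y)) x = - (a * ‖x - y‖ ^ 2) := by
      have e1 : inner ℝ (x - y) x = (‖x‖ ^ 2 - ‖y‖ ^ 2 + ‖x - y‖ ^ 2) / 2 := by
        rw [norm_sub_sq_real, inner_sub_left, real_inner_self_eq_norm_sq, real_inner_comm]; ring
      have e2 : ‖x‖ ^ 2 - ‖y‖ ^ 2 = a * ‖x - y‖ ^ 2 := by rw [ha]; field_simp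
      rw [mirrorSide, norm_smul, mul_pow, Real.norm_of_nonneg hapos.le, real_inner_smul_left, e1, e2]
      ring
    rw [mirror, h2, norm_smul, Real.norm_of_nonneg hapos.le, smul_smul,
      show -(a * ‖x - y‖ ^ 2) / (a * ‖x - y‖) ^ 2 * a = -1 by field_simp]
    simp
  · rw [hv, le_div_iff₀ h0]
    have := norm_sub_le x y
    gcongr
  · rw [hv, div_le_iff₀ h0, mul_comm]
    have := norm_sub_norm_le x y
    gcongr

/-- With `e = v / ‖v‖` the image is `x + v - 2⟨e, x⟩e`. Normalisation is Lipschitz with constant `2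
/ η` where `‖v‖ ≥ η`, and the last term varies by at most `4R` times the variation of `e`; this
gives `1 + 8R / η`. -/
lemma lipschitzOnWith_mirror {x : Momentum d} {R η : ℝ} (hη : 0 < η) (hx : ‖x‖ ≤ R) :
    LipschitzOnWith (Real.toNNReal (1 + 8 * R / η)) (fun v => mirror v x) {v | η ≤ ‖v‖} := by
  have hR : 0 ≤ R := (norm_nonneg x).trans hx
  refine LipschitzOnWith.of_dist_le_mul fun v hv w hw => ?_
  rw [Real.coe_toNNReal _ (by positivity), dist_eq_norm, dist_eq_norm]
  have hv0 : 0 < ‖v‖ := hη.trans_le hv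
  have hw0 : 0 < ‖w‖ := hη.trans_le hw
  have key : ∀ u : Momentum d, 0 < ‖u‖ → 
      mirror u x = x + u - (2 * inner ℝ ((‖u‖⁻¹) • u) x) • ((‖u‖⁻¹) • u) := by
    intro u hu
    rw [mirror, mirrorSide, sub_div, div_self (by positivity), sub_smul, one_smul,
      real_inner_smul_left, smul_smul, add_sub_assoc]
    congr 3
    field_simp
  set a := (‖v‖⁻¹) • v with ha
  set b := (‖w‖⁻¹) • w with hb
  have hna : ‖a‖ = 1 := by rw [ha, norm_smul, norm_inv, norm_norm]; field_simp
  have hnb : ‖b‖ = 1 := by rw [hb, norm_smul, norm_inv, norm_norm]; field_simp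
  have hab : ‖a - b‖ ≤ 2 / η * ‖v - w‖ := by
    have : a - b = ‖v‖⁻¹ • (v - w) + ((‖w‖ - ‖v‖) * ‖v‖⁻¹) • b := by
      rw [hb, smul_smul, ha, smul_sub, sub_mul, sub_mul, sub_smul]
      rw [show ‖w‖ * ‖v‖⁻¹ * ‖w‖⁻¹ = ‖v‖⁻¹ by field_simp,
        show ‖v‖ * ‖v‖⁻¹ * ‖w‖⁻¹ = ‖w‖⁻¹ by field_simp]
      abel
    rw [this]
    refine (norm_add_le _ _).trans ?_
    rw [norm_smul, norm_smul, hnb, norm_mul, norm_inv, norm_norm]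
    have h1 : ‖‖w‖ - ‖v‖‖ ≤ ‖v - w‖ := by
      rw [norm_sub_rev v w]; exact abs_norm_sub_norm_le w v
    have h2 : ‖v‖⁻¹ ≤ η⁻¹ := inv_anti₀ hη hv
    calc ‖v‖⁻¹ * ‖v - w‖ + ‖‖w‖ - ‖v‖‖ * ‖v‖⁻¹ * 1
        ≤ η⁻¹ * ‖v - w‖ + ‖v - w‖ * η⁻¹ * 1 := by gcongr
      _ = _ := by ring
  have hdiff : mirror v x - mirror w x =
      (v - w) - ((2 * inner ℝ a x) • (a - b) + (2 * inner ℝ (a - b) x) • b) := by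
    rw [key v hv0, key w hw0, ← ha, ← hb, inner_sub_left, mul_sub, sub_smul, smul_sub]
    abel
  rw [hdiff]
  have i1 : |inner ℝ a x| ≤ R := (abs_real_inner_le_norm a x).trans (by rw [hna, one_mul]; exact hx)
  have i2 : |inner ℝ (a - b) x| ≤ ‖a - b‖ * R :=
    (abs_real_inner_le_norm _ x).trans (by gcongr)
  calc _ ≤ ‖v - w‖ + (‖(2 * inner ℝ a x) • (a - b)‖ + ‖(2 * inner ℝ (a - b) x) • b‖) :=
        (norm_sub_le _ _).trans (by gcongr; exact norm_add_le _ _)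
    _ = ‖v - w‖ + (2 * |inner ℝ a x| * ‖a - b‖ + 2 * |inner ℝ (a - b) x|) := by
        rw [norm_smul, norm_smul, hnb]; simp
    _ ≤ ‖v - w‖ + (2 * R * ‖a - b‖ + 2 * (‖a - b‖ * R)) := by gcongr
    _ = ‖v - w‖ + 4 * R * ‖a - b‖ := by ring
    _ ≤ ‖v - w‖ + 4 * R * (2 / η * ‖v - w‖) := by gcongr
    _ = _ := by ring

end Mirror

/-! ### Transfer of mass across a mirror -/

/-- Move as much as possible of the mass of `0 ≤ f ≤ 1` to the side of the mirror that contains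
the origin. -/
noncomputable def transfer {d : ℕ} (v : Momentum d) (f : Momentum d → ℝ) (x : Momentum d) : ℝ :=
  if 0 < mirrorSide v x then min 1 (f x + f (mirror v x))
  else if mirrorSide v x < 0 then max 0 (f x + f (mirror v x) - 1) else f x

/-- The double integral of `φ ‖x - y‖ f x f y`. -/
noncomputable def radialEnergy {d : ℕ} (φ : ℝ → ℝ) (f : Momentum d → ℝ) : ENNReal :=
  ∫⁻ x, ∫⁻ y, ENNReal.ofReal (φ ‖x - y‖ * (f x * f y))

section Transfer

variable {d : ℕ} {v : Momentum d} {f : Momentum d → ℝ}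

lemma transfer_of_pos {x : Momentum d} (h : 0 < mirrorSide v x) :
    transfer v f x = min 1 (f x + f (mirror v x)) := if_pos h

lemma transfer_of_neg {x : Momentum d} (h : mirrorSide v x < 0) :
    transfer v f x = max 0 (f x + f (mirror v x) - 1) := by
  rw [transfer, if_neg h.not_gt, if_pos h]

lemma transfer_of_zero {x : Momentum d} (h : mirrorSide v x = 0) : transfer v f x = f x := by
  simp [transfer, h]

lemma mirror_of_zero {x : Momentum d} (h : mirrorSide v x = 0) : mirror v x = x := by
  simp [mirror, h]

lemma transfer_add_transfer (hv : v ≠ 0) (x : Momentum d) :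
    transfer v f x + transfer v f (mirror v x) = f x + f (mirror v x) := by
  rcases lt_trichotomy (mirrorSide v x) 0 with h | h | h
  · rw [transfer_of_neg h, transfer_of_pos (by rw [mirrorSide_mirror hv]; linarith),
      mirror_mirror hv]
    rcases le_total (f x + f (mirror v x)) 1 with h1 | h1
    · rw [max_eq_left (by linarith), min_eq_right (by linarith)]; ring
    · rw [max_eq_right (by linarith), min_eq_left (by linarith)]; ring
  · rw [mirror_of_zero h, transfer_of_zero h]
  · rw [transfer_of_pos h, transfer_of_neg (by rw [mirrorSide_mirror hv]; linarith),
      mirror_mirror hv]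
    rcases le_total (f x + f (mirror v x)) 1 with h1 | h1
    · rw [max_eq_left (by linarith), min_eq_right (by linarith)]; ring
    · rw [max_eq_right (by linarith), min_eq_left (by linarith)]; ring

lemma transfer_mem_Icc (hf : ∀ x, f x ∈ Set.Icc (0 : ℝ) 1) (x : Momentum d) :
    transfer v f x ∈ Set.Icc (0 : ℝ) 1 := by
  have h1 := hf x
  have h2 := hf (mirror v x)
  simp only [Set.mem_Icc] at *
  unfold transfer
  split_ifs
  · exact ⟨le_min zero_le_one (by linarith), min_le_left _ _⟩
  · exact ⟨le_max_left _ _, max_le zero_le_one (by linarith)⟩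
  · exact h1

lemma measurable_mirror_right (v : Momentum d) : Measurable (mirror v) :=
  measurable_mirror.comp measurable_prodMk_left

lemma measurable_mirrorSide (v : Momentum d) : Measurable (mirrorSide v) :=
  Measurable.of_uncurry_left (f := mirrorSide) continuous_mirrorSide.measurable

lemma measurable_transfer (hf : Measurable f) : Measurable (transfer v f) := by
  have h1 := hf.comp (measurable_mirror_right v)
  have h2 := measurable_mirrorSide v
  exact Measurable.ite (measurableSet_lt measurable_const h2)
    (measurable_const.min (hf.add h1)) (Measurable.ite (measurableSet_lt h2 measurable_const)
    (measurable_const.max ((hf.add h1).sub_const 1)) hf)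

/-- The odd part of `transfer v f` dominates that of `f` and is positive on the side of the
origin. -/
lemma transfer_sub_transfer (hv : v ≠ 0) (hf : ∀ x, f x ∈ Set.Icc (0 : ℝ) 1) {x : Momentum d}
    (h : 0 < mirrorSide v x) :
    |f x - f (mirror v x)| ≤ transfer v f x - transfer v f (mirror v x) := by
  have h1 := hf x
  have h2 := hf (mirror v x)
  simp only [Set.mem_Icc] at h1 h2
  rw [transfer_of_pos h, transfer_of_neg (by rw [mirrorSide_mirror hv]; linarith),
      mirror_mirror hv, abs_le]
  rcases le_total (f x + f (mirror v x)) 1 with h3 | h3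
  · rw [max_eq_left (by linarith), min_eq_right (by linarith)]; constructor <;> linarith
  · rw [max_eq_right (by linarith), min_eq_left (by linarith)]; constructor <;> linarith

lemma two_mul_lintegral_eq (hv : v ≠ 0) {g : Momentum d → ENNReal} (hg : Measurable g) :
    2 * ∫⁻ x, g x = ∫⁻ x, (g x + g (mirror v x)) := by
  rw [lintegral_add_left hg,
    (measurePreserving_mirror hv).lintegral_comp_emb (measurableEmbedding_mirror hv), two_mul]

/-- On the same side of the mirror the kernel difference is nonnegative and `transfer` does not
decrease the product of the odd parts; on opposite sides both signs flip. The excluded points are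
those where a distance vanishes, and `φ` is monotone only on positive distances. -/
lemma mul_odd_le_of_sides {φ : ℝ → ℝ} (hφ : AntitoneOn φ (Set.Ioi 0)) (hv : v ≠ 0)
    (hf : ∀ x, f x ∈ Set.Icc (0 : ℝ) 1) {x y : Momentum d} (hxy : y ≠ x) (hxy' : y ≠ mirror v x) :
    (φ ‖x - y‖ - φ ‖x - mirror v y‖) * ((f x - f (mirror v x)) * (f y - f (mirror v y))) ≤
    (φ ‖x - y‖ - φ ‖x - mirror v y‖) * ((transfer v f x - transfer v f (mirror v x)) *
      (transfer v f y - transfer v f (mirror v y))) := by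
  have hn : 0 < ‖v‖ ^ 2 := by positivity
  have p1 : 0 < ‖x - y‖ := norm_pos_iff.2 (sub_ne_zero.2 hxy.symm)
  have p2 : 0 < ‖x - mirror v y‖ := norm_pos_iff.2 (sub_ne_zero.2 fun h => hxy' (by
    rw [h, mirror_mirror hv]))
  have hsq := norm_sub_mirror_sq hv x y
  -- the differences at a point on the far side
  have hneg : ∀ z, mirrorSide v z < 0 →
      |f z - f (mirror v z)| ≤ -(transfer v f z - transfer v f (mirror v z)) := by
    intro z hz
    have := transfer_sub_transfer hv hf (x := mirror v z) (by rw [mirrorSide_mirror hv]; linarith)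
    rw [mirror_mirror hv, abs_sub_comm] at this
    linarith
  have habs : ∀ a b A B : ℝ, |a| ≤ A → |b| ≤ B → a * b ≤ A * B := fun a b A B ha hb =>
    (le_abs_self _).trans (by rw [abs_mul]; gcongr; exact (abs_nonneg _).trans ha)
  have habs' : ∀ a b A B : ℝ, |a| ≤ A → |b| ≤ B → -(A * B) ≤ a * b := fun a b A B ha hb => by
    have := habs (-a) b A B (by rwa [abs_neg]) hb
    linarith
  have hsame : 0 < mirrorSide v x * mirrorSide v y → φ ‖x - mirror v y‖ ≤ φ ‖x - y‖ := by
    intro h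
    refine hφ p1 p2 ((sq_le_sq₀ p1.le p2.le).1 ?_)
    rw [hsq]
    have : 0 < mirrorSide v x * mirrorSide v y / ‖v‖ ^ 2 := by positivity
    linarith
  have hopp : mirrorSide v x * mirrorSide v y < 0 → φ ‖x - y‖ ≤ φ ‖x - mirror v y‖ := by
    intro h
    refine hφ p2 p1 ((sq_le_sq₀ p2.le p1.le).1 ?_)
    rw [hsq]
    have : mirrorSide v x * mirrorSide v y / ‖v‖ ^ 2 < 0 := div_neg_of_neg_of_pos h hn
    linarith
  rcases lt_trichotomy (mirrorSide v x) 0 with h | h | h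
  · rcases lt_trichotomy (mirrorSide v y) 0 with h' | h' | h'
    · refine mul_le_mul_of_nonneg_left ?_ (sub_nonneg.2 (hsame (mul_pos_of_neg_of_neg h h')))
      have := habs _ _ _ _ (hneg x h) (hneg y h')
      linarith
    · simp [mirror_of_zero h']
    · refine mul_le_mul_of_nonpos_left ?_ (sub_nonpos.2 (hopp (mul_neg_of_neg_of_pos h h')))
      have := habs' _ _ _ _ (hneg x h) (transfer_sub_transfer hv hf h')
      linarith
  · simp [mirror_of_zero h]
  · rcases lt_trichotomy (mirrorSide v y) 0 with h' | h' | h'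
    · refine mul_le_mul_of_nonpos_left ?_ (sub_nonpos.2 (hopp (mul_neg_of_pos_of_neg h h')))
      have := habs' _ _ _ _ (transfer_sub_transfer hv hf h) (hneg y h')
      linarith
    · simp [mirror_of_zero h']
    · exact mul_le_mul_of_nonneg_left (habs _ _ _ _ (transfer_sub_transfer hv hf h)
        (transfer_sub_transfer hv hf h')) (sub_nonneg.2 (hsame (mul_pos h h')))

lemma measurable_radialIntegrand {φ : ℝ → ℝ} (hφ : Measurable φ) {f g : Momentum d → ℝ}
    (hf : Measurable f) (hg : Measurable g) :
    Measurable fun p : Momentum d × Momentum d =>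
      ENNReal.ofReal (φ ‖p.1 - p.2‖ * (f p.1 * g p.2)) := by
  fun_prop

lemma four_mul_lintegral_lintegral_eq (hv : v ≠ 0) {K : Momentum d → Momentum d → ENNReal}
    (hK : Measurable (Function.uncurry K)) :
    4 * ∫⁻ x, ∫⁻ y, K x y = ∫⁻ x, ∫⁻ y, (K x y + K x (mirror v y) +
      (K (mirror v x) y + K (mirror v x) (mirror v y))) := by
  have hmy : ∀ x, Measurable (K x) := fun x => hK.of_uncurry_left
  have hmx : Measurable fun x => ∫⁻ y, K x y := hK.lintegral_prod_right
  have hσ := measurable_mirror_right v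
  have e1 := two_mul_lintegral_eq hv hmx
  have e2 := lintegral_const_mul (μ := volume) 2 (hmx.add (hmx.comp hσ))
  rw [show (4 : ENNReal) = 2 * 2 by norm_num, mul_assoc, e1]
  refine e2.symm.trans (lintegral_congr fun x => ?_)
  have e3 := two_mul_lintegral_eq hv (hmy x)
  have e4 := two_mul_lintegral_eq hv (hmy (mirror v x))
  have e5 := lintegral_add_left (μ := volume) ((hmy x).add ((hmy x).comp hσ))
    (fun y => K (mirror v x) y + K (mirror v x) (mirror v y))
  exact (mul_add _ _ _).trans ((congrArg₂ _ e3 e4).trans e5.symm)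

/-- Averaging over the four reflected pairs separates the even part of `f`, which `transfer`
preserves, from the odd part; only the second term has to be compared. -/
lemma four_mul_radialEnergy {φ : ℝ → ℝ} (hφm : Measurable φ) (hφ0 : ∀ r, 0 ≤ φ r) (hv : v ≠ 0)
    (hfm : Measurable f) (hf : ∀ x, f x ∈ Set.Icc (0 : ℝ) 1) :
    4 * radialEnergy φ f = ∫⁻ x, ∫⁻ y, ENNReal.ofReal (
      (φ ‖x - y‖ + φ ‖x - mirror v y‖) / 2 *
        ((f x + f (mirror v x)) * (f y + f (mirror v y))) +
      (φ ‖x - y‖ - φ ‖x - mirror v y‖) *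
        ((f x - f (mirror v x)) * (f y - f (mirror v y))) / 2) := by
  rw [radialEnergy, four_mul_lintegral_lintegral_eq hv
    (K := fun x y => ENNReal.ofReal (φ ‖x - y‖ * (f x * f y)))
    (measurable_radialIntegrand hφm hfm hfm)]
  refine lintegral_congr fun x => lintegral_congr fun y => ?_
  have n : ∀ a b z : Momentum d, 0 ≤ φ ‖z‖ * (f a * f b) := fun a b z =>
    mul_nonneg (hφ0 _) (mul_nonneg (hf a).1 (hf b).1)
  rw [← ENNReal.ofReal_add (n _ _ _) (n _ _ _), ← ENNReal.ofReal_add (n _ _ _) (n _ _ _),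
    ← ENNReal.ofReal_add (add_nonneg (n _ _ _) (n _ _ _)) (add_nonneg (n _ _ _) (n _ _ _)),
    norm_mirror_sub hv, norm_mirror_sub_mirror hv]
  congr 1
  ring

lemma radialEnergy_le_transfer {φ : ℝ → ℝ} (hφm : Measurable φ) (hφ0 : ∀ r, 0 ≤ φ r)
    (hφ : AntitoneOn φ (Set.Ioi 0)) (hd : d ≠ 0) (hv : v ≠ 0)
    (hfm : Measurable f) (hf : ∀ x, f x ∈ Set.Icc (0 : ℝ) 1) :
    radialEnergy φ f ≤ radialEnergy φ (transfer v f) := by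
  have : NeZero d := ⟨hd⟩
  refine (ENNReal.mul_le_mul_iff_right (a := 4) (by norm_num) (by norm_num)).1 ?_
  rw [four_mul_radialEnergy hφm hφ0 hv hfm hf, four_mul_radialEnergy hφm hφ0 hv
    (measurable_transfer hfm) (transfer_mem_Icc hf)]
  refine lintegral_mono fun x => lintegral_mono_ae ?_
  have h1 : ∀ᵐ y : Momentum d, y ≠ x := by simp [ae_iff]
  have h2 : ∀ᵐ y : Momentum d, y ≠ mirror v x := by simp [ae_iff]
  filter_upwards [h1, h2] with y hy hy'
  refine ENNReal.ofReal_le_ofReal ?_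
  rw [transfer_add_transfer hv, transfer_add_transfer hv]
  have := mul_odd_le_of_sides hφ hv hf hy hy'
  linarith

lemma lintegral_transfer (hv : v ≠ 0) (hfm : Measurable f) (hf : ∀ x, f x ∈ Set.Icc (0 : ℝ) 1) :
    ∫⁻ x, ENNReal.ofReal (transfer v f x) = ∫⁻ x, ENNReal.ofReal (f x) := by
  refine (ENNReal.mul_right_inj (a := 2) (by norm_num) (by norm_num)).1 ?_
  rw [two_mul_lintegral_eq hv (measurable_transfer hfm).ennreal_ofReal,
    two_mul_lintegral_eq hv hfm.ennreal_ofReal]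
  refine lintegral_congr fun x => ?_
  rw [← ENNReal.ofReal_add (transfer_mem_Icc hf _).1 (transfer_mem_Icc hf _).1,
    ← ENNReal.ofReal_add (hf _).1 (hf _).1, transfer_add_transfer hv]

/-- Beyond radius `R`, a point on the far side keeps only mass in excess of `1`, and there is none;
a point on the near side has its mirror image still farther out. Bounded support thus survives
repeated transfers. -/
lemma transfer_eq_zero_of_norm_gt (hv : v ≠ 0) {R : ℝ} (hf : ∀ x, f x ∈ Set.Icc (0 : ℝ) 1)
    (hR : ∀ x, R < ‖x‖ → f x = 0) {x : Momentum d} (hx : R < ‖x‖) : transfer v f x = 0 := by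
  rcases lt_trichotomy (mirrorSide v x) 0 with h | h | h
  · rw [transfer_of_neg h, hR x hx, max_eq_left]
    linarith [(hf (mirror v x)).2]
  · rw [transfer_of_zero h, hR x hx]
  · rw [transfer_of_pos h, hR x hx, hR _ (hx.trans ((mirrorSide_pos_iff hv x).1 h))]
    simp

/-- The mass moved into a centred ball by `transfer`. -/
lemma transfer_deficit_add_le (hv : v ≠ 0) (hfm : Measurable f)
    (hf : ∀ x, f x ∈ Set.Icc (0 : ℝ) 1) (r : ℝ) :
    (∫⁻ x in (Metric.ball 0 r)ᶜ, ENNReal.ofReal (transfer v f x)) +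
      ∫⁻ x in (Metric.ball 0 r)ᶜ, ENNReal.ofReal (f x) *
        (Metric.ball 0 r).indicator (fun y => ENNReal.ofReal (1 - f y)) (mirror v x)
      ≤ ∫⁻ x in (Metric.ball 0 r)ᶜ, ENNReal.ofReal (f x) := by
  set B : Set (Momentum d) := Metric.ball 0 r with hB
  have hBm : MeasurableSet B := measurableSet_ball
  have m1 : Measurable fun x => ENNReal.ofReal (transfer v f x) :=
    (measurable_transfer hfm).ennreal_ofReal
  have m2 : Measurable fun x => ENNReal.ofReal (f x) := hfm.ennreal_ofReal
  have m3 : Measurable fun x => ENNReal.ofReal (f x) *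
        B.indicator (fun y => ENNReal.ofReal (1 - f y)) (mirror v x) :=
    m2.mul (((measurable_const.sub hfm).ennreal_ofReal.indicator hBm).comp
      (measurable_mirror_right v))
  rw [← lintegral_add_left m1, ← lintegral_indicator hBm.compl, ← lintegral_indicator hBm.compl]
  refine (ENNReal.mul_le_mul_iff_right (a := 2) (by norm_num) (by norm_num)).1 ?_
  refine ((two_mul_lintegral_eq hv ((m1.add m3).indicator hBm.compl)).trans_le ?_).trans
    (two_mul_lintegral_eq hv (m2.indicator hBm.compl)).ge
  refine lintegral_mono fun x => ?_
  have hT := transfer_mem_Icc (v := v) hf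
  -- one point inside the ball and its mirror image outside
  have key : ∀ z, z ∈ B → mirror v z ∉ B →
      ENNReal.ofReal (transfer v f (mirror v z)) + ENNReal.ofReal (f (mirror v z)) *
        ENNReal.ofReal (1 - f z) ≤ ENNReal.ofReal (f (mirror v z)) := by
    intro z hz hz'
    have hpos : 0 < mirrorSide v z := by
      rw [mirrorSide_pos_iff hv]
      simp only [hB, Metric.mem_ball, dist_zero_right, not_lt] at hz hz'
      linarith
    rw [← ENNReal.ofReal_mul (hf _).1, ← ENNReal.ofReal_add (hT _).1
      (mul_nonneg (hf _).1 (sub_nonneg.2 (hf _).2)),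
      transfer_of_neg (by rw [mirrorSide_mirror hv]; linarith), mirror_mirror hv]
    refine ENNReal.ofReal_le_ofReal ?_
    have h1 := hf z
    have h2 := hf (mirror v z)
    simp only [Set.mem_Icc] at h1 h2
    -- For `a, b` in `[0, 1]`, `a + b - 1 ≤ ab` is `(1 - a)(1 - b) ≥ 0`. So the mass leaving the
    -- outer point is at least `a(1 - b)`.
    have : max 0 (f (mirror v z) + f z - 1) ≤ f (mirror v z) * f z :=
      max_le (mul_nonneg h2.1 h1.1) (by nlinarith)
    linarith
  -- If both points lie in the ball nothing is counted; if neither does, mass only moves between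
  -- outside points. The gain comes from the mixed pairs.
  by_cases hx : x ∈ B <;> by_cases hx' : mirror v x ∈ B
  · simp [hx, hx']
  · simpa [hx, hx', mirror_mirror hv] using key x hx hx'
  · have := key _ hx' (by rwa [mirror_mirror hv])
    rw [mirror_mirror hv] at this
    simpa [hx, hx', mirror_mirror hv] using this
  · simp only [Set.indicator_of_mem (show x ∈ Bᶜ from hx),
      Set.indicator_of_mem (show mirror v x ∈ Bᶜ from hx'), Pi.add_apply, Set.indicator_of_notMem hx',
      mirror_mirror hv, Set.indicator_of_notMem hx, mul_zero, add_zero]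
    rw [← ENNReal.ofReal_add (hT _).1 (hT _).1, ← ENNReal.ofReal_add (hf _).1 (hf _).1,
      transfer_add_transfer hv]

end Transfer

/-! ### The rearrangement inequality for balls -/

section Rearrangement

variable {d : ℕ} {v : Momentum d} {f : Momentum d → ℝ}

/-- The hole left inside the ball equals the mass outside it. This common value, the deficit, serves
below as the distance to the ball. -/
lemma lintegral_ball_one_sub_eq {r : ℝ} (hfm : Measurable f) (hf : ∀ x, f x ∈ Set.Icc (0 : ℝ) 1)
    (hmass : ∫⁻ x, ENNReal.ofReal (f x) = volume (Metric.ball (0 : Momentum d) r)) :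
    ∫⁻ x in Metric.ball 0 r, ENNReal.ofReal (1 - f x) =
      ∫⁻ x in (Metric.ball 0 r)ᶜ, ENNReal.ofReal (f x) := by
  have hfin : ∫⁻ x in Metric.ball 0 r, ENNReal.ofReal (f x) ≠ ⊤ :=
    ((setLIntegral_le_lintegral _ _).trans_lt (hmass ▸ measure_ball_lt_top)).ne
  have h1 : (∫⁻ x in Metric.ball 0 r, ENNReal.ofReal (f x)) +
      ∫⁻ x in Metric.ball 0 r, ENNReal.ofReal (1 - f x) =
      volume (Metric.ball (0 : Momentum d) r) := by
    rw [← lintegral_add_left hfm.ennreal_ofReal, ← setLIntegral_one]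
    refine lintegral_congr fun x => ?_
    rw [← ENNReal.ofReal_add (hf x).1 (sub_nonneg.2 (hf x).2)]
    simp
  have h2 := lintegral_add_compl (μ := volume) (fun x => ENNReal.ofReal (f x))
    (measurableSet_ball (x := (0 : Momentum d)) (ε := r))
  exact (ENNReal.add_right_inj hfin).1 (h1.trans (hmass.symm.trans h2.symm))

/-- The images of a point under the mirrors spread out over balls. -/
lemma lintegral_ball_le_lintegral_mirror {r r' R : ℝ} (hr : r' < r) {x : Momentum d}
    (hx : r ≤ ‖x‖) (hxR : ‖x‖ ≤ R) {k : Momentum d → ENNReal} (hk : Measurable k) :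
    ∫⁻ y in Metric.ball 0 r', k y ≤ (Real.toNNReal (1 + 8 * R / (r - r')) : ENNReal) ^ d *
      ∫⁻ w in {w | r - r' ≤ ‖w‖ ∧ ‖w‖ ≤ 2 * R}, k (mirror w x) := by
  set A : Set (Momentum d) := {w | r - r' ≤ ‖w‖ ∧ ‖w‖ ≤ 2 * R} with hA
  have hF : Measurable fun w : Momentum d => mirror w x :=
    measurable_mirror.comp measurable_prodMk_right
  set C : ENNReal := (Real.toNNReal (1 + 8 * R / (r - r')) : ENNReal) ^ d
  -- The map `w ↦ mirror w x` sends the annulus `A` onto a set containing the smaller ball and is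
  -- Lipschitz on `A`, so its image measure dominates a multiple of volume on that ball.
  have hle : volume.restrict (Metric.ball (0 : Momentum d) r') ≤
      C • (Measure.map (fun w => mirror w x) (volume.restrict A)) := by
    refine Measure.le_iff.2 fun S hS => ?_
    rw [Measure.smul_apply, Measure.map_apply hF hS, Measure.restrict_apply hS,
      Measure.restrict_apply (hF hS), smul_eq_mul]
    have hlip := (lipschitzOnWith_mirror (sub_pos.2 hr) hxR).mono
      (show (fun w => mirror w x) ⁻¹' S ∩ A ⊆ {w | r - r' ≤ ‖w‖} from fun w hw => hw.2.1)
    refine (measure_mono ?_).trans (volume_image_le_of_lipschitzOnWith hlip)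
    rintro y ⟨hyS, hy⟩
    rw [Metric.mem_ball, dist_zero_right] at hy
    obtain ⟨w, hw, h1, h2⟩ := exists_mirror_eq (hy.trans (hr.trans_le hx))
    refine ⟨w, ⟨by rwa [Set.mem_preimage, hw], by linarith, by linarith⟩, hw⟩
  calc ∫⁻ y in Metric.ball 0 r', k y
      ≤ ∫⁻ y, k y ∂(C • (Measure.map (fun w => mirror w x) (volume.restrict A))) :=
        lintegral_mono' hle le_rfl
    _ = _ := by rw [lintegral_smul_measure, lintegral_map hk hF, smul_eq_mul]

/-- States on a bounded region whose mass outside the centred ball is at least `L` can be improved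
by a fixed amount. -/
lemma exists_transfer_deficit_le (r R : ℝ) {L : ENNReal} (hL : L ≠ 0) :
    ∃ c : ENNReal, c ≠ 0 ∧ ∀ f : Momentum d → ℝ, Measurable f → (∀ x, f x ∈ Set.Icc (0 : ℝ) 1) →
      (∀ x, R < ‖x‖ → f x = 0) →
      (∫⁻ x, ENNReal.ofReal (f x) = volume (Metric.ball (0 : Momentum d) r)) →
      L ≤ ∫⁻ x in (Metric.ball 0 r)ᶜ, ENNReal.ofReal (f x) →
      ∃ v : Momentum d, v ≠ 0 ∧
        (∫⁻ x in (Metric.ball 0 r)ᶜ, ENNReal.ofReal (transfer v f x)) + c ≤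
          ∫⁻ x in (Metric.ball 0 r)ᶜ, ENNReal.ofReal (f x) := by
  rcases eq_or_ne L ⊤ with rfl | hLtop
  · refine ⟨1, one_ne_zero, fun f _ _ _ hmass hf => ?_⟩
    exact absurd ((top_le_iff.1 hf) ▸ setLIntegral_le_lintegral _ _)
      (not_le.2 (hmass ▸ measure_ball_lt_top))
  -- a slightly smaller ball
  obtain ⟨r', hr', hvol⟩ : ∃ r' < r, volume (Metric.ball (0 : Momentum d) r) ≤
      volume (Metric.ball (0 : Momentum d) r') + L / 2 := by
    have hL2 : L / 2 ≠ 0 := by simp [hL]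
    have hU : Metric.ball (0 : Momentum d) r = ⋃ n : ℕ, Metric.ball 0 (r - 1 / ((n : ℝ) + 1)) := by
      ext x
      simp only [Metric.mem_ball, Set.mem_iUnion]
      constructor
      · intro h
        obtain ⟨n, hn⟩ := exists_nat_one_div_lt (sub_pos.2 h)
        exact ⟨n, by linarith⟩
      · rintro ⟨n, hn⟩
        have : 0 < 1 / ((n : ℝ) + 1) := by positivity
        linarith
    have hmono : Monotone fun n : ℕ => Metric.ball (0 : Momentum d) (r - 1 / ((n : ℝ) + 1)) := by
      intro m n hmn
      refine Metric.ball_subset_ball ?_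
      have : 1 / ((n : ℝ) + 1) ≤ 1 / ((m : ℝ) + 1) := by gcongr
      linarith
    by_contra! hcon
    have h1 : volume (Metric.ball (0 : Momentum d) r) + L / 2 ≤
        volume (Metric.ball (0 : Momentum d) r) := by
      conv_lhs => rw [hU, hmono.measure_iUnion, ENNReal.iSup_add]
      refine iSup_le fun n => (hcon _ ?_).le
      have : 0 < 1 / ((n : ℝ) + 1) := by positivity
      linarith
    exact absurd h1 (not_le.2 (ENNReal.lt_add_right measure_ball_lt_top.ne hL2))
  set A : Set (Momentum d) := {w | r - r' ≤ ‖w‖ ∧ ‖w‖ ≤ 2 * R} with hA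
  set C : ENNReal := (Real.toNNReal (1 + 8 * R / (r - r')) : ENNReal) ^ d with hC
  have hCtop : C ≠ ⊤ := ENNReal.pow_ne_top ENNReal.coe_ne_top
  have hAfin : volume A ≠ ⊤ := by
    refine ((measure_mono (t := Metric.closedBall 0 (2 * R)) fun w hw => ?_).trans_lt
      measure_closedBall_lt_top).ne
    simpa using hw.2
  have hAm : MeasurableSet A :=
    (measurableSet_le measurable_const measurable_norm).inter
      (measurableSet_le measurable_norm measurable_const)
  -- Here `L` bounds the outside mass from below and `L / 2` will bound the hole in the smaller
  -- ball. If no mirror gained `c`, averaging over `w ∈ A` would give `L * (L / 2) ≤ C * (c * volume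
  -- A)`, which this choice of `c` excludes.
  obtain ⟨c, hc0, hc⟩ := ENNReal.exists_nnreal_pos_mul_lt (ENNReal.mul_ne_top hCtop hAfin)
    (show L * (L / 2) ≠ 0 by simp [hL])
  refine ⟨c, by exact_mod_cast hc0.ne', fun f hfm hf hfR hmass hδ => ?_⟩
  set B : Set (Momentum d) := Metric.ball 0 r with hB
  have hBm : MeasurableSet B := measurableSet_ball
  set k : Momentum d → ENNReal := B.indicator fun y => ENNReal.ofReal (1 - f y) with hk
  have hkm : Measurable k := (measurable_const.sub hfm).ennreal_ofReal.indicator hBm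
  -- the defect of the smaller ball
  have hdef : L / 2 ≤ ∫⁻ y in Metric.ball 0 r', k y := by
    have h1 := lintegral_ball_one_sub_eq hfm hf hmass
    have h2 : ∫⁻ y in B, ENNReal.ofReal (1 - f y) = ∫⁻ y in B, k y :=
      setLIntegral_congr_fun hBm fun y hy => by simp [hk, hy]
    have hsub : Metric.ball (0 : Momentum d) r' ⊆ B := Metric.ball_subset_ball hr'.le
    have h3 : ∫⁻ y in B, k y ≤ (∫⁻ y in Metric.ball 0 r', k y) +
        volume (B \ Metric.ball 0 r') := by
      rw [← lintegral_inter_add_sdiff k B (measurableSet_ball (x := (0 : Momentum d)) (ε := r')),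
        Set.inter_eq_right.2 hsub]
      gcongr
      rw [← setLIntegral_one]
      refine lintegral_mono fun y => ?_
      refine Set.indicator_le_self' (fun _ _ => zero_le) y |>.trans ?_
      rw [← ENNReal.ofReal_one]
      exact ENNReal.ofReal_le_ofReal (by linarith [(hf y).1])
    have h4 : volume (B \ Metric.ball 0 r') ≤ L / 2 := by
      rw [measure_sdiff hsub measurableSet_ball.nullMeasurableSet measure_ball_lt_top.ne]
      exact tsub_le_iff_left.2 hvol
    have h5 : L / 2 + L / 2 ≤ (∫⁻ y in Metric.ball 0 r', k y) + L / 2 := by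
      rw [ENNReal.add_halves]
      exact hδ.trans (h1 ▸ h2 ▸ h3.trans (by gcongr))
    exact (ENNReal.add_le_add_iff_right (ENNReal.div_ne_top hLtop (by norm_num))).1 h5
  by_contra! hcon
  have hgain : ∀ w ∈ A, ∫⁻ x in Bᶜ, ENNReal.ofReal (f x) * k (mirror w x) ≤ c := by
    intro w hw
    have hw0 : w ≠ 0 := by
      rintro rfl
      have := hw.1
      rw [norm_zero] at this
      linarith
    have h1 := transfer_deficit_add_le hw0 hfm hf r
    have h2 := h1.trans_lt (hcon w hw0)
    exact (lt_of_add_lt_add_left h2).le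
  have hjoint : Measurable fun p : Momentum d × Momentum d =>
      ENNReal.ofReal (f p.2) * k (mirror p.1 p.2) :=
    (hfm.comp measurable_snd).ennreal_ofReal.mul (hkm.comp measurable_mirror)
  -- By Tonelli: for each outside point `x` with `‖x‖ ≤ R`, the images under the mirrors in `A`
  -- sweep over the hole in the smaller ball, and `f` vanishes at the other points.
  have hδpos : L * (L / 2) ≤ C * ∫⁻ w in A, ∫⁻ x in Bᶜ, ENNReal.ofReal (f x) * k (mirror w x) := by
    rw [lintegral_lintegral_swap hjoint.aemeasurable, ← lintegral_const_mul _
      hjoint.lintegral_prod_left']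
    refine (mul_le_mul_left hδ _).trans ?_
    rw [← lintegral_mul_const _ hfm.ennreal_ofReal]
    refine setLIntegral_mono_ae' hBm.compl (Filter.Eventually.of_forall fun x hx => ?_)
    have hx' : r ≤ ‖x‖ := by simpa [hB] using hx
    have hkx : Measurable fun w => k (mirror w x) :=
      hkm.comp (measurable_mirror.comp measurable_prodMk_right)
    simp only
    rw [lintegral_const_mul _ hkx]
    rcases le_or_gt ‖x‖ R with hxR | hxR
    · have := lintegral_ball_le_lintegral_mirror hr' hx' hxR hkm
      calc _ ≤ ENNReal.ofReal (f x) * (C * ∫⁻ w in A, k (mirror w x)) := by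
            gcongr
            exact hdef.trans this
        _ = _ := by ring
    · simp [hfR x hxR]
  have hup : ∫⁻ w in A, ∫⁻ x in Bᶜ, ENNReal.ofReal (f x) * k (mirror w x) ≤ c * volume A := by
    rw [← setLIntegral_const]
    exact setLIntegral_mono' hAm hgain
  refine absurd (hδpos.trans (mul_le_mul_right hup C)) (not_le.2 ?_)
  calc C * (c * volume A) = c * (C * volume A) := by ring
    _ < _ := hc

/-- A uniform bound on the potential of a density. -/
lemma lintegral_radial_mul_le {φ : ℝ → ℝ} (hφm : Measurable φ) (hφ0 : ∀ r, 0 ≤ φ r)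
    (hφ : AntitoneOn φ (Set.Ioi 0)) (hfm : Measurable f) (hf : ∀ x, f x ∈ Set.Icc (0 : ℝ) 1)
    (x : Momentum d) :
    ∫⁻ y, ENNReal.ofReal (φ ‖x - y‖ * f y) ≤
      (∫⁻ z in Metric.ball (0 : Momentum d) 1, ENNReal.ofReal (φ ‖z‖)) +
        ENNReal.ofReal (φ 1) * ∫⁻ y, ENNReal.ofReal (f y) := by
  have hm : Measurable fun z : Momentum d => ENNReal.ofReal (φ ‖z‖) := by fun_prop
  rw [← lintegral_indicator measurableSet_ball, ← lintegral_sub_left_eq_self (fun z =>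
    (Metric.ball (0 : Momentum d) 1).indicator (fun z => ENNReal.ofReal (φ ‖z‖)) z) x,
    ← lintegral_const_mul _ hfm.ennreal_ofReal, ← lintegral_add_right _
      (hfm.ennreal_ofReal.const_mul _)]
  refine lintegral_mono fun y => ?_
  rw [ENNReal.ofReal_mul (hφ0 _)]
  by_cases h : x - y ∈ Metric.ball (0 : Momentum d) 1
  · rw [Set.indicator_of_mem h]
    refine le_add_right (mul_le_of_le_one_right (zero_le) ?_)
    rw [← ENNReal.ofReal_one]
    exact ENNReal.ofReal_le_ofReal (hf y).2
  · rw [Set.indicator_of_notMem h, zero_add]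
    have h1 : 1 ≤ ‖x - y‖ := by simpa using h
    gcongr
    exact hφ (Set.mem_Ioi.2 one_pos) (Set.mem_Ioi.2 (one_pos.trans_le h1)) h1

/-- The product `f x * f y` is at most that of the ball indicators plus two terms in which one
factor is `f` restricted to the outside. The uniform bound on potentials makes these two terms
linear in the deficit. -/
lemma radialEnergy_le_add_deficit {φ : ℝ → ℝ} (hφm : Measurable φ) (hφ0 : ∀ r, 0 ≤ φ r)
    (hφ : AntitoneOn φ (Set.Ioi 0)) (hfm : Measurable f) (hf : ∀ x, f x ∈ Set.Icc (0 : ℝ) 1)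
    (r : ℝ) :
    radialEnergy φ f ≤ radialEnergy φ ((Metric.ball (0 : Momentum d) r).indicator 1) +
      2 * ((∫⁻ z in Metric.ball (0 : Momentum d) 1, ENNReal.ofReal (φ ‖z‖)) +
        ENNReal.ofReal (φ 1) * ∫⁻ y, ENNReal.ofReal (f y)) *
        ∫⁻ x in (Metric.ball 0 r)ᶜ, ENNReal.ofReal (f x) := by
  set B : Set (Momentum d) := Metric.ball 0 r with hB
  have hBm : MeasurableSet B := measurableSet_ball
  set C := (∫⁻ z in Metric.ball (0 : Momentum d) 1, ENNReal.ofReal (φ ‖z‖)) +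
        ENNReal.ofReal (φ 1) * ∫⁻ y, ENNReal.ofReal (f y) with hC
  set h : Momentum d → ℝ := Bᶜ.indicator f with hh
  have hhm : Measurable h := hfm.indicator hBm.compl
  have hh0 : ∀ x, 0 ≤ h x := fun x => Set.indicator_nonneg (fun _ _ => (hf _).1) x
  have h1m : Measurable (B.indicator (1 : Momentum d → ℝ)) := measurable_one.indicator hBm
  have hbound : ∫⁻ x, ∫⁻ y, ENNReal.ofReal (φ ‖x - y‖ * (h x * f y)) ≤
      C * ∫⁻ x in Bᶜ, ENNReal.ofReal (f x) := by
    rw [← lintegral_indicator hBm.compl, ← lintegral_const_mul _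
      (hfm.ennreal_ofReal.indicator hBm.compl)]
    refine lintegral_mono fun x => ?_
    have e : ∀ y, ENNReal.ofReal (φ ‖x - y‖ * (h x * f y)) =
        ENNReal.ofReal (h x) * ENNReal.ofReal (φ ‖x - y‖ * f y) := by
      intro y
      rw [← ENNReal.ofReal_mul (hh0 x)]
      congr 1
      ring
    simp_rw [e]
    rw [lintegral_const_mul _ (by fun_prop), mul_comm]
    have e2 : ENNReal.ofReal (h x) = Bᶜ.indicator (fun x => ENNReal.ofReal (f x)) x := by
      by_cases hx : x ∈ Bᶜ <;> simp only [hh, Set.indicator, hx, if_true, if_false,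
        ENNReal.ofReal_zero]
    rw [e2]
    gcongr
    exact lintegral_radial_mul_le hφm hφ0 hφ hfm hf x
  have hbound' : ∫⁻ x, ∫⁻ y, ENNReal.ofReal (φ ‖x - y‖ * (f x * h y)) ≤
      C * ∫⁻ x in Bᶜ, ENNReal.ofReal (f x) := by
    rw [lintegral_lintegral_swap (measurable_radialIntegrand hφm hfm hhm).aemeasurable]
    refine le_of_eq_of_le ?_ hbound
    refine lintegral_congr fun x => lintegral_congr fun y => ?_
    rw [norm_sub_rev, mul_comm (f y)]
  have hm1 := measurable_radialIntegrand hφm h1m h1m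
  have hm2 := measurable_radialIntegrand hφm hhm hfm
  calc radialEnergy φ f ≤ ∫⁻ x, ∫⁻ y, (ENNReal.ofReal (φ ‖x - y‖ *
        (B.indicator 1 x * B.indicator 1 y)) + (ENNReal.ofReal (φ ‖x - y‖ * (h x * f y)) +
        ENNReal.ofReal (φ ‖x - y‖ * (f x * h y)))) := by
        refine lintegral_mono fun x => lintegral_mono fun y => ?_
        have n1 : 0 ≤ φ ‖x - y‖ * (h x * f y) :=
          mul_nonneg (hφ0 _) (mul_nonneg (hh0 x) (hf y).1)
        have n2 : 0 ≤ φ ‖x - y‖ * (f x * h y) :=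
          mul_nonneg (hφ0 _) (mul_nonneg (hf x).1 (hh0 y))
        have n3 : 0 ≤ B.indicator (1 : Momentum d → ℝ) x * B.indicator 1 y :=
          mul_nonneg (Set.indicator_nonneg (by simp) _) (Set.indicator_nonneg (by simp) _)
        rw [← ENNReal.ofReal_add n1 n2, ← ENNReal.ofReal_add (mul_nonneg (hφ0 _) n3)
          (add_nonneg n1 n2)]
        refine ENNReal.ofReal_le_ofReal ?_
        rw [← mul_add, ← mul_add]
        refine mul_le_mul_of_nonneg_left ?_ (hφ0 _)
        have hx := hf x
        have hy := hf y
        simp only [Set.mem_Icc] at hx hy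
        have hxy : 0 ≤ f x * f y := mul_nonneg hx.1 hy.1
        by_cases h1 : x ∈ B <;> by_cases h2 : y ∈ B <;> simp [hh, h1, h2] <;> nlinarith
    _ = radialEnergy φ (B.indicator 1) +
        ((∫⁻ x, ∫⁻ y, ENNReal.ofReal (φ ‖x - y‖ * (h x * f y))) +
        ∫⁻ x, ∫⁻ y, ENNReal.ofReal (φ ‖x - y‖ * (f x * h y))) := by
        rw [radialEnergy, ← lintegral_add_left hm2.lintegral_prod_right',
          ← lintegral_add_left hm1.lintegral_prod_right']
        refine lintegral_congr fun x => ?_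
        rw [lintegral_add_left (by fun_prop), lintegral_add_left (by fun_prop)]
    _ ≤ radialEnergy φ (B.indicator 1) + (C * (∫⁻ x in Bᶜ, ENNReal.ofReal (f x)) +
        C * ∫⁻ x in Bᶜ, ENNReal.ofReal (f x)) := by gcongr
    _ = _ := by ring

/-- The class `𝒞` of competitors with at least the energy of `f` is stable under `transfer`. If
their deficits had a positive infimum, a nearly optimal member could be pushed below it by the
uniform gain. So the infimum is `0`, and no limit of densities has to be extracted. -/
lemma radialEnergy_le_ball_of_bounded {φ : ℝ → ℝ} (hφm : Measurable φ) (hφ0 : ∀ r, 0 ≤ φ r)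
    (hφ : AntitoneOn φ (Set.Ioi 0))
    (hloc : ∫⁻ z in Metric.ball (0 : Momentum d) 1, ENNReal.ofReal (φ ‖z‖) ≠ ⊤) (hd : d ≠ 0)
    (hfm : Measurable f) (hf : ∀ x, f x ∈ Set.Icc (0 : ℝ) 1) {r R : ℝ}
    (hfR : ∀ x, R < ‖x‖ → f x = 0)
    (hmass : ∫⁻ x, ENNReal.ofReal (f x) = volume (Metric.ball (0 : Momentum d) r)) :
    radialEnergy φ f ≤ radialEnergy φ ((Metric.ball (0 : Momentum d) r).indicator 1) := by
  set B : Set (Momentum d) := Metric.ball 0 r with hB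
  have hBfin : volume B ≠ ⊤ := measure_ball_lt_top.ne
  let 𝒞 : Set (Momentum d → ℝ) := {g | Measurable g ∧ (∀ x, g x ∈ Set.Icc (0 : ℝ) 1) ∧
    (∀ x, R < ‖x‖ → g x = 0) ∧ (∫⁻ x, ENNReal.ofReal (g x) = volume B) ∧
    radialEnergy φ f ≤ radialEnergy φ g}
  let δ : (Momentum d → ℝ) → ENNReal := fun g => ∫⁻ x in Bᶜ, ENNReal.ofReal (g x)
  have hf𝒞 : f ∈ 𝒞 := ⟨hfm, hf, hfR, hmass, le_rfl⟩
  have hδfin : ∀ g ∈ 𝒞, δ g ≠ ⊤ := fun g hg =>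
    ((setLIntegral_le_lintegral _ _).trans_lt (hg.2.2.2.1 ▸ hBfin.lt_top)).ne
  have hinf : sInf (δ '' 𝒞) = 0 := by
    by_contra hL
    obtain ⟨c, hc0, hc⟩ := exists_transfer_deficit_le (d := d) r R hL
    have hLfin : sInf (δ '' 𝒞) ≠ ⊤ :=
      ne_top_of_le_ne_top (hδfin f hf𝒞) (sInf_le ⟨f, hf𝒞, rfl⟩)
    obtain ⟨_, ⟨g, hg, rfl⟩, hgL⟩ := sInf_lt_iff.1 (ENNReal.lt_add_right hLfin hc0)
    obtain ⟨v, hv, hle⟩ := hc g hg.1 hg.2.1 hg.2.2.1 hg.2.2.2.1 (sInf_le ⟨g, hg, rfl⟩)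
    have hg' : transfer v g ∈ 𝒞 := ⟨measurable_transfer hg.1, transfer_mem_Icc hg.2.1,
      fun x hx => transfer_eq_zero_of_norm_gt hv hg.2.1 hg.2.2.1 hx,
      (lintegral_transfer hv hg.1 hg.2.1).trans hg.2.2.2.1,
      hg.2.2.2.2.trans (radialEnergy_le_transfer hφm hφ0 hφ hd hv hg.1 hg.2.1)⟩
    have h1 : sInf (δ '' 𝒞) + c ≤ δ g :=
      (add_le_add_left (sInf_le (Set.mem_image_of_mem δ hg')) c).trans hle
    exact absurd hgL (not_lt.2 h1)
  set C := 2 * ((∫⁻ z in Metric.ball (0 : Momentum d) 1, ENNReal.ofReal (φ ‖z‖)) +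
        ENNReal.ofReal (φ 1) * volume B) with hC
  have hCfin : C ≠ ⊤ := ENNReal.mul_ne_top (by norm_num)
    (ENNReal.add_ne_top.2 ⟨hloc, ENNReal.mul_ne_top ENNReal.ofReal_ne_top hBfin⟩)
  have hle : ∀ g ∈ 𝒞, radialEnergy φ f ≤ radialEnergy φ (B.indicator 1) + C * δ g := by
    intro g hg
    have := radialEnergy_le_add_deficit hφm hφ0 hφ hg.1 hg.2.1 r
    rw [hg.2.2.2.1] at this
    exact hg.2.2.2.2.trans this
  refine ENNReal.le_of_forall_pos_le_add fun ε hε _ => ?_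
  obtain ⟨c, hc0, hc⟩ := ENNReal.exists_nnreal_pos_mul_lt hCfin
    (show (ε : ENNReal) ≠ 0 by exact_mod_cast hε.ne')
  obtain ⟨_, ⟨g, hg, rfl⟩, hgc⟩ := sInf_lt_iff.1 (hinf.trans_lt (ENNReal.coe_pos.2 hc0))
  refine (hle g hg).trans ?_
  gcongr
  calc C * δ g ≤ C * c := by gcongr
    _ = c * C := mul_comm _ _
    _ ≤ ε := hc.le

/-- Every mass below that of a ball is the mass of a smaller ball. -/
lemma exists_ball_volume_eq (hd : d ≠ 0) {r : ℝ} {m : ENNReal}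
    (hm : m ≤ volume (Metric.ball (0 : Momentum d) r)) :
    ∃ r' ≤ r, m = volume (Metric.ball (0 : Momentum d) r') := by
  have : NeZero d := ⟨hd⟩
  rcases le_or_gt r 0 with hr | hr
  · rw [Metric.ball_eq_empty.2 hr, measure_empty] at hm
    exact ⟨r, le_rfl, by rw [Metric.ball_eq_empty.2 hr, measure_empty, nonpos_iff_eq_zero.1 hm]⟩
  have h1 : volume (Metric.ball (0 : Momentum d) 1) ≠ 0 :=
    (Metric.measure_ball_pos _ _ one_pos).ne'
  have h1' : volume (Metric.ball (0 : Momentum d) 1) ≠ ⊤ := measure_ball_lt_top.ne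
  have hmfin : m ≠ ⊤ := ne_top_of_le_ne_top measure_ball_lt_top.ne hm
  set q : ℝ := (m / volume (Metric.ball (0 : Momentum d) 1)).toReal with hq
  have hq0 : 0 ≤ q := ENNReal.toReal_nonneg
  have hpow : (q ^ ((d : ℝ)⁻¹)) ^ d = q := Real.rpow_inv_natCast_pow hq0 hd
  have hvol : volume (Metric.ball (0 : Momentum d) (q ^ ((d : ℝ)⁻¹))) = m := by
    rw [Measure.addHaar_ball _ _ (by positivity), finrank_euclideanSpace_fin, hpow, hq,
      ENNReal.ofReal_toReal (ENNReal.div_ne_top hmfin h1), ENNReal.div_mul_cancel h1 h1']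
  refine ⟨q ^ ((d : ℝ)⁻¹), ?_, hvol.symm⟩
  rw [← hvol, Measure.addHaar_ball _ _ hr.le, Measure.addHaar_ball _ _ (by positivity),
    ENNReal.mul_le_mul_iff_left h1 h1', finrank_euclideanSpace_fin,
    ENNReal.ofReal_le_ofReal_iff (by positivity)] at hm
  exact (pow_le_pow_iff_left₀ (by positivity) hr.le hd).1 hm

lemma radialEnergy_mono {φ : ℝ → ℝ} (hφ0 : ∀ r, 0 ≤ φ r) {f g : Momentum d → ℝ}
    (hf : ∀ x, 0 ≤ f x) (hfg : ∀ x, f x ≤ g x) : radialEnergy φ f ≤ radialEnergy φ g :=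
  lintegral_mono fun x => lintegral_mono fun y => ENNReal.ofReal_le_ofReal
    (mul_le_mul_of_nonneg_left (mul_le_mul (hfg x) (hfg y) (hf y) ((hf x).trans (hfg x))) (hφ0 _))

/-- Among densities bounded by `1` with the mass of a ball, the interaction energy is largest for
the ball. -/
theorem radialEnergy_le_ball {φ : ℝ → ℝ} (hφm : Measurable φ) (hφ0 : ∀ r, 0 ≤ φ r)
    (hφ : AntitoneOn φ (Set.Ioi 0))
    (hloc : ∫⁻ z in Metric.ball (0 : Momentum d) 1, ENNReal.ofReal (φ ‖z‖) ≠ ⊤) (hd : d ≠ 0)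
    (hfm : Measurable f) (hf : ∀ x, f x ∈ Set.Icc (0 : ℝ) 1) {r : ℝ}
    (hmass : ∫⁻ x, ENNReal.ofReal (f x) = volume (Metric.ball (0 : Momentum d) r)) :
    radialEnergy φ f ≤ radialEnergy φ ((Metric.ball (0 : Momentum d) r).indicator 1) := by
  -- Truncations have no more mass than `f`, so they are compared with balls of radius at most `r`;
  -- their energies increase to that of `f` by monotone convergence.
  set F : ℕ → Momentum d → ℝ := fun n => (Metric.closedBall 0 (n : ℝ)).indicator f with hF
  have hFm : ∀ n, Measurable (F n) := fun n => hfm.indicator measurableSet_closedBall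
  have hF01 : ∀ n x, F n x ∈ Set.Icc (0 : ℝ) 1 := fun n x =>
    ⟨Set.indicator_nonneg (fun _ _ => (hf _).1) x,
      Set.indicator_le' (fun _ _ => (hf _).2) (fun _ _ => zero_le_one) x⟩
  have hFmono : ∀ x, Monotone fun n => F n x := fun x m n hmn =>
    Set.indicator_le_indicator_of_subset
      (Metric.closedBall_subset_closedBall (Nat.cast_le.2 hmn)) (fun y => (hf y).1) x
  have hFn : ∀ n, radialEnergy φ (F n) ≤
      radialEnergy φ ((Metric.ball (0 : Momentum d) r).indicator 1) := by
    intro n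
    obtain ⟨r', hr', hm⟩ := exists_ball_volume_eq hd (m := ∫⁻ x, ENNReal.ofReal (F n x)) (hmass ▸
      lintegral_mono fun x => ENNReal.ofReal_le_ofReal
        (Set.indicator_le_self' (fun _ _ => (hf _).1) x))
    refine (radialEnergy_le_ball_of_bounded hφm hφ0 hφ hloc hd (hFm n) (hF01 n) (R := n)
      (fun x hx => Set.indicator_of_notMem (by simpa using hx) f) hm).trans ?_
    exact radialEnergy_mono hφ0 (fun x => Set.indicator_nonneg (by simp) x) fun x =>
      Set.indicator_le_indicator_of_subset (Metric.ball_subset_ball hr') (by simp) x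
  have hmono : ∀ x y, Monotone fun n => ENNReal.ofReal (φ ‖x - y‖ * (F n x * F n y)) :=
    fun x y m n hmn => ENNReal.ofReal_le_ofReal (mul_le_mul_of_nonneg_left
      (mul_le_mul (hFmono x hmn) (hFmono y hmn) (hF01 _ _).1 (hF01 _ _).1) (hφ0 _))
  have hm : ∀ n, Measurable fun p : Momentum d × Momentum d =>
      ENNReal.ofReal (φ ‖p.1 - p.2‖ * (F n p.1 * F n p.2)) := fun n =>
    measurable_radialIntegrand hφm (hFm n) (hFm n)
  have hsup : radialEnergy φ f = ⨆ n, radialEnergy φ (F n) := by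
    unfold radialEnergy
    rw [← lintegral_iSup (fun n => (hm n).lintegral_prod_right')
      (fun m n hmn x => lintegral_mono fun y => hmono x y hmn)]
    refine lintegral_congr fun x => ?_
    simp only
    rw [← lintegral_iSup (fun n => by have := hFm n; fun_prop)
      (fun m n hmn y => hmono x y hmn)]
    refine lintegral_congr fun y => le_antisymm ?_ (iSup_le fun n => ?_)
    · obtain ⟨n, hn⟩ := exists_nat_ge (max ‖x‖ ‖y‖)
      refine le_iSup_of_le n (le_of_eq ?_)
      simp only [hF]
      rw [Set.indicator_of_mem, Set.indicator_of_mem]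
      · simpa using (le_max_right _ _).trans hn
      · simpa using (le_max_left _ _).trans hn
    · exact ENNReal.ofReal_le_ofReal (mul_le_mul_of_nonneg_left (mul_le_mul
        (Set.indicator_le_self' (fun _ _ => (hf _).1) x)
        (Set.indicator_le_self' (fun _ _ => (hf _).1) y) (hF01 _ _).1 (hf _).1) (hφ0 _))
  rw [hsup]
  exact iSup_le hFn

end Rearrangement

/-! ### Fermi balls -/

/-- The radius of the Fermi ball of density `ρ`. -/
noncomputable def fermiRadius (d : ℕ) (ρ : ℝ) : ℝ :=
  2 * Real.pi * ((d : ℝ) / sphereArea d) ^ (1 / (d : ℝ)) * ρ ^ (1 / (d : ℝ))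

/-- The radial profile of the Riesz interaction, up to the constant. -/
noncomputable def rieszProfile (d : ℕ) (s r : ℝ) : ℝ := |r| ^ (s - (d : ℝ))

section Balls

variable {d : ℕ}

lemma sphereArea_eq (d : ℕ) :
    sphereArea d = d * (volume : Measure (Momentum d)).real (Metric.ball 0 1) := by
  rw [sphereArea, Measure.toSphere_real_apply_univ, finrank_euclideanSpace_fin]

lemma sphereArea_pos (hd : d ≠ 0) : 0 < sphereArea d := by
  have : NeZero d := ⟨hd⟩
  rw [sphereArea_eq]
  have : 0 < (volume : Measure (Momentum d)).real (Metric.ball 0 1) :=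
    ENNReal.toReal_pos (Metric.measure_ball_pos _ _ one_pos).ne' measure_ball_lt_top.ne
  positivity

lemma fermiRadius_nonneg (hd : d ≠ 0) {ρ : ℝ} (hρ : 0 ≤ ρ) : 0 ≤ fermiRadius d ρ := by
  have := sphereArea_pos hd
  unfold fermiRadius
  positivity

lemma fermiRadius_rpow (hd : d ≠ 0) {ρ : ℝ} (hρ : 0 ≤ ρ) (a : ℝ) :
    fermiRadius d ρ ^ a = (2 * Real.pi) ^ a * ((d : ℝ) / sphereArea d) ^ (a / d) *
      ρ ^ (a / d) := by
  have := sphereArea_pos hd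
  rw [fermiRadius, Real.mul_rpow (by positivity) (by positivity),
    Real.mul_rpow (by positivity) (by positivity), ← Real.rpow_mul (by positivity),
    ← Real.rpow_mul hρ, one_div_mul_eq_div]

lemma fermiRadius_pow (hd : d ≠ 0) {ρ : ℝ} (hρ : 0 ≤ ρ) :
    fermiRadius d ρ ^ d = (2 * Real.pi) ^ d * (d / sphereArea d) * ρ := by
  have := fermiRadius_rpow hd hρ d
  rw [div_self (by exact_mod_cast hd), Real.rpow_one, Real.rpow_one] at this
  exact_mod_cast this

lemma fermiRadius_sq (hd : d ≠ 0) {ρ : ℝ} (hρ : 0 ≤ ρ) :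
    fermiRadius d ρ ^ 2 = thomasFermiConst d * ρ ^ (2 / (d : ℝ)) := by
  have := fermiRadius_rpow hd hρ 2
  rw [Real.rpow_two, Real.rpow_two] at this
  rw [this, thomasFermiConst]
  ring

lemma fermiBall_eq (hd : d ≠ 0) {ρ : ℝ} (hρ : 0 ≤ ρ) (k : Momentum d) :
    fermiBall d ρ k = if ‖k‖ ≤ fermiRadius d ρ then 1 else 0 := by
  rw [fermiBall, ← fermiRadius_sq hd hρ]
  simp only [sq_le_sq₀ (norm_nonneg k) (fermiRadius_nonneg hd hρ)]

lemma volume_ball_fermiRadius (hd : d ≠ 0) {ρ : ℝ} (hρ : 0 ≤ ρ) :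
    volume (Metric.ball (0 : Momentum d) (fermiRadius d ρ)) =
      ENNReal.ofReal ((2 * Real.pi) ^ d * ρ) := by
  have : NeZero d := ⟨hd⟩
  have hS := sphereArea_pos hd
  have hV : sphereArea d / d = (volume : Measure (Momentum d)).real (Metric.ball 0 1) := by
    rw [sphereArea_eq]
    field_simp
  rw [Measure.addHaar_ball _ _ (fermiRadius_nonneg hd hρ), finrank_euclideanSpace_fin,
    fermiRadius_pow hd hρ, ← ofReal_measureReal measure_ball_lt_top.ne, ← hV,
    ← ENNReal.ofReal_mul (by positivity)]
  congr 1
  have : (d : ℝ) ≠ 0 := by exact_mod_cast hd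
  field_simp

lemma lintegral_eq_smul_comp {R : ℝ} (hR : 0 < R) {g : Momentum d → ENNReal} (hg : Measurable g) :
    ∫⁻ x, g x = ENNReal.ofReal (R ^ d) * ∫⁻ x, g (R • x) := by
  rw [← lintegral_map hg (measurable_const_smul R), Measure.map_addHaar_smul _ hR.ne',
    lintegral_smul_measure, smul_eq_mul, finrank_euclideanSpace_fin, ← mul_assoc,
    ← ENNReal.ofReal_mul (by positivity), abs_of_pos (by positivity),
    mul_inv_cancel₀ (by positivity), ENNReal.ofReal_one, one_mul]

lemma lintegral_ball_norm_sq (hd : d ≠ 0) {R : ℝ} (hR : 0 ≤ R) :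
    ∫⁻ x in Metric.ball (0 : Momentum d) R, ENNReal.ofReal (‖x‖ ^ 2) =
      ENNReal.ofReal (sphereArea d * (R ^ (d + 2) / (d + 2))) := by
  have : NeZero d := ⟨hd⟩
  have hcont : Continuous fun x : Momentum d => ‖x‖ ^ 2 := by fun_prop
  have hint : IntegrableOn (fun x : Momentum d => ‖x‖ ^ 2) (Metric.ball 0 R) :=
    (hcont.continuousOn.integrableOn_compact (isCompact_closedBall 0 R)).mono_set
      Metric.ball_subset_closedBall
  rw [← ofReal_integral_eq_lintegral_ofReal hint
    (Filter.Eventually.of_forall fun x => by positivity)]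
  congr 1
  have h := integral_fun_norm_addHaar (volume : Measure (Momentum d))
    ((Set.Iio R).indicator fun y => y ^ 2)
  have e1 : ∫ x : Momentum d, (Set.Iio R).indicator (fun y => y ^ 2) ‖x‖ =
      ∫ x in Metric.ball (0 : Momentum d) R, ‖x‖ ^ 2 := by
    rw [← integral_indicator measurableSet_ball]
    refine integral_congr_ae (Filter.Eventually.of_forall fun x => ?_)
    simp [Set.indicator]
  have e2 : ∫ y in Set.Ioi (0 : ℝ), y ^ (d - 1) • (Set.Iio R).indicator (fun y => y ^ 2) y =
      R ^ (d + 2) / (d + 2) := by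
    have : ∀ y : ℝ, y ^ (d - 1) • (Set.Iio R).indicator (fun y => y ^ 2) y =
        (Set.Iio R).indicator (fun y => y ^ (d + 1)) y := by
      intro y
      by_cases hy : y ∈ Set.Iio R
      · rw [Set.indicator_of_mem hy, Set.indicator_of_mem hy, smul_eq_mul, ← pow_add]
        congr 1
        omega
      · simp [Set.indicator_of_notMem hy]
    simp_rw [this]
    rw [setIntegral_indicator measurableSet_Iio, Set.Ioi_inter_Iio, ← integral_Ioc_eq_integral_Ioo,
      ← intervalIntegral.integral_of_le hR, integral_pow]
    push_cast
    simp
    ring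
  rw [← e1, h, finrank_euclideanSpace_fin, e2, sphereArea_eq, nsmul_eq_mul, smul_eq_mul]
  ring

/-- The kinetic energy of a Fermi ball. -/
lemma kinetic_fermiBall (hd : d ≠ 0) {ρ : ℝ} (hρ : 0 ≤ ρ) :
    ENNReal.ofReal (1 / (2 * (2 * Real.pi) ^ d)) *
      ∫⁻ x in Metric.ball (0 : Momentum d) (fermiRadius d ρ), ENNReal.ofReal (‖x‖ ^ 2) =
      ENNReal.ofReal (kappaConst d * ρ ^ (1 + 2 / (d : ℝ))) := by
  have hS := sphereArea_pos hd
  have hd' : (0 : ℝ) < d := by positivity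
  rw [lintegral_ball_norm_sq hd (fermiRadius_nonneg hd hρ), ← ENNReal.ofReal_mul (by positivity),
    pow_add, fermiRadius_pow hd hρ, fermiRadius_sq hd hρ, thomasFermiConst, kappaConst,
    Real.rpow_add_of_nonneg hρ zero_le_one (by positivity), Real.rpow_one]
  congr 1
  field_simp
  ring

/-! ### Riesz energies of balls and positivity of the constants. -/

section Riesz

variable {s : ℝ}

/-- In polar coordinates the integrand becomes `r ^ (s - 1)`, integrable at the origin because `0 <
s`. -/
lemma integrableOn_ball_rpow (hd : d ≠ 0) (hs : 0 < s) :
    IntegrableOn (fun z : Momentum d => ‖z‖ ^ (s - (d : ℝ))) (Metric.ball 0 1) := by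
  have : NeZero d := ⟨hd⟩
  rw [integrableOn_fun_norm_addHaar volume (f := fun r : ℝ => r ^ (s - (d : ℝ)))]
  have h := (intervalIntegral.integrableOn_Ioo_rpow_iff (s := s - 1) one_pos).2 (by linarith)
  refine h.congr_fun (fun y hy => ?_) measurableSet_Ioo
  rw [finrank_euclideanSpace_fin, smul_eq_mul]
  simp only
  rw [← Real.rpow_natCast, ← Real.rpow_add hy.1, Nat.cast_sub (Nat.one_le_iff_ne_zero.2 hd)]
  congr 1
  push_cast
  ring

lemma rieszProfile_norm (d : ℕ) (s : ℝ) (z : Momentum d) :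
    rieszProfile d s ‖z‖ = ‖z‖ ^ (s - (d : ℝ)) := by
  rw [rieszProfile, abs_norm]

lemma measurable_rieszProfile (d : ℕ) (s : ℝ) : Measurable (rieszProfile d s) := by
  unfold rieszProfile
  fun_prop

lemma rieszProfile_nonneg (d : ℕ) (s r : ℝ) : 0 ≤ rieszProfile d s r := by
  unfold rieszProfile
  positivity

lemma rieszProfile_pos {r : ℝ} (hr : 0 < r) : 0 < rieszProfile d s r := by
  unfold rieszProfile
  positivity

lemma antitoneOn_rieszProfile (hsd : s < d) : AntitoneOn (rieszProfile d s) (Set.Ioi 0) := by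
  intro x hx y hy hxy
  rw [rieszProfile, rieszProfile, abs_of_pos (Set.mem_Ioi.1 hx), abs_of_pos (Set.mem_Ioi.1 hy)]
  exact Real.rpow_le_rpow_of_nonpos hx hxy (by linarith)

lemma lintegral_ball_rieszProfile_ne_top (hd : d ≠ 0) (hs : 0 < s) :
    ∫⁻ z in Metric.ball (0 : Momentum d) 1, ENNReal.ofReal (rieszProfile d s ‖z‖) ≠ ⊤ := by
  simp_rw [rieszProfile_norm]
  exact (integrableOn_ball_rpow hd hs).lintegral_lt_top.ne

lemma radialEnergy_ne_top (hd : d ≠ 0) (hs : 0 < s) (hsd : s < d) {f : Momentum d → ℝ}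
    (hfm : Measurable f) (hf : ∀ x, f x ∈ Set.Icc (0 : ℝ) 1)
    (hmass : ∫⁻ x, ENNReal.ofReal (f x) ≠ ⊤) : radialEnergy (rieszProfile d s) f ≠ ⊤ := by
  -- Radius `0` makes the ball empty and the deficit the whole mass.
  have h := radialEnergy_le_add_deficit (measurable_rieszProfile d s) (rieszProfile_nonneg d s)
    (antitoneOn_rieszProfile hsd) hfm hf 0
  refine ne_top_of_le_ne_top ?_ h
  simp only [Metric.ball_zero, Set.indicator_empty, Set.compl_empty, Measure.restrict_univ]
  refine ENNReal.add_ne_top.2 ⟨by simp [radialEnergy], ENNReal.mul_ne_top (ENNReal.mul_ne_top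
    (by norm_num) (ENNReal.add_ne_top.2 ⟨lintegral_ball_rieszProfile_ne_top hd hs,
      ENNReal.mul_ne_top ENNReal.ofReal_ne_top hmass⟩)) hmass⟩

lemma indicator_ball_mem_Icc (R : ℝ) (x : Momentum d) :
    (Metric.ball (0 : Momentum d) R).indicator (1 : Momentum d → ℝ) x ∈ Set.Icc (0 : ℝ) 1 := by
  by_cases h : x ∈ Metric.ball (0 : Momentum d) R <;> simp [Set.indicator, h]

lemma measurable_indicator_ball (R : ℝ) :
    Measurable ((Metric.ball (0 : Momentum d) R).indicator (1 : Momentum d → ℝ)) :=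
  measurable_one.indicator measurableSet_ball

lemma lintegral_indicator_ball (R : ℝ) :
    ∫⁻ x, ENNReal.ofReal ((Metric.ball (0 : Momentum d) R).indicator (1 : Momentum d → ℝ) x) =
      volume (Metric.ball (0 : Momentum d) R) := by
  rw [← lintegral_indicator_one measurableSet_ball]
  refine lintegral_congr fun x => ?_
  by_cases h : x ∈ Metric.ball (0 : Momentum d) R <;> simp [Set.indicator, h]

/-- As `diracConst` is an iterated Bochner integral, finiteness of the energy is needed before the
two can be identified. -/
lemma radialEnergy_ball_one (hd : d ≠ 0) (hs : 0 < s) (hsd : s < d) :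
    radialEnergy (rieszProfile d s) ((Metric.ball (0 : Momentum d) 1).indicator 1) =
      ENNReal.ofReal (diracConst d s) := by
  have hfin := radialEnergy_ne_top hd hs hsd (measurable_indicator_ball (d := d) 1)
    (indicator_ball_mem_Icc 1) (by rw [lintegral_indicator_ball]; exact measure_ball_lt_top.ne)
  set B : Set (Momentum d) := Metric.ball 0 1 with hB
  have hBm : MeasurableSet B := measurableSet_ball
  have hKm : Measurable fun p : Momentum d × Momentum d =>
      ENNReal.ofReal (‖p.1 - p.2‖ ^ (s - (d : ℝ))) := by fun_prop
  have e1 : radialEnergy (rieszProfile d s) (B.indicator 1) =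
      ∫⁻ x in B, ∫⁻ y in B, ENNReal.ofReal (‖x - y‖ ^ (s - (d : ℝ))) := by
    rw [radialEnergy, ← lintegral_indicator hBm]
    refine lintegral_congr fun x => ?_
    by_cases hx : x ∈ B
    · conv_rhs => rw [Set.indicator_of_mem hx, ← lintegral_indicator hBm]
      refine lintegral_congr fun y => ?_
      by_cases hy : y ∈ B <;> simp [hx, hy, rieszProfile_norm]
    · simp [hx]
  have hinner : Measurable fun x => ∫⁻ y in B, ENNReal.ofReal (‖x - y‖ ^ (s - (d : ℝ))) :=
    hKm.lintegral_prod_right'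
  rw [e1] at hfin ⊢
  have e2 : diracConst d s =
      (∫⁻ x in B, ∫⁻ y in B, ENNReal.ofReal (‖x - y‖ ^ (s - (d : ℝ)))).toReal := by
    rw [← integral_toReal hinner.aemeasurable (ae_lt_top hinner hfin), diracConst]
    refine integral_congr_ae (Filter.Eventually.of_forall fun x => ?_)
    exact integral_eq_lintegral_of_nonneg_ae
      (Filter.Eventually.of_forall fun y => by positivity)
      (Measurable.aestronglyMeasurable (by fun_prop))
  rw [e2, ENNReal.ofReal_toReal hfin]

/-- Distinct points of the unit ball are at distance at most `2`, so the kernel is bounded below by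
its value at `2`. -/
lemma diracConst_pos (hd : d ≠ 0) (hs : 0 < s) (hsd : s < d) : 0 < diracConst d s := by
  have : NeZero d := ⟨hd⟩
  rw [← ENNReal.ofReal_pos, ← radialEnergy_ball_one hd hs hsd]
  set B : Set (Momentum d) := Metric.ball 0 1 with hB
  have hBm : MeasurableSet B := measurableSet_ball
  have hle : ∫⁻ x in B, ∫⁻ y in B, ENNReal.ofReal (rieszProfile d s 2) ≤
      radialEnergy (rieszProfile d s) (B.indicator 1) := by
    rw [radialEnergy, ← lintegral_indicator hBm]
    refine lintegral_mono fun x => ?_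
    by_cases hx : x ∈ B
    · rw [Set.indicator_of_mem hx, ← lintegral_indicator hBm]
      have h1 : ∀ᵐ y : Momentum d, y ≠ x := by simp [ae_iff]
      refine lintegral_mono_ae ?_
      filter_upwards [h1] with y hy
      by_cases hyB : y ∈ B
      · simp only [hyB, hx, Set.indicator_of_mem, Pi.one_apply, mul_one]
        refine ENNReal.ofReal_le_ofReal (antitoneOn_rieszProfile hsd
          (norm_pos_iff.2 (sub_ne_zero.2 hy.symm)) (Set.mem_Ioi.2 two_pos) ?_)
        refine (norm_sub_le _ _).trans ?_
        simp only [hB, Metric.mem_ball, dist_zero_right] at hx hyB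
        linarith
      · simp [hyB]
    · simp [hx]
  refine lt_of_lt_of_le ?_ hle
  rw [setLIntegral_const, setLIntegral_const]
  have h2 : 0 < volume B := Metric.measure_ball_pos _ _ one_pos
  have h3 : 0 < ENNReal.ofReal (rieszProfile d s 2) :=
    ENNReal.ofReal_pos.2 (rieszProfile_pos two_pos)
  positivity

/-- Scaling by `R` contributes `R ^ d` from each variable and `R ^ (s - d)` from the homogeneous
kernel. -/
lemma radialEnergy_ball (hd : d ≠ 0) (hs : 0 < s) (hsd : s < d) {R : ℝ} (hR : 0 ≤ R) :
    radialEnergy (rieszProfile d s) ((Metric.ball (0 : Momentum d) R).indicator 1) =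
      ENNReal.ofReal (diracConst d s * R ^ ((d : ℝ) + s)) := by
  have hd' : (0 : ℝ) < d := by positivity
  rcases hR.eq_or_lt with rfl | hR
  · simp [radialEnergy, Real.zero_rpow (show (d : ℝ) + s ≠ 0 by positivity)]
  have hm := measurable_radialIntegrand (measurable_rieszProfile d s)
    (measurable_indicator_ball (d := d) R) (measurable_indicator_ball R)
  have e1 := lintegral_eq_smul_comp hR (hm.lintegral_prod_right' (ν := volume))
  have e2 : ∀ x : Momentum d, ∫⁻ y, ENNReal.ofReal (rieszProfile d s ‖R • x - y‖ *
      ((Metric.ball (0 : Momentum d) R).indicator 1 (R • x) *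
        (Metric.ball (0 : Momentum d) R).indicator 1 y)) =
      ENNReal.ofReal (R ^ d) * (ENNReal.ofReal (R ^ (s - (d : ℝ))) *
        ∫⁻ y, ENNReal.ofReal (rieszProfile d s ‖x - y‖ *
      ((Metric.ball (0 : Momentum d) 1).indicator 1 x *
        (Metric.ball (0 : Momentum d) 1).indicator 1 y))) := by
    intro x
    have hmx : Measurable fun y : Momentum d => ENNReal.ofReal (rieszProfile d s ‖R • x - y‖ *
      ((Metric.ball (0 : Momentum d) R).indicator 1 (R • x) *
        (Metric.ball (0 : Momentum d) R).indicator 1 y)) := by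
      have h1 := measurable_rieszProfile d s
      have h2 := measurable_indicator_ball (d := d) R
      fun_prop
    rw [lintegral_eq_smul_comp hR hmx]
    congr 1
    rw [← lintegral_const_mul' _ _ ENNReal.ofReal_ne_top]
    refine lintegral_congr fun y => ?_
    have hi : ∀ z : Momentum d, (Metric.ball (0 : Momentum d) R).indicator (1 : Momentum d → ℝ)
        (R • z) = (Metric.ball (0 : Momentum d) 1).indicator 1 z := by
      intro z
      have : R • z ∈ Metric.ball (0 : Momentum d) R ↔ z ∈ Metric.ball (0 : Momentum d) 1 := by
        rw [Metric.mem_ball, Metric.mem_ball, dist_zero_right, dist_zero_right, norm_smul,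
          Real.norm_of_nonneg hR.le, mul_lt_iff_lt_one_right hR]
      by_cases hz : z ∈ Metric.ball (0 : Momentum d) 1
      · rw [Set.indicator_of_mem hz, Set.indicator_of_mem (this.2 hz), Pi.one_apply, Pi.one_apply]
      · rw [Set.indicator_of_notMem hz, Set.indicator_of_notMem (mt this.1 hz)]
    rw [hi, hi, ← smul_sub, rieszProfile_norm, rieszProfile_norm, norm_smul,
      Real.norm_of_nonneg hR.le, Real.mul_rpow hR.le (norm_nonneg _),
      ← ENNReal.ofReal_mul (by positivity), mul_assoc]
  have e3 : radialEnergy (rieszProfile d s) ((Metric.ball (0 : Momentum d) R).indicator 1) =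
      ENNReal.ofReal (R ^ d) * (ENNReal.ofReal (R ^ d) * (ENNReal.ofReal (R ^ (s - (d : ℝ))) *
      radialEnergy (rieszProfile d s) ((Metric.ball (0 : Momentum d) 1).indicator 1))) := by
    refine e1.trans ?_
    congr 1
    simp only [e2]
    rw [lintegral_const_mul' _ _ ENNReal.ofReal_ne_top, lintegral_const_mul' _ _
      ENNReal.ofReal_ne_top]
    rfl
  rw [e3, radialEnergy_ball_one hd hs hsd, ← ENNReal.ofReal_mul (by positivity),
    ← ENNReal.ofReal_mul (by positivity), ← ENNReal.ofReal_mul (by positivity)]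
  congr 1
  have : R ^ ((d : ℝ) + s) = R ^ d * R ^ d * R ^ (s - (d : ℝ)) := by
    rw [← Real.rpow_natCast, ← Real.rpow_add hR, ← Real.rpow_add hR]
    congr 1
    ring
  rw [this]
  ring

lemma rieszConst_pos (hs : 0 < s) (hsd : s < d) : 0 < rieszConst d s := by
  have h1 : 0 < Real.Gamma (((d : ℝ) - s) / 2) := Real.Gamma_pos_of_pos (by linarith)
  have h2 : 0 < Real.Gamma (s / 2) := Real.Gamma_pos_of_pos (by linarith)
  unfold rieszConst
  positivity

lemma lambdaConst_pos (hd : d ≠ 0) (hs : 0 < s) (hsd : s < d) : 0 < lambdaConst d s := by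
  have h1 : 0 < Real.Gamma (((d : ℝ) - s) / 2) := Real.Gamma_pos_of_pos (by linarith)
  have h2 : 0 < Real.Gamma (s / 2) := Real.Gamma_pos_of_pos (by linarith)
  have h3 := sphereArea_pos hd
  have h4 := diracConst_pos hd hs hsd
  unfold lambdaConst
  positivity

lemma kappaConst_pos (hd : d ≠ 0) : 0 < kappaConst d := by
  have h3 := sphereArea_pos hd
  unfold kappaConst
  positivity

/-- The exchange energy of a Fermi ball. -/
lemma exchange_fermiBall (hd : d ≠ 0) (hs : 0 < s) (hsd : s < d) {ρ : ℝ} (hρ : 0 ≤ ρ) :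
    ENNReal.ofReal (1 / (2 * (2 * Real.pi) ^ d)) * (ENNReal.ofReal (rieszConst d s) *
      radialEnergy (rieszProfile d s)
        ((Metric.ball (0 : Momentum d) (fermiRadius d ρ)).indicator 1)) =
      ENNReal.ofReal (lambdaConst d s * ρ ^ (1 + s / (d : ℝ))) := by
  have hS := sphereArea_pos hd
  have hd' : (0 : ℝ) < d := by positivity
  have hc := rieszConst_pos hs hsd
  rw [radialEnergy_ball hd hs hsd (fermiRadius_nonneg hd hρ), ← ENNReal.ofReal_mul hc.le,
    ← ENNReal.ofReal_mul (by positivity), fermiRadius_rpow hd hρ, rieszConst, lambdaConst]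
  congr 1
  have e1 : ((d : ℝ) + s) / d = 1 + s / d := by field_simp
  have e2 : (2 * Real.pi) ^ ((d : ℝ) + s) = (2 * Real.pi) ^ d * (2 ^ s * Real.pi ^ s) := by
    rw [Real.rpow_add (by positivity), Real.rpow_natCast, Real.mul_rpow two_pos.le Real.pi_pos.le]
  have e3 : (2 : ℝ) ^ (((d : ℝ) - s) / 2) * 2 ^ s = 2 ^ ((d : ℝ) / 2) * 2 ^ (s / 2) := by
    rw [← Real.rpow_add two_pos, ← Real.rpow_add two_pos]
    congr 1
    ring
  have e4 : Real.pi ^ ((d : ℝ) / 2) = Real.pi ^ ((d : ℝ) / 2 - s) * Real.pi ^ s := by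
    rw [← Real.rpow_add Real.pi_pos]
    congr 1
    ring
  rw [e2, Real.mul_rpow two_pos.le Real.pi_pos.le, e4, e1]
  have hΓ : 0 < Real.Gamma (s / 2) := Real.Gamma_pos_of_pos (by linarith)
  have e5 : (2 : ℝ) ^ (((d : ℝ) - s) / 2) = 2 ^ ((d : ℝ) / 2) * 2 ^ (s / 2) / 2 ^ s := by
    rw [← e3]
    field_simp
  rw [e5]
  field_simp

end Riesz

end Balls

/-! ### The bathtub principle for the kinetic energy -/

section Bathtub

variable {d : ℕ} {f : Momentum d → ℝ} {r : ℝ}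

/-- Filling the hole costs at most `r²` per unit of mass, and the hole equals the mass outside,
which costs at least `r²` per unit where it is. This is the bathtub principle. -/
lemma lintegral_ball_norm_sq_mul_one_sub_le (hfm : Measurable f)
    (hf : ∀ x, f x ∈ Set.Icc (0 : ℝ) 1)
    (hmass : ∫⁻ x, ENNReal.ofReal (f x) = volume (Metric.ball (0 : Momentum d) r)) :
    ∫⁻ x in Metric.ball 0 r, ENNReal.ofReal (‖x‖ ^ 2 * (1 - f x)) ≤
      ∫⁻ x in (Metric.ball 0 r)ᶜ, ENNReal.ofReal (r ^ 2 * f x) := by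
  simp_rw [ENNReal.ofReal_mul (sq_nonneg r)]
  rw [lintegral_const_mul _ hfm.ennreal_ofReal, ← lintegral_ball_one_sub_eq hfm hf hmass,
    ← lintegral_const_mul _ (by fun_prop)]
  refine setLIntegral_mono' measurableSet_ball fun x hx => ?_
  rw [ENNReal.ofReal_mul (sq_nonneg _)]
  have : ‖x‖ < r := by simpa using hx
  gcongr

lemma ofReal_rsq_mul_le (hf : ∀ x, f x ∈ Set.Icc (0 : ℝ) 1) (hr : 0 ≤ r) {x : Momentum d}
    (hx : x ∈ (Metric.ball (0 : Momentum d) r)ᶜ) :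
    ENNReal.ofReal (r ^ 2 * f x) ≤ ENNReal.ofReal (‖x‖ ^ 2 * f x) := by
  have : r ≤ ‖x‖ := by simpa using hx
  have := (hf x).1
  gcongr

lemma lintegral_ball_norm_sq_eq_add (hfm : Measurable f) (hf : ∀ x, f x ∈ Set.Icc (0 : ℝ) 1) :
    ∫⁻ x in Metric.ball (0 : Momentum d) r, ENNReal.ofReal (‖x‖ ^ 2) =
      (∫⁻ x in Metric.ball 0 r, ENNReal.ofReal (‖x‖ ^ 2 * f x)) +
        ∫⁻ x in Metric.ball 0 r, ENNReal.ofReal (‖x‖ ^ 2 * (1 - f x)) := by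
  rw [← lintegral_add_left (by fun_prop)]
  refine lintegral_congr fun x => ?_
  rw [← ENNReal.ofReal_add (mul_nonneg (sq_nonneg _) (hf x).1)
    (mul_nonneg (sq_nonneg _) (sub_nonneg.2 (hf x).2))]
  congr 1
  ring

lemma lintegral_ball_norm_sq_le (hr : 0 ≤ r) (hfm : Measurable f)
    (hf : ∀ x, f x ∈ Set.Icc (0 : ℝ) 1)
    (hmass : ∫⁻ x, ENNReal.ofReal (f x) = volume (Metric.ball (0 : Momentum d) r)) :
    ∫⁻ x in Metric.ball (0 : Momentum d) r, ENNReal.ofReal (‖x‖ ^ 2) ≤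
      ∫⁻ x, ENNReal.ofReal (‖x‖ ^ 2 * f x) := by
  rw [lintegral_ball_norm_sq_eq_add hfm hf, ← lintegral_add_compl (μ := volume)
    (fun x => ENNReal.ofReal (‖x‖ ^ 2 * f x)) (measurableSet_ball (x := (0 : Momentum d)) (ε := r))]
  refine add_le_add le_rfl ?_
  exact (lintegral_ball_norm_sq_mul_one_sub_le hfm hf hmass).trans
    (setLIntegral_mono' measurableSet_ball.compl fun x hx => ofReal_rsq_mul_le hf hr hx)

/-- Only the ball minimises the kinetic energy. -/
lemma ae_eq_indicator_ball_of_lintegral_norm_sq_le (hd : d ≠ 0) (hr : 0 ≤ r) (hfm : Measurable f)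
    (hf : ∀ x, f x ∈ Set.Icc (0 : ℝ) 1)
    (hmass : ∫⁻ x, ENNReal.ofReal (f x) = volume (Metric.ball (0 : Momentum d) r))
    (hle : ∫⁻ x, ENNReal.ofReal (‖x‖ ^ 2 * f x) ≤
      ∫⁻ x in Metric.ball (0 : Momentum d) r, ENNReal.ofReal (‖x‖ ^ 2)) :
    f =ᵐ[volume] (Metric.ball (0 : Momentum d) r).indicator 1 := by
  have : NeZero d := ⟨hd⟩
  set B : Set (Momentum d) := Metric.ball 0 r with hB
  have hBm : MeasurableSet B := measurableSet_ball
  have hkin : ∫⁻ x in B, ENNReal.ofReal (‖x‖ ^ 2) ≠ ⊤ := by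
    rw [lintegral_ball_norm_sq hd hr]
    exact ENNReal.ofReal_ne_top
  have hsum := lintegral_ball_norm_sq_eq_add (r := r) hfm hf
  have ha : ∫⁻ x in B, ENNReal.ofReal (‖x‖ ^ 2 * f x) ≠ ⊤ := fun h => hkin (by
    rw [hsum, h, top_add])
  rw [hsum, ← lintegral_add_compl (fun x => ENNReal.ofReal (‖x‖ ^ 2 * f x)) hBm,
    ENNReal.add_le_add_iff_left ha] at hle
  -- In the equality case the mass outside has average weight at most `r²`. Off the null sphere the
  -- weight there exceeds `r²`, so `f` must vanish.
  have hout := hle.trans (lintegral_ball_norm_sq_mul_one_sub_le hfm hf hmass)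
  have hfin : ∫⁻ x in Bᶜ, ENNReal.ofReal (f x) ≠ ⊤ :=
    ((setLIntegral_le_lintegral _ _).trans_lt (hmass ▸ measure_ball_lt_top)).ne
  have hfin' : ∫⁻ x in Bᶜ, ENNReal.ofReal (r ^ 2 * f x) ≠ ⊤ := by
    simp_rw [ENNReal.ofReal_mul (sq_nonneg r)]
    rw [lintegral_const_mul _ hfm.ennreal_ofReal]
    exact ENNReal.mul_ne_top ENNReal.ofReal_ne_top hfin
  have hae := ae_eq_of_ae_le_of_lintegral_le
    ((ae_restrict_iff' hBm.compl).2 (Filter.Eventually.of_forall fun x hx =>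
      ofReal_rsq_mul_le hf hr hx)) hfin' (by fun_prop) hout
  have hsphere : ∀ᵐ x : Momentum d, x ∉ Metric.sphere (0 : Momentum d) r :=
    measure_eq_zero_iff_ae_notMem.1 (Measure.addHaar_sphere _ _ _)
  have hzero : ∀ᵐ x : Momentum d, x ∈ Bᶜ → f x = 0 := by
    filter_upwards [(ae_restrict_iff' hBm.compl).1 hae, hsphere] with x hx hxs hxB
    have h1 := hx hxB
    rw [ENNReal.ofReal_eq_ofReal_iff (mul_nonneg (sq_nonneg _) (hf x).1)
      (mul_nonneg (sq_nonneg _) (hf x).1)] at h1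
    have h2 : r < ‖x‖ := by
      refine lt_of_le_of_ne (by simpa [hB] using hxB) fun h => hxs ?_
      simp [h]
    have h3 : r ^ 2 < ‖x‖ ^ 2 := by gcongr
    rcases mul_eq_mul_right_iff.1 h1 with h | h
    · exact absurd h h3.ne
    · exact h
  have hin : ∫⁻ x in B, ENNReal.ofReal (1 - f x) = 0 := by
    rw [lintegral_ball_one_sub_eq hfm hf hmass]
    refine setLIntegral_eq_zero_iff hBm.compl hfm.ennreal_ofReal |>.2 ?_
    filter_upwards [hzero] with x hx hxB
    rw [hx hxB, ENNReal.ofReal_zero]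
  have hone := (setLIntegral_eq_zero_iff hBm
    (show Measurable fun x => ENNReal.ofReal (1 - f x) by fun_prop)).1 hin
  filter_upwards [hzero, hone] with x h0 h1
  by_cases hx : x ∈ B
  · have := ENNReal.ofReal_eq_zero.1 (h1 hx)
    rw [Set.indicator_of_mem hx, Pi.one_apply]
    linarith [(hf x).2]
  · rw [Set.indicator_of_notMem hx, h0 hx]

end Bathtub

/-! ### Two-by-two density matrices -/

section Spin

/-- Complex `2 × 2` matrices. -/
abbrev SpinMatrix : Type := Matrix (Fin 2) (Fin 2) ℂ

/-- The difference of the eigenvalues of a Hermitian `2 × 2` matrix. -/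
noncomputable def spinGap (M : SpinMatrix) : ℝ :=
  √(((M 0 0).re - (M 1 1).re) ^ 2 + 4 * Complex.normSq (M 0 1))

/-- The larger eigenvalue of a Hermitian `2 × 2` matrix. -/
noncomputable def eigHi (M : SpinMatrix) : ℝ := ((M 0 0).re + (M 1 1).re + spinGap M) / 2

/-- The smaller eigenvalue of a Hermitian `2 × 2` matrix. -/
noncomputable def eigLo (M : SpinMatrix) : ℝ := ((M 0 0).re + (M 1 1).re - spinGap M) / 2

lemma spinGap_nonneg (M : SpinMatrix) : 0 ≤ spinGap M := Real.sqrt_nonneg _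

lemma spinGap_sq (M : SpinMatrix) : spinGap M ^ 2 =
    ((M 0 0).re - (M 1 1).re) ^ 2 + 4 * ((M 0 1).re ^ 2 + (M 0 1).im ^ 2) := by
  have := Complex.normSq_nonneg (M 0 1)
  rw [spinGap, Real.sq_sqrt (by positivity), Complex.normSq_apply]
  ring

lemma eigLo_le_eigHi (M : SpinMatrix) : eigLo M ≤ eigHi M := by
  have := spinGap_nonneg M
  unfold eigLo eigHi
  linarith

lemma trace_re_eq (M : SpinMatrix) : M.trace.re = eigHi M + eigLo M := by
  rw [Matrix.trace_fin_two, Complex.add_re, eigHi, eigLo]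
  ring

lemma isHermitian_entries {M : SpinMatrix} (hM : M.IsHermitian) :
    (M 1 0).re = (M 0 1).re ∧ (M 1 0).im = -(M 0 1).im ∧ (M 0 0).im = 0 ∧ (M 1 1).im = 0 := by
  have h1 := hM.apply 1 0
  have h2 := hM.apply 0 0
  have h3 := hM.apply 1 1
  rw [← h1]
  refine ⟨by simp, by simp, ?_, ?_⟩
  · exact Complex.conj_eq_iff_im.1 h2
  · exact Complex.conj_eq_iff_im.1 h3

lemma det_re_eq {M : SpinMatrix} (hM : M.IsHermitian) : M.det.re =
    (M 0 0).re * (M 1 1).re - ((M 0 1).re ^ 2 + (M 0 1).im ^ 2) := by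
  obtain ⟨h1, h2, h3, h4⟩ := isHermitian_entries hM
  rw [Matrix.det_fin_two]
  simp only [Complex.sub_re, Complex.mul_re, h1, h2, h3, h4]
  ring

/-- The squared gap is `tr² - 4 det`, and a positive semidefinite matrix has nonnegative trace and
determinant. -/
lemma spinGap_le_trace {M : SpinMatrix} (hM : M.PosSemidef) : spinGap M ≤ (M 0 0).re + (M 1 1).re := by
  have h1 : 0 ≤ M.trace.re := (Complex.le_def.1 hM.trace_nonneg).1
  have h2 : 0 ≤ M.det.re := (Complex.le_def.1 hM.det_nonneg).1
  rw [det_re_eq hM.isHermitian] at h2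
  rw [Matrix.trace_fin_two, Complex.add_re] at h1
  refine (sq_le_sq₀ (spinGap_nonneg M) h1).1 ?_
  rw [spinGap_sq]
  linarith

lemma eigLo_nonneg {M : SpinMatrix} (hM : M.PosSemidef) : 0 ≤ eigLo M := by
  have := spinGap_le_trace hM
  unfold eigLo
  linarith

lemma spinGap_one_sub (M : SpinMatrix) : spinGap (1 - M) = spinGap M := by
  simp only [spinGap, Matrix.sub_apply, Complex.sub_re, Matrix.one_apply_eq, ne_eq, zero_ne_one,
    not_false_eq_true, Matrix.one_apply_ne, zero_sub, Complex.normSq_neg, Complex.one_re]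
  congr 2
  ring

lemma eigHi_le_one {M : SpinMatrix} (hM : (1 - M).PosSemidef) : eigHi M ≤ 1 := by
  have := spinGap_le_trace hM
  rw [spinGap_one_sub] at this
  simp only [Matrix.sub_apply, Complex.sub_re, Matrix.one_apply_eq, Complex.one_re] at this
  unfold eigHi
  linarith

lemma trace_mul_re {M N : SpinMatrix} (hM : M.IsHermitian) (hN : N.IsHermitian) :
    (M * N).trace.re = (M 0 0).re * (N 0 0).re + (M 1 1).re * (N 1 1).re +
      2 * ((M 0 1).re * (N 0 1).re + (M 0 1).im * (N 0 1).im) := by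
  obtain ⟨h1, h2, h3, h4⟩ := isHermitian_entries hM
  obtain ⟨k1, k2, k3, k4⟩ := isHermitian_entries hN
  rw [Matrix.trace_fin_two, Matrix.mul_apply, Matrix.mul_apply, Fin.sum_univ_two, Fin.sum_univ_two]
  simp only [Complex.add_re, Complex.mul_re, h1, h2, h3, h4, k1, k2, k3, k4]
  ring

/-- Cauchy-Schwarz for the Bloch vectors. -/
lemma abs_bloch_inner_le (M N : SpinMatrix) :
    |((M 0 0).re - (M 1 1).re) * ((N 0 0).re - (N 1 1).re) +
      4 * ((M 0 1).re * (N 0 1).re + (M 0 1).im * (N 0 1).im)| ≤ spinGap M * spinGap N := by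
  refine abs_le_of_sq_le_sq ?_ (mul_nonneg (spinGap_nonneg M) (spinGap_nonneg N))
  rw [mul_pow, spinGap_sq, spinGap_sq]
  -- Lagrange's identity: the difference of the two sides is a positive combination of the squared
  -- minors of the two Bloch vectors.
  nlinarith [sq_nonneg (((M 0 0).re - (M 1 1).re) * (N 0 1).re - ((N 0 0).re - (N 1 1).re) *
    (M 0 1).re), sq_nonneg (((M 0 0).re - (M 1 1).re) * (N 0 1).im - ((N 0 0).re - (N 1 1).re) *
    (M 0 1).im), sq_nonneg ((M 0 1).re * (N 0 1).im - (M 0 1).im * (N 0 1).re)]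

/-- Both sides are half the product of the traces plus half a Bloch term: the inner product of the
Bloch vectors on the left, the product of their lengths on the right. -/
lemma trace_mul_re_le {M N : SpinMatrix} (hM : M.IsHermitian) (hN : N.IsHermitian) :
    (M * N).trace.re ≤ eigHi M * eigHi N + eigLo M * eigLo N := by
  rw [trace_mul_re hM hN]
  unfold eigHi eigLo
  have := (abs_le.1 (abs_bloch_inner_le M N)).2
  linarith

lemma trace_mul_re_nonneg {M N : SpinMatrix} (hM : M.PosSemidef) (hN : N.PosSemidef) :
    0 ≤ (M * N).trace.re := by
  rw [trace_mul_re hM.isHermitian hN.isHermitian]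
  have h1 := (abs_le.1 (abs_bloch_inner_le M N)).1
  have h2 := mul_le_mul (spinGap_le_trace hM) (spinGap_le_trace hN) (spinGap_nonneg N)
    ((spinGap_nonneg M).trans (spinGap_le_trace hM))
  linarith

lemma ext_of_isHermitian {M N : SpinMatrix} (hM : M.IsHermitian) (hN : N.IsHermitian)
    (h0 : (M 0 0).re = (N 0 0).re) (h1 : (M 1 1).re = (N 1 1).re) (h2 : (M 0 1).re = (N 0 1).re)
    (h3 : (M 0 1).im = (N 0 1).im) : M = N := by
  obtain ⟨a1, a2, a3, a4⟩ := isHermitian_entries hM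
  obtain ⟨b1, b2, b3, b4⟩ := isHermitian_entries hN
  ext i j
  fin_cases i <;> fin_cases j <;> apply Complex.ext <;> simp_all

lemma eq_smul_one_of_eig_eq {M : SpinMatrix} (hM : M.IsHermitian) {x : ℝ} (hi : eigHi M = x)
    (lo : eigLo M = x) : M = (x : ℂ) • 1 := by
  have hx : ((x : ℂ) • (1 : SpinMatrix)).IsHermitian := by
    rw [Matrix.IsHermitian, Matrix.conjTranspose_smul, Matrix.conjTranspose_one]
    simp
  have hg : spinGap M = 0 := by
    unfold eigHi at hi
    unfold eigLo at lo
    linarith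
  have hsq := spinGap_sq M
  rw [hg] at hsq
  have h1 : ((M 0 0).re - (M 1 1).re) = 0 := by
    refine pow_eq_zero_iff two_ne_zero |>.1 (le_antisymm ?_ (sq_nonneg _))
    nlinarith [sq_nonneg (M 0 1).re, sq_nonneg (M 0 1).im]
  have h2 : (M 0 1).re = 0 := by
    refine pow_eq_zero_iff two_ne_zero |>.1 (le_antisymm ?_ (sq_nonneg _))
    nlinarith [sq_nonneg (M 0 1).re, sq_nonneg (M 0 1).im]
  have h3 : (M 0 1).im = 0 := by
    refine pow_eq_zero_iff two_ne_zero |>.1 (le_antisymm ?_ (sq_nonneg _))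
    nlinarith [sq_nonneg (M 0 1).re, sq_nonneg (M 0 1).im]
  unfold eigHi at hi
  refine ext_of_isHermitian hM hx ?_ ?_ ?_ ?_ <;> simp [h2, h3] <;> linarith

/-- Two rank-one projections of maximal overlap agree. -/
lemma eq_of_trace_mul_eq_one {M N : SpinMatrix} (hM : M.IsHermitian) (hN : N.IsHermitian)
    (hMi : eigHi M = 1) (lMo : eigLo M = 0) (hNi : eigHi N = 1) (lNo : eigLo N = 0)
    (h : (M * N).trace.re = 1) : M = N := by
  rw [trace_mul_re hM hN] at h
  have gM := spinGap_sq M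
  have gN := spinGap_sq N
  unfold eigHi at hMi hNi
  unfold eigLo at lMo lNo
  rw [show spinGap M = 1 by linarith] at gM
  rw [show spinGap N = 1 by linarith] at gN
  have tM : (M 1 1).re = 1 - (M 0 0).re := by linarith
  have tN : (N 1 1).re = 1 - (N 0 0).re := by linarith
  rw [tM] at gM h
  rw [tN] at gN h
  -- Both Bloch vectors have length `1` and their inner product is `1`; this is their squared
  -- distance up to a factor.
  have hs : ((M 0 0).re - (N 0 0).re) ^ 2 + ((M 0 1).re - (N 0 1).re) ^ 2 +
      ((M 0 1).im - (N 0 1).im) ^ 2 = 0 := by nlinarith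
  have z : ∀ u v w : ℝ, u ^ 2 + v ^ 2 + w ^ 2 = 0 → u = 0 ∧ v = 0 ∧ w = 0 := by
    intro u v w huvw
    refine ⟨?_, ?_, ?_⟩ <;> refine pow_eq_zero_iff two_ne_zero |>.1 (le_antisymm ?_ (sq_nonneg _))
      <;> nlinarith [sq_nonneg u, sq_nonneg v, sq_nonneg w]
  obtain ⟨z1, z2, z3⟩ := z _ _ _ hs
  refine ext_of_isHermitian hM hN ?_ ?_ ?_ ?_ <;> linarith

/-- The rotation with second column `ν`. -/
def spinRotation (ν : Fin 2 → ℂ) : SpinMatrix := !![star (ν 1), ν 0; -star (ν 0), ν 1]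

lemma spinRotation_mem {ν : Fin 2 → ℂ} (hν : Complex.normSq (ν 0) + Complex.normSq (ν 1) = 1) :
    spinRotation ν ∈ Matrix.specialUnitaryGroup (Fin 2) ℂ := by
  have h : ν 0 * star (ν 0) + ν 1 * star (ν 1) = 1 := by
    have : ∀ z : ℂ, z * star z = (Complex.normSq z : ℂ) := Complex.mul_conj
    rw [this, this, ← Complex.ofReal_add, hν, Complex.ofReal_one]
  rw [Matrix.mem_specialUnitaryGroup_iff, Matrix.mem_unitaryGroup_iff]
  constructor
  · ext i j
    fin_cases i <;> fin_cases j <;>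
      simp [spinRotation, Matrix.mul_apply, Fin.sum_univ_two, Matrix.star_apply] <;>
      simp only [Complex.star_def] at h ⊢ <;> first | linear_combination h | ring
  · rw [Matrix.det_fin_two]
    simp [spinRotation]
    simp only [Complex.star_def] at h
    linear_combination h

/-- Splitting off a multiple of the identity shows that only the second column of `U` matters. In
`mixedState` the second slot holds the larger ball, as `t ≤ 1 / 2`. -/
lemma unitary_conj_diagonal {U : SpinMatrix} (hU : U ∈ Matrix.specialUnitaryGroup (Fin 2) ℂ) (x y : ℂ) :
    U * Matrix.diagonal ![x, y] * star U =
      x • (1 : SpinMatrix) + (y - x) • Matrix.vecMulVec (fun i => U i 1) (star fun i => U i 1) := by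
  have h : U * star U = 1 := Matrix.mem_unitaryGroup_iff.1 (Matrix.mem_specialUnitaryGroup_iff.1 hU).1
  rw [← h]
  ext i j
  simp [Matrix.mul_apply, Fin.sum_univ_two, Matrix.vecMulVec_apply, Matrix.star_apply,
    Matrix.diagonal_apply]
  ring

lemma normSq_column {U : SpinMatrix} (hU : U ∈ Matrix.specialUnitaryGroup (Fin 2) ℂ) :
    Complex.normSq (U 0 1) + Complex.normSq (U 1 1) = 1 := by
  have h : star U * U = 1 :=
    Matrix.mem_unitaryGroup_iff'.1 (Matrix.mem_specialUnitaryGroup_iff.1 hU).1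
  have h1 := congrFun (congrFun h 1) 1
  simp only [Matrix.mul_apply, Fin.sum_univ_two, Matrix.star_apply, Matrix.one_apply_eq] at h1
  have h2 : ∀ z : ℂ, star z * z = (Complex.normSq z : ℂ) := fun z => Complex.normSq_eq_conj_mul_self.symm
  rw [h2, h2] at h1
  exact_mod_cast h1

/-- A rank-one projection is a rotated `diag(0, 1)`. -/
lemma exists_rotation_of_projection {M : SpinMatrix} (hM : M.IsHermitian) (hi : eigHi M = 1)
    (lo : eigLo M = 0) : ∃ U ∈ Matrix.specialUnitaryGroup (Fin 2) ℂ,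
      M = Matrix.vecMulVec (fun i => U i 1) (star fun i => U i 1) := by
  have g := spinGap_sq M
  unfold eigHi at hi
  unfold eigLo at lo
  rw [show spinGap M = 1 by linarith] at g
  have tM : (M 0 0).re = 1 - (M 1 1).re := by linarith
  obtain ⟨h10r, h10i, h00, h11⟩ := isHermitian_entries hM
  set b := (M 1 1).re with hb
  set u := (M 0 1).re with hu
  set w := (M 0 1).im with hw
  have hdet : u ^ 2 + w ^ 2 = (1 - b) * b := by rw [tM] at g; nlinarith
  have hb0 : 0 ≤ b := by nlinarith [sq_nonneg u, sq_nonneg w]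
  -- If `M` projects onto `ν` with `ν 1 = √b`, its second column is `√b • ν`, which determines `ν`
  -- unless `b = 0`; in that case `M` is `diag(1, 0)`.
  rcases hb0.eq_or_lt with hb0 | hb0
  · have hu0 : u = 0 := by
      refine pow_eq_zero_iff two_ne_zero |>.1 (le_antisymm ?_ (sq_nonneg _))
      rw [← hb0] at hdet
      nlinarith [sq_nonneg w]
    have hw0 : w = 0 := by
      refine pow_eq_zero_iff two_ne_zero |>.1 (le_antisymm ?_ (sq_nonneg _))
      rw [← hb0] at hdet
      nlinarith [sq_nonneg u]
    refine ⟨spinRotation ![1, 0], spinRotation_mem (by simp), ?_⟩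
    ext i j
    fin_cases i <;> fin_cases j <;> apply Complex.ext <;>
      simp [spinRotation, Matrix.vecMulVec_apply] <;> linarith
  · have hsb : 0 < √b := Real.sqrt_pos.2 hb0
    have hsq : √b ^ 2 = b := Real.sq_sqrt hb0.le
    refine ⟨spinRotation ![⟨u / √b, w / √b⟩, (√b : ℝ)], spinRotation_mem ?_, ?_⟩
    · simp only [Matrix.cons_val_zero, Matrix.cons_val_one, Complex.normSq_apply,
        Complex.ofReal_re, Complex.ofReal_im]
      field_simp
      nlinarith
    · ext i j
      fin_cases i <;> fin_cases j <;> apply Complex.ext <;>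
        simp [spinRotation, Matrix.vecMulVec_apply, ← hu, ← hw, ← hb, h10r, h10i, h00, h11, tM] <;>
        field_simp <;> nlinarith

end Spin

/-! ### Energies of the mixed states -/

/-- The energy `F(ρ, t)` of the mixed states of polarisation `t`: kinetic part. -/
noncomputable def mixedKinetic (d : ℕ) (ρ t : ℝ) : ℝ :=
  kappaConst d * (t * ρ) ^ (1 + 2 / (d : ℝ)) + kappaConst d * ((1 - t) * ρ) ^ (1 + 2 / (d : ℝ))

/-- The exchange part of the energy of the mixed states of polarisation `t`. -/
noncomputable def mixedExchange (d : ℕ) (s ρ t : ℝ) : ℝ :=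
  lambdaConst d s * (t * ρ) ^ (1 + s / (d : ℝ)) + lambdaConst d s * ((1 - t) * ρ) ^ (1 + s / (d : ℝ))

section Mixed

variable {d : ℕ} {s : ℝ}

lemma radialEnergy_congr_ae {φ : ℝ → ℝ} {f g : Momentum d → ℝ} (h : f =ᵐ[volume] g) :
    radialEnergy φ f = radialEnergy φ g := by
  refine lintegral_congr_ae ?_
  filter_upwards [h] with x hx
  refine lintegral_congr_ae ?_
  filter_upwards [h] with y hy
  rw [hx, hy]

lemma rieszInteraction_eq (d : ℕ) (s : ℝ) (k : Momentum d) :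
    rieszInteraction d s k = rieszConst d s * rieszProfile d s ‖k‖ := by
  rw [rieszInteraction, rieszProfile_norm]

lemma measurable_riesz_pair {f g : Momentum d → ℝ} (hfm : Measurable f) (hgm : Measurable g) :
    Measurable fun p : Momentum d × Momentum d => ENNReal.ofReal
      (rieszInteraction d s (p.1 - p.2) * (f p.1 * f p.2 + g p.1 * g p.2)) := by
  simp_rw [rieszInteraction_eq]
  have := measurable_rieszProfile d s
  fun_prop

lemma lintegral_riesz_pair (hs : 0 < s) (hsd : s < d) {f g : Momentum d → ℝ} (hfm : Measurable f)
    (hf : ∀ x, 0 ≤ f x) (hg : ∀ x, 0 ≤ g x) :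
    ∫⁻ k, ∫⁻ k', ENNReal.ofReal
      (rieszInteraction d s (k - k') * (f k * f k' + g k * g k')) =
      ENNReal.ofReal (rieszConst d s) * radialEnergy (rieszProfile d s) f +
        ENNReal.ofReal (rieszConst d s) * radialEnergy (rieszProfile d s) g := by
  have hc := rieszConst_pos hs hsd
  have hφ := measurable_rieszProfile d s
  have hmf := measurable_radialIntegrand hφ hfm hfm
  rw [← mul_add, radialEnergy, radialEnergy,
    ← lintegral_add_left (hmf.lintegral_prod_right' (ν := volume)),
    ← lintegral_const_mul' _ _ ENNReal.ofReal_ne_top]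
  refine lintegral_congr fun k => ?_
  simp only
  rw [← lintegral_add_left (by fun_prop), ← lintegral_const_mul' _ _ ENNReal.ofReal_ne_top]
  refine lintegral_congr fun k' => ?_
  have h1 := rieszProfile_nonneg d s ‖k - k'‖
  rw [← ENNReal.ofReal_add (mul_nonneg h1 (mul_nonneg (hf _) (hf _)))
    (mul_nonneg h1 (mul_nonneg (hg _) (hg _))), ← ENNReal.ofReal_mul hc.le, rieszInteraction_eq]
  congr 1
  ring

/-- The Fermi ball of density `ρ` as a real function. -/
noncomputable def fermiIndicator (d : ℕ) (ρ : ℝ) : Momentum d → ℝ :=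
  (Metric.closedBall (0 : Momentum d) (fermiRadius d ρ)).indicator 1

lemma fermiBall_eq_indicator (hd : d ≠ 0) {ρ : ℝ} (hρ : 0 ≤ ρ) (k : Momentum d) :
    fermiBall d ρ k = (fermiIndicator d ρ k : ℂ) := by
  rw [fermiBall_eq hd hρ, fermiIndicator]
  by_cases h : ‖k‖ ≤ fermiRadius d ρ <;> simp [h]

lemma measurable_fermiIndicator (d : ℕ) (ρ : ℝ) : Measurable (fermiIndicator d ρ) :=
  measurable_one.indicator measurableSet_closedBall

lemma fermiIndicator_mem_Icc (ρ : ℝ) (k : Momentum d) : fermiIndicator d ρ k ∈ Set.Icc (0 : ℝ) 1 := by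
  unfold fermiIndicator
  by_cases h : k ∈ Metric.closedBall (0 : Momentum d) (fermiRadius d ρ) <;> simp [Set.indicator, h]

lemma fermiIndicator_ae_eq (hd : d ≠ 0) (ρ : ℝ) : fermiIndicator d ρ =ᵐ[volume]
    (Metric.ball (0 : Momentum d) (fermiRadius d ρ)).indicator 1 := by
  have : NeZero d := ⟨hd⟩
  have hsphere : ∀ᵐ x : Momentum d, x ∉ Metric.sphere (0 : Momentum d) (fermiRadius d ρ) :=
    measure_eq_zero_iff_ae_notMem.1 (Measure.addHaar_sphere _ _ _)
  filter_upwards [hsphere] with x hx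
  rw [fermiIndicator]
  have h : x ∈ Metric.closedBall (0 : Momentum d) (fermiRadius d ρ) ↔
      x ∈ Metric.ball (0 : Momentum d) (fermiRadius d ρ) := by
    simp only [mem_sphere_iff_norm, sub_zero] at hx
    rw [mem_closedBall_zero_iff, mem_ball_zero_iff]
    exact ⟨fun h => lt_of_le_of_ne h hx, le_of_lt⟩
  by_cases hx' : x ∈ Metric.ball (0 : Momentum d) (fermiRadius d ρ)
  · rw [Set.indicator_of_mem hx', Set.indicator_of_mem (h.2 hx')]
  · rw [Set.indicator_of_notMem hx', Set.indicator_of_notMem (mt h.1 hx')]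

lemma lintegral_fermiIndicator (hd : d ≠ 0) {ρ : ℝ} (hρ : 0 ≤ ρ) :
    ∫⁻ k, ENNReal.ofReal (fermiIndicator d ρ k) = ENNReal.ofReal ((2 * Real.pi) ^ d * ρ) := by
  rw [← volume_ball_fermiRadius hd hρ, ← lintegral_indicator_ball]
  refine lintegral_congr_ae ?_
  filter_upwards [fermiIndicator_ae_eq hd ρ] with k hk
  rw [hk]

lemma lintegral_norm_sq_fermiIndicator (hd : d ≠ 0) (ρ : ℝ) :
    ∫⁻ k, ENNReal.ofReal (‖k‖ ^ 2 * fermiIndicator d ρ k) =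
      ∫⁻ x in Metric.ball (0 : Momentum d) (fermiRadius d ρ), ENNReal.ofReal (‖x‖ ^ 2) := by
  rw [← lintegral_indicator measurableSet_ball]
  refine lintegral_congr_ae ?_
  filter_upwards [fermiIndicator_ae_eq hd ρ] with k hk
  rw [hk]
  by_cases h : k ∈ Metric.ball (0 : Momentum d) (fermiRadius d ρ)
  · simp only [Set.indicator_of_mem h, Pi.one_apply, mul_one]
  · simp only [Set.indicator_of_notMem h, mul_zero, ENNReal.ofReal_zero]

lemma integrable_fermiIndicator (d : ℕ) (ρ : ℝ) : Integrable (fermiIndicator d ρ) :=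
  (integrable_indicator_iff measurableSet_closedBall).2
    (integrableOn_const measure_closedBall_lt_top.ne)

lemma integral_fermiIndicator (hd : d ≠ 0) {ρ : ℝ} (hρ : 0 ≤ ρ) :
    ∫ k, fermiIndicator d ρ k = (2 * Real.pi) ^ d * ρ := by
  rw [integral_eq_lintegral_of_nonneg_ae
    (Filter.Eventually.of_forall fun k => (fermiIndicator_mem_Icc ρ k).1)
    (measurable_fermiIndicator d ρ).aestronglyMeasurable, lintegral_fermiIndicator hd hρ,
    ENNReal.toReal_ofReal (by positivity)]

variable {ρ t : ℝ} {U : SpinMatrix}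

lemma mixedState_eq (hd : d ≠ 0) (hρ : 0 ≤ ρ) (ht : t ∈ Set.Icc (0 : ℝ) 1) (k : Momentum d) :
    mixedState d ρ t U k = U * Matrix.diagonal ![(fermiIndicator d (t * ρ) k : ℂ),
      (fermiIndicator d ((1 - t) * ρ) k : ℂ)] * star U := by
  rw [mixedState, fermiBall_eq_indicator hd (mul_nonneg ht.1 hρ),
    fermiBall_eq_indicator hd (mul_nonneg (sub_nonneg.2 ht.2) hρ)]

lemma star_mul_self_of_mem (hU : U ∈ Matrix.specialUnitaryGroup (Fin 2) ℂ) : star U * U = 1 :=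
  Matrix.mem_unitaryGroup_iff'.1 (Matrix.mem_specialUnitaryGroup_iff.1 hU).1

lemma self_mul_star_of_mem (hU : U ∈ Matrix.specialUnitaryGroup (Fin 2) ℂ) : U * star U = 1 :=
  Matrix.mem_unitaryGroup_iff.1 (Matrix.mem_specialUnitaryGroup_iff.1 hU).1

lemma trace_conj_diagonal_re (hU : U ∈ Matrix.specialUnitaryGroup (Fin 2) ℂ) (x y : ℝ) :
    (U * Matrix.diagonal ![(x : ℂ), (y : ℂ)] * star U).trace.re = x + y := by
  rw [Matrix.trace_mul_cycle, star_mul_self_of_mem hU, one_mul, Matrix.trace_fin_two]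
  simp

lemma trace_conj_diagonal_mul_re (hU : U ∈ Matrix.specialUnitaryGroup (Fin 2) ℂ)
    (x y x' y' : ℝ) :
    (U * Matrix.diagonal ![(x : ℂ), (y : ℂ)] * star U *
      (U * Matrix.diagonal ![(x' : ℂ), (y' : ℂ)] * star U)).trace.re = x * x' + y * y' := by
  have h : U * Matrix.diagonal ![(x : ℂ), (y : ℂ)] * star U *
      (U * Matrix.diagonal ![(x' : ℂ), (y' : ℂ)] * star U) =
      U * Matrix.diagonal ![((x * x' : ℝ) : ℂ), ((y * y' : ℝ) : ℂ)] * star U := by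
    calc _ = U * (Matrix.diagonal ![(x : ℂ), (y : ℂ)] * (star U * U) *
          Matrix.diagonal ![(x' : ℂ), (y' : ℂ)]) * star U := by noncomm_ring
      _ = _ := by
        rw [star_mul_self_of_mem hU, mul_one, Matrix.diagonal_mul_diagonal]
        congr 3
        ext i
        fin_cases i <;> simp
  rw [h, trace_conj_diagonal_re hU]

lemma posSemidef_diagonal_pair {x y : ℝ} (hx : 0 ≤ x) (hy : 0 ≤ y) :
    (Matrix.diagonal ![(x : ℂ), (y : ℂ)]).PosSemidef := by
  refine Matrix.PosSemidef.diagonal fun i => ?_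
  fin_cases i
  · exact Complex.zero_le_real.2 hx
  · exact Complex.zero_le_real.2 hy

lemma isHFState_mixedState (hd : d ≠ 0) (hρ : 0 ≤ ρ) (ht : t ∈ Set.Icc (0 : ℝ) 1)
    (hU : U ∈ Matrix.specialUnitaryGroup (Fin 2) ℂ) : IsHFState d ρ (mixedState d ρ t U) where
  aemeasurable i j := by
    have h1 := measurable_fermiIndicator d (t * ρ)
    have h2 := measurable_fermiIndicator d ((1 - t) * ρ)
    have : (fun k => mixedState d ρ t U k i j) = fun k =>
        U i 0 * (fermiIndicator d (t * ρ) k : ℂ) * star (U j 0) +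
          U i 1 * (fermiIndicator d ((1 - t) * ρ) k : ℂ) * star (U j 1) := by
      funext k
      rw [mixedState_eq hd hρ ht]
      simp [Matrix.mul_apply, Fin.sum_univ_two, Matrix.diagonal_apply, Matrix.star_apply]
    rw [this]
    exact Measurable.aemeasurable (by fun_prop)
  nonneg := Filter.Eventually.of_forall fun k => by
    rw [mixedState_eq hd hρ ht]
    exact (posSemidef_diagonal_pair (fermiIndicator_mem_Icc _ k).1
      (fermiIndicator_mem_Icc _ k).1).mul_mul_conjTranspose_same U
  le_one := Filter.Eventually.of_forall fun k => by
    rw [mixedState_eq hd hρ ht]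
    have : 1 - U * Matrix.diagonal ![(fermiIndicator d (t * ρ) k : ℂ),
        (fermiIndicator d ((1 - t) * ρ) k : ℂ)] * star U =
        U * Matrix.diagonal ![((1 - fermiIndicator d (t * ρ) k : ℝ) : ℂ),
        ((1 - fermiIndicator d ((1 - t) * ρ) k : ℝ) : ℂ)] * star U := by
      have e : Matrix.diagonal ![((1 - fermiIndicator d (t * ρ) k : ℝ) : ℂ),
        ((1 - fermiIndicator d ((1 - t) * ρ) k : ℝ) : ℂ)] = 1 -
          Matrix.diagonal ![(fermiIndicator d (t * ρ) k : ℂ),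
          (fermiIndicator d ((1 - t) * ρ) k : ℂ)] := by
        rw [← Matrix.diagonal_one, Matrix.diagonal_sub]
        congr 1
        ext i
        fin_cases i <;> simp
      rw [e, mul_sub U, mul_one, sub_mul U, self_mul_star_of_mem hU]
    rw [this]
    exact (posSemidef_diagonal_pair (sub_nonneg.2 (fermiIndicator_mem_Icc _ k).2)
      (sub_nonneg.2 (fermiIndicator_mem_Icc _ k).2)).mul_mul_conjTranspose_same U
  integrable := by
    simp_rw [mixedState_eq hd hρ ht, trace_conj_diagonal_re hU]
    exact (integrable_fermiIndicator d _).add (integrable_fermiIndicator d _)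
  density := by
    simp_rw [mixedState_eq hd hρ ht, trace_conj_diagonal_re hU]
    rw [integral_add (integrable_fermiIndicator d _) (integrable_fermiIndicator d _),
      integral_fermiIndicator hd (mul_nonneg ht.1 hρ),
      integral_fermiIndicator hd (mul_nonneg (sub_nonneg.2 ht.2) hρ)]
    field_simp
    ring

lemma mixedKinetic_eq (hd : d ≠ 0) (hρ : 0 ≤ ρ) (ht : t ∈ Set.Icc (0 : ℝ) 1) :
    ENNReal.ofReal (mixedKinetic d ρ t) =
      ENNReal.ofReal (1 / (2 * (2 * Real.pi) ^ d)) *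
      ((∫⁻ x in Metric.ball (0 : Momentum d) (fermiRadius d (t * ρ)), ENNReal.ofReal (‖x‖ ^ 2)) +
      ∫⁻ x in Metric.ball (0 : Momentum d) (fermiRadius d ((1 - t) * ρ)),
        ENNReal.ofReal (‖x‖ ^ 2)) := by
  have h1 := mul_nonneg ht.1 hρ
  have h2 := mul_nonneg (sub_nonneg.2 ht.2) hρ
  have hκ := kappaConst_pos hd
  rw [mul_add, kinetic_fermiBall hd h1, kinetic_fermiBall hd h2, mixedKinetic,
    ENNReal.ofReal_add (by positivity) (by positivity)]

lemma mixedExchange_eq (hd : d ≠ 0) (hs : 0 < s) (hsd : s < d) (hρ : 0 ≤ ρ)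
    (ht : t ∈ Set.Icc (0 : ℝ) 1) :
    ENNReal.ofReal (mixedExchange d s ρ t) = ENNReal.ofReal (1 / (2 * (2 * Real.pi) ^ d)) *
      (ENNReal.ofReal (rieszConst d s) * radialEnergy (rieszProfile d s)
        ((Metric.ball (0 : Momentum d) (fermiRadius d (t * ρ))).indicator 1) +
      ENNReal.ofReal (rieszConst d s) * radialEnergy (rieszProfile d s)
        ((Metric.ball (0 : Momentum d) (fermiRadius d ((1 - t) * ρ))).indicator 1)) := by
  have h1 := mul_nonneg ht.1 hρ
  have h2 := mul_nonneg (sub_nonneg.2 ht.2) hρ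
  have hl := lambdaConst_pos hd hs hsd
  rw [mul_add, exchange_fermiBall hd hs hsd h1, exchange_fermiBall hd hs hsd h2, mixedExchange,
    ENNReal.ofReal_add (by positivity) (by positivity)]

lemma kineticEnergy_mixedState (hd : d ≠ 0) (hρ : 0 ≤ ρ) (ht : t ∈ Set.Icc (0 : ℝ) 1)
    (hU : U ∈ Matrix.specialUnitaryGroup (Fin 2) ℂ) :
    kineticEnergy d (mixedState d ρ t U) = ENNReal.ofReal (mixedKinetic d ρ t) := by
  have h1 := measurable_fermiIndicator d (t * ρ)
  rw [mixedKinetic_eq hd hρ ht, kineticEnergy, ← lintegral_norm_sq_fermiIndicator hd,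
    ← lintegral_norm_sq_fermiIndicator hd, ← lintegral_add_left (by fun_prop)]
  congr 1
  refine lintegral_congr fun k => ?_
  rw [mixedState_eq hd hρ ht, trace_conj_diagonal_re hU, mul_add, ENNReal.ofReal_add]
  · exact mul_nonneg (sq_nonneg _) (fermiIndicator_mem_Icc _ k).1
  · exact mul_nonneg (sq_nonneg _) (fermiIndicator_mem_Icc _ k).1

lemma exchangeEnergy_mixedState (hd : d ≠ 0) (hs : 0 < s) (hsd : s < d) (hρ : 0 ≤ ρ)
    (ht : t ∈ Set.Icc (0 : ℝ) 1) (hU : U ∈ Matrix.specialUnitaryGroup (Fin 2) ℂ) :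
    exchangeEnergy d (rieszInteraction d s) (mixedState d ρ t U) =
      ENNReal.ofReal (mixedExchange d s ρ t) := by
  rw [mixedExchange_eq hd hs hsd hρ ht, exchangeEnergy,
    ← radialEnergy_congr_ae (fermiIndicator_ae_eq hd _),
    ← radialEnergy_congr_ae (fermiIndicator_ae_eq hd _), ← lintegral_riesz_pair hs hsd
      (measurable_fermiIndicator d _)
      (fun k => (fermiIndicator_mem_Icc _ k).1) (fun k => (fermiIndicator_mem_Icc _ k).1)]
  congr 1
  refine lintegral_congr fun k => lintegral_congr fun k' => ?_
  rw [mixedState_eq hd hρ ht, mixedState_eq hd hρ ht, trace_conj_diagonal_mul_re hU]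

end Mixed

/-! ### Lower bound on the energy of an arbitrary state -/

section LowerBound

variable {d : ℕ} {s ρ : ℝ} {γ : DensityMatrix d}

/-- Clipping a measurable representative to `[0, 1]` provides the pointwise bounds that the
rearrangement and bathtub lemmas ask for. -/
lemma exists_measurable_mem_Icc {f : Momentum d → ℝ} (hfm : AEMeasurable f volume)
    (hf : ∀ᵐ x, f x ∈ Set.Icc (0 : ℝ) 1) :
    ∃ g : Momentum d → ℝ, Measurable g ∧ (∀ x, g x ∈ Set.Icc (0 : ℝ) 1) ∧ f =ᵐ[volume] g := by
  refine ⟨fun x => max 0 (min 1 (hfm.mk f x)), by have := hfm.measurable_mk; fun_prop,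
    fun x => ⟨le_max_left _ _, max_le zero_le_one (min_le_left _ _)⟩, ?_⟩
  filter_upwards [hfm.ae_eq_mk, hf] with x h1 h2
  rw [← h1, min_eq_right h2.2, max_eq_right h2.1]

lemma aemeasurable_spinGap (h : ∀ i j, AEMeasurable (fun k => γ k i j) volume) :
    AEMeasurable (fun k => spinGap (γ k)) volume := by
  have h1 := Complex.measurable_re.comp_aemeasurable (h 0 0)
  have h2 := Complex.measurable_re.comp_aemeasurable (h 1 1)
  have h3 := Complex.measurable_re.comp_aemeasurable (h 0 1)
  have h4 := Complex.measurable_im.comp_aemeasurable (h 0 1)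
  simp only [Function.comp_def] at h1 h2 h3 h4
  unfold spinGap
  simp_rw [Complex.normSq_apply]
  fun_prop

lemma aemeasurable_eigHi (h : ∀ i j, AEMeasurable (fun k => γ k i j) volume) :
    AEMeasurable (fun k => eigHi (γ k)) volume := by
  have h1 := Complex.measurable_re.comp_aemeasurable (h 0 0)
  have h2 := Complex.measurable_re.comp_aemeasurable (h 1 1)
  have h3 := aemeasurable_spinGap h
  simp only [Function.comp_def] at h1 h2
  unfold eigHi
  fun_prop

lemma aemeasurable_eigLo (h : ∀ i j, AEMeasurable (fun k => γ k i j) volume) :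
    AEMeasurable (fun k => eigLo (γ k)) volume := by
  have h1 := Complex.measurable_re.comp_aemeasurable (h 0 0)
  have h2 := Complex.measurable_re.comp_aemeasurable (h 1 1)
  have h3 := aemeasurable_spinGap h
  simp only [Function.comp_def] at h1 h2
  unfold eigLo
  fun_prop

/-- The eigenvalues of a state, made measurable and bounded everywhere. -/
lemma exists_eigenvalue_functions (hγ : IsHFState d ρ γ) :
    ∃ f g : Momentum d → ℝ, Measurable f ∧ Measurable g ∧ (∀ k, f k ∈ Set.Icc (0 : ℝ) 1) ∧
      (∀ k, g k ∈ Set.Icc (0 : ℝ) 1) ∧ (∀ᵐ k, eigHi (γ k) = f k) ∧ ∀ᵐ k, eigLo (γ k) = g k := by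
  obtain ⟨f, hfm, hf, hfe⟩ := exists_measurable_mem_Icc (aemeasurable_eigHi hγ.aemeasurable) (by
    filter_upwards [hγ.nonneg, hγ.le_one] with k h0 h1
    exact ⟨(eigLo_nonneg h0).trans (eigLo_le_eigHi _), eigHi_le_one h1⟩)
  obtain ⟨g, hgm, hg, hge⟩ := exists_measurable_mem_Icc (aemeasurable_eigLo hγ.aemeasurable) (by
    filter_upwards [hγ.nonneg, hγ.le_one] with k h0 h1
    exact ⟨eigLo_nonneg h0, (eigLo_le_eigHi _).trans (eigHi_le_one h1)⟩)
  exact ⟨f, g, hfm, hgm, hf, hg, hfe, hge⟩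

/-- Here `t` is the share of the total mass carried by the smaller eigenvalue, hence at most `1 /
2`. -/
lemma exists_polarisation (hd : d ≠ 0) (hρ : 0 < ρ) (hγ : IsHFState d ρ γ) {f g : Momentum d → ℝ}
    (hfm : Measurable f) (hf : ∀ k, f k ∈ Set.Icc (0 : ℝ) 1)
    (hg : ∀ k, g k ∈ Set.Icc (0 : ℝ) 1) (hfe : ∀ᵐ k, eigHi (γ k) = f k)
    (hge : ∀ᵐ k, eigLo (γ k) = g k) :
    ∃ t ∈ Set.Icc (0 : ℝ) (1 / 2),
      (∫⁻ k, ENNReal.ofReal (f k) =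
        volume (Metric.ball (0 : Momentum d) (fermiRadius d ((1 - t) * ρ)))) ∧
      ∫⁻ k, ENNReal.ofReal (g k) =
        volume (Metric.ball (0 : Momentum d) (fermiRadius d (t * ρ))) := by
  have hπ : 0 < (2 * Real.pi) ^ d := by positivity
  have hsum : (∫⁻ k, ENNReal.ofReal (f k)) + ∫⁻ k, ENNReal.ofReal (g k) =
      ENNReal.ofReal ((2 * Real.pi) ^ d * ρ) := by
    have h1 : (2 * Real.pi) ^ d * ρ = ∫ k, (γ k).trace.re := by
      rw [← hγ.density]
      field_simp
    rw [h1, ofReal_integral_eq_lintegral_ofReal hγ.integrable, ← lintegral_add_left (by fun_prop)]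
    · refine lintegral_congr_ae ?_
      filter_upwards [hfe, hge] with k h2 h3
      rw [trace_re_eq, h2, h3, ENNReal.ofReal_add (hf k).1 (hg k).1]
    · filter_upwards [hγ.nonneg] with k h2
      exact (Complex.le_def.1 h2.trace_nonneg).1
  have hle : ∫⁻ k, ENNReal.ofReal (g k) ≤ ∫⁻ k, ENNReal.ofReal (f k) := by
    refine lintegral_mono_ae ?_
    filter_upwards [hfe, hge] with k h2 h3
    rw [← h2, ← h3]
    exact ENNReal.ofReal_le_ofReal (eigLo_le_eigHi _)
  have hgfin : ∫⁻ k, ENNReal.ofReal (g k) ≠ ⊤ := fun h => ENNReal.ofReal_ne_top (by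
    rw [← hsum, h, add_top])
  have hffin : ∫⁻ k, ENNReal.ofReal (f k) ≠ ⊤ := fun h => ENNReal.ofReal_ne_top (by
    rw [← hsum, h, top_add])
  have hle' := ENNReal.toReal_mono hffin hle
  have hsum' := congrArg ENNReal.toReal hsum
  rw [ENNReal.toReal_add hffin hgfin, ENNReal.toReal_ofReal (by positivity)] at hsum'
  set mf := (∫⁻ k, ENNReal.ofReal (f k)).toReal with hmf
  set mg := (∫⁻ k, ENNReal.ofReal (g k)).toReal with hmg
  have hmg0 : 0 ≤ mg := ENNReal.toReal_nonneg
  have ht : mg / ((2 * Real.pi) ^ d * ρ) ∈ Set.Icc (0 : ℝ) (1 / 2) := by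
    refine ⟨by positivity, ?_⟩
    rw [div_le_iff₀ (by positivity)]
    linarith
  refine ⟨_, ht, ?_, ?_⟩
  · rw [volume_ball_fermiRadius hd (mul_nonneg (by linarith [ht.2]) hρ.le),
      ← ENNReal.ofReal_toReal hffin, ← hmf]
    congr 1
    field_simp
    linarith
  · rw [volume_ball_fermiRadius hd (mul_nonneg ht.1 hρ.le), ← ENNReal.ofReal_toReal hgfin, ← hmg]
    congr 1
    field_simp

lemma ofReal_coeff_ne_zero (d : ℕ) : ENNReal.ofReal (1 / (2 * (2 * Real.pi) ^ d)) ≠ 0 := by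
  have : 0 < 1 / (2 * (2 * Real.pi) ^ d) := by positivity
  exact (ENNReal.ofReal_pos.2 this).ne'

/-- If both inequalities for the kinetic and exchange energies are equalities, the state is mixed. -/
lemma ae_eq_mixedState (hd : d ≠ 0) (hs : 0 < s) (hsd : s < d) (hρ : 0 < ρ)
    (hγ : IsHFState d ρ γ) {f g : Momentum d → ℝ}
    (hfe : ∀ᵐ k, eigHi (γ k) = f k) (hge : ∀ᵐ k, eigLo (γ k) = g k) {t : ℝ}
    (ht : t ∈ Set.Icc (0 : ℝ) (1 / 2))
    (hfi : f =ᵐ[volume] fermiIndicator d ((1 - t) * ρ))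
    (hgi : g =ᵐ[volume] fermiIndicator d (t * ρ))
    (htr : ∀ᵐ k, ∀ᵐ k', ENNReal.ofReal (rieszInteraction d s (k - k') * (γ k * γ k').trace.re) =
      ENNReal.ofReal (rieszInteraction d s (k - k') * (f k * f k' + g k * g k'))) :
    ∃ U ∈ Matrix.specialUnitaryGroup (Fin 2) ℂ, γ =ᵐ[volume] mixedState d ρ t U := by
  have : NeZero d := ⟨hd⟩
  have hdich : ∀ (r : ℝ) (k : Momentum d), fermiIndicator d r k = 0 ∨ fermiIndicator d r k = 1 := by
    intro r k
    unfold fermiIndicator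
    by_cases h : k ∈ Metric.closedBall (0 : Momentum d) (fermiRadius d r) <;>
      simp [Set.indicator, h]
  obtain ⟨U, hU, hproj⟩ : ∃ U ∈ Matrix.specialUnitaryGroup (Fin 2) ℂ, ∀ᵐ k, f k = 1 → g k = 0 →
      γ k = Matrix.vecMulVec (fun i => U i 1) (star fun i => U i 1) := by
    -- If almost no momentum has eigenvalues `1` and `0`, every rotation will do. Otherwise the
    -- projection at one generic such `k₀` fixes the axis: as `w > 0`, equality in the trace bound
    -- at `(k₀, k)` aligns almost every other such `k` with it.
    by_cases hne : ∀ᵐ k, ¬(f k = 1 ∧ g k = 0)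
    · refine ⟨1, one_mem _, ?_⟩
      filter_upwards [hne] with k hk h1 h2
      exact absurd ⟨h1, h2⟩ hk
    · have hfr : ∃ᵐ k, f k = 1 ∧ g k = 0 := by
        simpa only [not_not] using Filter.not_eventually.1 hne
      obtain ⟨k₀, ⟨hf0, hg0⟩, h0, hfe0, hge0, htr0⟩ :=
        (hfr.and_eventually (hγ.nonneg.and (hfe.and (hge.and htr)))).exists
      obtain ⟨U, hU, hUe⟩ := exists_rotation_of_projection h0.isHermitian (hfe0.trans hf0)
        (hge0.trans hg0)
      refine ⟨U, hU, ?_⟩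
      rw [← hUe]
      have hk0 : ∀ᵐ k : Momentum d, k ≠ k₀ := by simp [ae_iff]
      filter_upwards [htr0, hγ.nonneg, hfe, hge, hk0] with k hk hpos hfk hgk hkk hf1 hg1
      have hw : 0 < rieszInteraction d s (k₀ - k) := by
        rw [rieszInteraction_eq]
        exact mul_pos (rieszConst_pos hs hsd)
          (rieszProfile_pos (norm_pos_iff.2 (sub_ne_zero.2 hkk.symm)))
      rw [hf0, hg0, hf1, hg1, ENNReal.ofReal_eq_ofReal_iff
        (mul_nonneg hw.le (trace_mul_re_nonneg h0 hpos)) (by linarith),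
        mul_right_inj' hw.ne'] at hk
      exact (eq_of_trace_mul_eq_one h0.isHermitian hpos.isHermitian (hfe0.trans hf0)
        (hge0.trans hg0) (hfk.trans hf1) (hgk.trans hg1) (by linarith)).symm
  refine ⟨U, hU, ?_⟩
  filter_upwards [hγ.nonneg, hfe, hge, hfi, hgi, hproj] with k h0 hfk hgk hfik hgik hpk
  rw [mixedState_eq hd hρ.le ⟨ht.1, by linarith [ht.2]⟩, ← hfik, ← hgik, unitary_conj_diagonal hU]
  have hle : g k ≤ f k := by
    rw [← hfk, ← hgk]
    exact eigLo_le_eigHi _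
  -- Equal eigenvalues give a scalar matrix and `f = 1`, `g = 0` the fixed projection, while `f =
  -- 0`, `g = 1` contradicts `g ≤ f`.
  rcases hdich ((1 - t) * ρ) k with h1 | h1 <;> rcases hdich (t * ρ) k with h2 | h2 <;>
    rw [← hfik] at h1 <;> rw [← hgik] at h2
  · rw [eq_smul_one_of_eig_eq h0.isHermitian (hfk.trans h1) (hgk.trans h2), h1, h2]
    simp
  · linarith
  · rw [hpk h1 h2, h1, h2]
    simp
  · rw [eq_smul_one_of_eig_eq h0.isHermitian (hfk.trans h1) (hgk.trans h2), h1, h2]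
    simp

/-- Equality in the integrated trace inequality forces pointwise equality. -/
lemma ae_ae_eq_of_lintegral_lintegral_le {I J : Momentum d → Momentum d → ENNReal}
    (hJ : Measurable (Function.uncurry J)) (hIJ : ∀ᵐ k, ∀ᵐ k', I k k' ≤ J k k')
    (hfin : ∫⁻ k, ∫⁻ k', J k k' ≠ ⊤) (hle : ∫⁻ k, ∫⁻ k', J k k' ≤ ∫⁻ k, ∫⁻ k', I k k') :
    ∀ᵐ k, ∀ᵐ k', I k k' = J k k' := by
  have hJm : Measurable fun k => ∫⁻ k', J k k' := hJ.lintegral_prod_right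
  have hae : ∀ᵐ k, ∫⁻ k', I k k' ≤ ∫⁻ k', J k k' := by
    filter_upwards [hIJ] with k hk
    exact lintegral_mono_ae hk
  have hIfin : ∫⁻ k, ∫⁻ k', I k k' ≠ ⊤ := ne_top_of_le_ne_top hfin (lintegral_mono_ae hae)
  have heq := ae_eq_of_ae_le_of_lintegral_le hae hIfin hJm.aemeasurable hle
  filter_upwards [hIJ, heq, ae_lt_top hJm hfin] with k h1 h2 h3
  exact ae_eq_of_ae_le_of_lintegral_le h1 (h2.trans_lt h3).ne
    (hJ.of_uncurry_left (x := k)).aemeasurable h2.ge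

/-- Every state has at least the kinetic energy and at most the exchange energy of a mixed state,
with equality only for mixed states. -/
theorem exists_mixed_comparison (hd : d ≠ 0) (hs : 0 < s) (hsd : s < d) (hρ : 0 < ρ)
    (hγ : IsHFState d ρ γ) : ∃ t ∈ Set.Icc (0 : ℝ) (1 / 2),
      ENNReal.ofReal (mixedKinetic d ρ t) ≤ kineticEnergy d γ ∧
      exchangeEnergy d (rieszInteraction d s) γ ≤ ENNReal.ofReal (mixedExchange d s ρ t) ∧
      (kineticEnergy d γ ≤ ENNReal.ofReal (mixedKinetic d ρ t) →
        ENNReal.ofReal (mixedExchange d s ρ t) ≤ exchangeEnergy d (rieszInteraction d s) γ →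
        ∃ U ∈ Matrix.specialUnitaryGroup (Fin 2) ℂ, γ =ᵐ[volume] mixedState d ρ t U) := by
  obtain ⟨f, g, hfm, hgm, hf, hg, hfe, hge⟩ := exists_eigenvalue_functions hγ
  obtain ⟨t, ht, hfmass, hgmass⟩ := exists_polarisation hd hρ hγ hfm hf hg hfe hge
  have ht1 : t ∈ Set.Icc (0 : ℝ) 1 := ⟨ht.1, by linarith [ht.2]⟩
  have hr1 := fermiRadius_nonneg hd (mul_nonneg ht1.1 hρ.le)
  have hr2 := fermiRadius_nonneg hd (mul_nonneg (sub_nonneg.2 ht1.2) hρ.le)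
  have hC := ofReal_coeff_ne_zero d
  have hkin : kineticEnergy d γ = ENNReal.ofReal (1 / (2 * (2 * Real.pi) ^ d)) *
      ((∫⁻ k, ENNReal.ofReal (‖k‖ ^ 2 * g k)) + ∫⁻ k, ENNReal.ofReal (‖k‖ ^ 2 * f k)) := by
    rw [kineticEnergy, ← lintegral_add_left (by fun_prop)]
    congr 1
    refine lintegral_congr_ae ?_
    filter_upwards [hfe, hge] with k h1 h2
    rw [trace_re_eq, h1, h2, ← ENNReal.ofReal_add (mul_nonneg (sq_nonneg _) (hg k).1)
      (mul_nonneg (sq_nonneg _) (hf k).1)]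
    congr 1
    ring
  have hg1 := lintegral_ball_norm_sq_le hr1 hgm hg hgmass
  have hf1 := lintegral_ball_norm_sq_le hr2 hfm hf hfmass
  -- exchange
  have hpair := lintegral_riesz_pair hs hsd hgm (fun k => (hg k).1) (fun k => (hf k).1)
  have hφm := measurable_rieszProfile d s
  have hφ0 := rieszProfile_nonneg d s
  have hφ := antitoneOn_rieszProfile hsd
  have hloc := lintegral_ball_rieszProfile_ne_top hd hs
  have hIJ : ∀ᵐ k, ∀ᵐ k', ENNReal.ofReal (rieszInteraction d s (k - k') * (γ k * γ k').trace.re) ≤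
      ENNReal.ofReal (rieszInteraction d s (k - k') * (g k * g k' + f k * f k')) := by
    filter_upwards [hγ.nonneg, hfe, hge] with k a1 a2 a3
    filter_upwards [hγ.nonneg, hfe, hge] with k' b1 b2 b3
    refine ENNReal.ofReal_le_ofReal (mul_le_mul_of_nonneg_left ?_ ?_)
    · have := trace_mul_re_le a1.isHermitian b1.isHermitian
      rw [a2, a3, b2, b3] at this
      linarith
    · rw [rieszInteraction_eq]
      exact mul_nonneg (rieszConst_pos hs hsd).le (hφ0 _)
  have hex1 : exchangeEnergy d (rieszInteraction d s) γ ≤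
      ENNReal.ofReal (1 / (2 * (2 * Real.pi) ^ d)) * ∫⁻ k, ∫⁻ k', ENNReal.ofReal
        (rieszInteraction d s (k - k') * (g k * g k' + f k * f k')) := by
    rw [exchangeEnergy]
    refine mul_le_mul_right (lintegral_mono_ae ?_) _
    filter_upwards [hIJ] with k hk
    exact lintegral_mono_ae hk
  have hex2 : ENNReal.ofReal (1 / (2 * (2 * Real.pi) ^ d)) * ∫⁻ k, ∫⁻ k', ENNReal.ofReal
        (rieszInteraction d s (k - k') * (g k * g k' + f k * f k')) ≤
      ENNReal.ofReal (mixedExchange d s ρ t) := by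
    rw [hpair, mixedExchange_eq hd hs hsd hρ.le ht1]
    gcongr
    · exact radialEnergy_le_ball hφm hφ0 hφ hloc hd hgm hg hgmass
    · exact radialEnergy_le_ball hφm hφ0 hφ hloc hd hfm hf hfmass
  refine ⟨t, ht, ?_, hex1.trans hex2, fun hkle hxle => ?_⟩
  · rw [hkin, mixedKinetic_eq hd hρ.le ht1]
    gcongr
  · have hgfin : ∫⁻ x in Metric.ball (0 : Momentum d) (fermiRadius d (t * ρ)),
        ENNReal.ofReal (‖x‖ ^ 2) ≠ ⊤ := by
      rw [lintegral_ball_norm_sq hd hr1]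
      exact ENNReal.ofReal_ne_top
    have hffin : ∫⁻ x in Metric.ball (0 : Momentum d) (fermiRadius d ((1 - t) * ρ)),
        ENNReal.ofReal (‖x‖ ^ 2) ≠ ⊤ := by
      rw [lintegral_ball_norm_sq hd hr2]
      exact ENNReal.ofReal_ne_top
    rw [hkin, mixedKinetic_eq hd hρ.le ht1, ENNReal.mul_le_mul_iff_right hC ENNReal.ofReal_ne_top]
      at hkle
    -- Both bathtub inequalities must be equalities, since their sum is one and the terms are
    -- finite. The kinetic term alone thus identifies the balls, and the equality case of the
    -- rearrangement inequality is not needed.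
    have hg2 : ∫⁻ k, ENNReal.ofReal (‖k‖ ^ 2 * g k) ≤
        ∫⁻ x in Metric.ball (0 : Momentum d) (fermiRadius d (t * ρ)), ENNReal.ofReal (‖x‖ ^ 2) :=
      (ENNReal.add_le_add_iff_right hffin).1 ((add_le_add le_rfl hf1).trans hkle)
    have hf2 : ∫⁻ k, ENNReal.ofReal (‖k‖ ^ 2 * f k) ≤
        ∫⁻ x in Metric.ball (0 : Momentum d) (fermiRadius d ((1 - t) * ρ)),
          ENNReal.ofReal (‖x‖ ^ 2) :=
      (ENNReal.add_le_add_iff_left hgfin).1 ((add_le_add hg1 le_rfl).trans hkle)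
    have hgi := (ae_eq_indicator_ball_of_lintegral_norm_sq_le hd hr1 hgm hg hgmass hg2).trans
      (fermiIndicator_ae_eq hd _).symm
    have hfi := (ae_eq_indicator_ball_of_lintegral_norm_sq_le hd hr2 hfm hf hfmass hf2).trans
      (fermiIndicator_ae_eq hd _).symm
    have hJle := hex2.trans hxle
    rw [exchangeEnergy, ENNReal.mul_le_mul_iff_right hC ENNReal.ofReal_ne_top] at hJle
    have hJfin : ∫⁻ k, ∫⁻ k', ENNReal.ofReal
        (rieszInteraction d s (k - k') * (g k * g k' + f k * f k')) ≠ ⊤ := fun h => by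
      rw [h, ENNReal.mul_top hC] at hex2
      exact ENNReal.ofReal_ne_top (top_le_iff.1 hex2)
    have htr := ae_ae_eq_of_lintegral_lintegral_le
      (J := fun k k' => ENNReal.ofReal
        (rieszInteraction d s (k - k') * (g k * g k' + f k * f k')))
      (measurable_riesz_pair hgm hfm) hIJ hJfin hJle
    refine ae_eq_mixedState hd hs hsd hρ hγ hfe hge ht hfi hgi ?_
    filter_upwards [htr] with k hk
    filter_upwards [hk] with k' hk'
    rw [hk', add_comm]

end LowerBound

/-! ### Reduction to the polarisation -/

/-- The energy of the mixed states of polarisation `t`. -/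
noncomputable def mixedEnergy (d : ℕ) (s ρ t : ℝ) : ℝ := mixedKinetic d ρ t - mixedExchange d s ρ t

/-- `t` minimises the energy of the mixed states over `[0, 1 / 2]`. -/
def IsOptimalPolarisation (d : ℕ) (s ρ t : ℝ) : Prop :=
  t ∈ Set.Icc (0 : ℝ) (1 / 2) ∧ ∀ t' ∈ Set.Icc (0 : ℝ) (1 / 2), mixedEnergy d s ρ t ≤ mixedEnergy d s ρ t'

section Reduction

variable {d : ℕ} {s ρ t : ℝ} {γ γ' : DensityMatrix d} {U : SpinMatrix}

lemma kineticEnergy_congr_ae (h : γ =ᵐ[volume] γ') : kineticEnergy d γ = kineticEnergy d γ' := by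
  unfold kineticEnergy
  congr 1
  refine lintegral_congr_ae ?_
  filter_upwards [h] with k hk
  rw [hk]

lemma exchangeEnergy_congr_ae (w : Momentum d → ℝ) (h : γ =ᵐ[volume] γ') :
    exchangeEnergy d w γ = exchangeEnergy d w γ' := by
  unfold exchangeEnergy
  congr 1
  refine lintegral_congr_ae ?_
  filter_upwards [h] with k hk
  refine lintegral_congr_ae ?_
  filter_upwards [h] with k' hk'
  rw [hk, hk']

lemma hfEnergy_congr_ae (w : Momentum d → ℝ) (h : γ =ᵐ[volume] γ') :
    hfEnergy d w γ = hfEnergy d w γ' := by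
  rw [hfEnergy, hfEnergy, kineticEnergy_congr_ae h, exchangeEnergy_congr_ae w h]

lemma IsHFState.congr_ae (hγ : IsHFState d ρ γ) (h : γ =ᵐ[volume] γ') : IsHFState d ρ γ' where
  aemeasurable i j := (hγ.aemeasurable i j).congr (by filter_upwards [h] with k hk; rw [hk])
  nonneg := by filter_upwards [h, hγ.nonneg] with k hk h0; rwa [← hk]
  le_one := by filter_upwards [h, hγ.le_one] with k hk h0; rwa [← hk]
  integrable := hγ.integrable.congr (by filter_upwards [h] with k hk; rw [hk])
  density := by
    rw [← hγ.density]
    congr 1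
    refine integral_congr_ae ?_
    filter_upwards [h] with k hk
    rw [hk]

lemma mixedKinetic_nonneg (hd : d ≠ 0) (hρ : 0 ≤ ρ) (ht : t ∈ Set.Icc (0 : ℝ) 1) :
    0 ≤ mixedKinetic d ρ t := by
  have h1 := mul_nonneg ht.1 hρ
  have h2 := mul_nonneg (sub_nonneg.2 ht.2) hρ
  have hκ := kappaConst_pos hd
  unfold mixedKinetic
  positivity

lemma mixedExchange_nonneg (hd : d ≠ 0) (hs : 0 < s) (hsd : s < d) (hρ : 0 ≤ ρ)
    (ht : t ∈ Set.Icc (0 : ℝ) 1) : 0 ≤ mixedExchange d s ρ t := by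
  have h1 := mul_nonneg ht.1 hρ
  have h2 := mul_nonneg (sub_nonneg.2 ht.2) hρ
  have hl := lambdaConst_pos hd hs hsd
  unfold mixedExchange
  positivity

lemma coe_ofReal_ennreal {x : ℝ} (hx : 0 ≤ x) : ((ENNReal.ofReal x : ENNReal) : EReal) = (x : EReal) := by
  rw [EReal.coe_ennreal_ofReal, max_eq_left hx]

lemma hfEnergy_mixedState (hd : d ≠ 0) (hs : 0 < s) (hsd : s < d) (hρ : 0 ≤ ρ)
    (ht : t ∈ Set.Icc (0 : ℝ) 1) (hU : U ∈ Matrix.specialUnitaryGroup (Fin 2) ℂ) :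
    hfEnergy d (rieszInteraction d s) (mixedState d ρ t U) = (mixedEnergy d s ρ t : EReal) := by
  rw [hfEnergy, kineticEnergy_mixedState hd hρ ht hU,
    exchangeEnergy_mixedState hd hs hsd hρ ht hU, coe_ofReal_ennreal (mixedKinetic_nonneg hd hρ ht),
    coe_ofReal_ennreal (mixedExchange_nonneg hd hs hsd hρ ht), mixedEnergy, EReal.coe_sub]

/-- If the energy does not exceed the bound, the kinetic and exchange inequalities are both
equalities. This is real arithmetic once both energies are finite: the exchange energy is, so an
infinite kinetic energy would make the difference `⊤`. -/
lemma exists_mixedEnergy_le_hfEnergy (hd : d ≠ 0) (hs : 0 < s) (hsd : s < d) (hρ : 0 < ρ)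
    (hγ : IsHFState d ρ γ) : ∃ t ∈ Set.Icc (0 : ℝ) (1 / 2),
      (mixedEnergy d s ρ t : EReal) ≤ hfEnergy d (rieszInteraction d s) γ ∧
      (hfEnergy d (rieszInteraction d s) γ ≤ (mixedEnergy d s ρ t : EReal) →
        ∃ U ∈ Matrix.specialUnitaryGroup (Fin 2) ℂ, γ =ᵐ[volume] mixedState d ρ t U) := by
  obtain ⟨t, ht, hk, hx, heq⟩ := exists_mixed_comparison hd hs hsd hρ hγ
  have ht1 : t ∈ Set.Icc (0 : ℝ) 1 := ⟨ht.1, by linarith [ht.2]⟩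
  have hK0 := mixedKinetic_nonneg hd hρ.le ht1
  have hX0 := mixedExchange_nonneg hd hs hsd hρ.le ht1
  have hk' : (mixedKinetic d ρ t : EReal) ≤ (kineticEnergy d γ : EReal) := by
    rw [← coe_ofReal_ennreal hK0]
    exact EReal.coe_ennreal_le_coe_ennreal_iff.2 hk
  have hx' : (exchangeEnergy d (rieszInteraction d s) γ : EReal) ≤
      (mixedExchange d s ρ t : EReal) := by
    rw [← coe_ofReal_ennreal hX0]
    exact EReal.coe_ennreal_le_coe_ennreal_iff.2 hx
  refine ⟨t, ht, ?_, fun hle => ?_⟩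
  · rw [mixedEnergy, EReal.coe_sub, hfEnergy]
    exact EReal.sub_le_sub hk' hx'
  · have hxfin : exchangeEnergy d (rieszInteraction d s) γ ≠ ⊤ :=
      ne_top_of_le_ne_top ENNReal.ofReal_ne_top hx
    rw [hfEnergy] at hle
    generalize kineticEnergy d γ = a at *
    generalize exchangeEnergy d (rieszInteraction d s) γ = b at *
    lift b to NNReal using hxfin
    have hafin : a ≠ ⊤ := by
      rintro rfl
      rw [EReal.coe_ennreal_top] at hle
      change (⊤ : EReal) - ((b : ℝ) : EReal) ≤ _ at hle
      rw [EReal.top_sub_coe] at hle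
      exact EReal.coe_ne_top _ (top_le_iff.1 hle)
    lift a to NNReal using hafin
    change ((a : ℝ) : EReal) - ((b : ℝ) : EReal) ≤ _ at hle
    change _ ≤ ((a : ℝ) : EReal) at hk'
    change ((b : ℝ) : EReal) ≤ _ at hx'
    rw [← EReal.coe_sub, EReal.coe_le_coe_iff, mixedEnergy] at hle
    rw [EReal.coe_le_coe_iff] at hk' hx'
    refine heq ?_ ?_
    · rw [← ENNReal.ofReal_coe_nnreal]
      exact ENNReal.ofReal_le_ofReal (by linarith)
    · rw [← ENNReal.ofReal_coe_nnreal]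
      exact ENNReal.ofReal_le_ofReal (by linarith)

/-- Mixed states are admissible and attain the lower bound, so minimising over states amounts to
minimising over `t`; the equality case excludes all other minimisers. -/
theorem isHFMinimiser_iff (hd : d ≠ 0) (hs : 0 < s) (hsd : s < d) (hρ : 0 < ρ) :
    IsHFMinimiser d (rieszInteraction d s) ρ γ ↔ ∃ t, IsOptimalPolarisation d s ρ t ∧
      ∃ U ∈ Matrix.specialUnitaryGroup (Fin 2) ℂ, γ =ᵐ[volume] mixedState d ρ t U := by
  have hsub : ∀ t ∈ Set.Icc (0 : ℝ) (1 / 2), t ∈ Set.Icc (0 : ℝ) 1 := fun t ht =>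
    ⟨ht.1, by linarith [ht.2]⟩
  constructor
  · rintro ⟨hγ, hmin⟩
    obtain ⟨t, ht, hle, heq⟩ := exists_mixedEnergy_le_hfEnergy hd hs hsd hρ hγ
    have hmin' : ∀ t' ∈ Set.Icc (0 : ℝ) (1 / 2),
        hfEnergy d (rieszInteraction d s) γ ≤ (mixedEnergy d s ρ t' : EReal) := by
      intro t' ht'
      rw [← hfEnergy_mixedState hd hs hsd hρ.le (hsub t' ht') (one_mem _)]
      exact hmin _ (isHFState_mixedState hd hρ.le (hsub t' ht') (one_mem _))
    exact ⟨t, ⟨ht, fun t' ht' => EReal.coe_le_coe_iff.1 (hle.trans (hmin' t' ht'))⟩,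
      heq (hmin' t ht)⟩
  · rintro ⟨t, ⟨ht, hmin⟩, U, hU, hae⟩
    refine ⟨(isHFState_mixedState hd hρ.le (hsub t ht) hU).congr_ae hae.symm, fun γ' hγ' => ?_⟩
    rw [hfEnergy_congr_ae _ hae, hfEnergy_mixedState hd hs hsd hρ.le (hsub t ht) hU]
    obtain ⟨t', ht', hle, -⟩ := exists_mixedEnergy_le_hfEnergy hd hs hsd hρ hγ'
    exact (EReal.coe_le_coe_iff.2 (hmin t' ht')).trans hle

theorem hfGroundEnergy_eq (hd : d ≠ 0) (hs : 0 < s) (hsd : s < d) (hρ : 0 < ρ)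
    (ht : IsOptimalPolarisation d s ρ t) :
    hfGroundEnergy d (rieszInteraction d s) ρ = (mixedEnergy d s ρ t : EReal) := by
  have ht1 : t ∈ Set.Icc (0 : ℝ) 1 := ⟨ht.1.1, by linarith [ht.1.2]⟩
  refine le_antisymm (sInf_le ?_) (le_sInf ?_)
  · exact ⟨mixedState d ρ t 1, isHFState_mixedState hd hρ.le ht1 (one_mem _),
      hfEnergy_mixedState hd hs hsd hρ.le ht1 (one_mem _)⟩
  · rintro _ ⟨γ, hγ, rfl⟩
    obtain ⟨t', ht', hle, -⟩ := exists_mixedEnergy_le_hfEnergy hd hs hsd hρ hγ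
    exact (EReal.coe_le_coe_iff.2 (ht.2 t' ht')).trans hle

lemma mixedState_half (hU : U ∈ Matrix.specialUnitaryGroup (Fin 2) ℂ) :
    mixedState d ρ (1 / 2) U = paraState d ρ := by
  funext k
  rw [mixedState, paraState, unitary_conj_diagonal hU,
    show (1 : ℝ) / 2 * ρ = ρ / 2 by ring, show (1 - (1 : ℝ) / 2) * ρ = ρ / 2 by ring]
  simp

lemma exists_ae_eq_mixedState_half_iff :
    (∃ U ∈ Matrix.specialUnitaryGroup (Fin 2) ℂ, γ =ᵐ[volume] mixedState d ρ (1 / 2) U) ↔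
      γ =ᵐ[volume] paraState d ρ := by
  constructor
  · rintro ⟨U, hU, h⟩
    rwa [mixedState_half hU] at h
  · intro h
    exact ⟨1, one_mem _, by rwa [mixedState_half (one_mem _)]⟩

/-- The Fermi ball of density `0` is the origin alone, so the two states can differ only there. -/
lemma mixedState_zero_ae_eq (hd : d ≠ 0) (hU : U ∈ Matrix.specialUnitaryGroup (Fin 2) ℂ) :
    mixedState d ρ 0 U =ᵐ[volume] ferroState d ρ (WithLp.toLp 2 fun i => U i 1) := by
  have : NeZero d := ⟨hd⟩
  have hk0 : ∀ᵐ k : Momentum d, k ≠ 0 := by simp [ae_iff]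
  filter_upwards [hk0] with k hk
  have h0 : fermiBall d (0 * ρ) k = 0 := by
    rw [zero_mul, fermiBall_eq hd le_rfl, if_neg]
    have : fermiRadius d 0 = 0 := by
      rw [fermiRadius, Real.zero_rpow (by positivity), mul_zero]
    rw [this, not_le]
    exact norm_pos_iff.2 hk
  rw [mixedState, ferroState, unitary_conj_diagonal hU, h0]
  simp

lemma norm_eq_one_iff_normSq (ν : EuclideanSpace ℂ (Fin 2)) :
    ‖ν‖ = 1 ↔ Complex.normSq (ν 0) + Complex.normSq (ν 1) = 1 := by
  rw [EuclideanSpace.norm_eq, Real.sqrt_eq_one, Fin.sum_univ_two, Complex.normSq_eq_norm_sq,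
    Complex.normSq_eq_norm_sq]

lemma exists_ae_eq_mixedState_zero_iff (hd : d ≠ 0) :
    (∃ U ∈ Matrix.specialUnitaryGroup (Fin 2) ℂ, γ =ᵐ[volume] mixedState d ρ 0 U) ↔
      ∃ ν : EuclideanSpace ℂ (Fin 2), ‖ν‖ = 1 ∧ γ =ᵐ[volume] ferroState d ρ ν := by
  constructor
  · rintro ⟨U, hU, h⟩
    exact ⟨WithLp.toLp 2 fun i => U i 1, (norm_eq_one_iff_normSq _).2 (normSq_column hU),
      h.trans (mixedState_zero_ae_eq hd hU)⟩
  · rintro ⟨ν, hν, h⟩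
    have hU := spinRotation_mem ((norm_eq_one_iff_normSq ν).1 hν)
    refine ⟨spinRotation ν, hU, h.trans ?_⟩
    have hcol : (WithLp.toLp 2 fun i => spinRotation ν i 1 : EuclideanSpace ℂ (Fin 2)) = ν := by
      ext i
      fin_cases i <;> simp [spinRotation]
    have := mixedState_zero_ae_eq (ρ := ρ) hd hU
    rw [hcol] at this
    exact this.symm

end Reduction

/-! ### The ratio governing the polarisation -/

section Ratio

lemma exp_sub_one_lt_mul_exp {z : ℝ} (hz : 0 < z) : Real.exp z - 1 < z * Real.exp z := by
  have h1 := Real.add_one_lt_exp (neg_ne_zero.2 hz.ne')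
  have h2 : Real.exp (-z) * Real.exp z = 1 := by rw [← Real.exp_add]; simp
  nlinarith [Real.exp_pos z]

/-- The difference vanishes at `0` and has derivative `1 + z e^z - e^z`, positive by
`exp_sub_one_lt_mul_exp`. -/
lemma two_mul_exp_sub_one_lt {z : ℝ} (hz : 0 < z) :
    2 * (Real.exp z - 1) < z * (Real.exp z + 1) := by
  have hd : ∀ x : ℝ, HasDerivAt (fun z : ℝ => z * (Real.exp z + 1) - 2 * (Real.exp z - 1))
      (1 * (Real.exp x + 1) + x * Real.exp x - 2 * Real.exp x) x := fun x =>
    ((hasDerivAt_id x).mul ((Real.hasDerivAt_exp x).add_const 1)).sub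
      (((Real.hasDerivAt_exp x).sub_const 1).const_mul 2)
  have hmono : StrictMonoOn (fun z : ℝ => z * (Real.exp z + 1) - 2 * (Real.exp z - 1))
      (Set.Ici 0) := by
    refine strictMonoOn_of_deriv_pos (convex_Ici 0)
      (fun x _ => (hd x).continuousAt.continuousWithinAt) fun x hx => ?_
    rw [interior_Ici] at hx
    rw [(hd x).deriv]
    have := exp_sub_one_lt_mul_exp (Set.mem_Ioi.1 hx)
    linarith
  have := hmono Set.self_mem_Ici hz.le hz
  simp only [Real.exp_zero] at this
  linarith

/-- The numerator of the derivative is affine in `e^y` with negative slope `e^z - 1 - z e^z`. At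
`e^y = e^z` it equals `e^z (2(e^z - 1) - z(e^z + 1))`, negative by `two_mul_exp_sub_one_lt`, and `y
> z` only lowers it. -/
lemma strictAntiOn_mul_exp_add_div {y : ℝ} :
    StrictAntiOn (fun z : ℝ => z * (Real.exp z + Real.exp y) / (Real.exp z - 1)) (Set.Ioc 0 y) := by
  have hpos : ∀ z : ℝ, 0 < z → 0 < Real.exp z - 1 := fun z hz => by
    linarith [Real.one_lt_exp_iff.2 hz]
  have hd : ∀ z : ℝ, 0 < z →
      HasDerivAt (fun z : ℝ => z * (Real.exp z + Real.exp y) / (Real.exp z - 1))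
      (((1 * (Real.exp z + Real.exp y) + z * Real.exp z) * (Real.exp z - 1) -
        z * (Real.exp z + Real.exp y) * Real.exp z) / (Real.exp z - 1) ^ 2) z := fun z hz =>
    ((hasDerivAt_id z).mul ((Real.hasDerivAt_exp z).add_const (Real.exp y))).div
      ((Real.hasDerivAt_exp z).sub_const 1) (hpos z hz).ne'
  refine strictAntiOn_of_deriv_neg (convex_Ioc 0 y)
    (fun z hz => (hd z hz.1).continuousAt.continuousWithinAt) fun z hz => ?_
  rw [interior_Ioc] at hz
  rw [(hd z hz.1).deriv]
  refine div_neg_of_neg_of_pos ?_ (by have := hpos z hz.1; positivity)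
  have h1 := exp_sub_one_lt_mul_exp hz.1
  have h2 := two_mul_exp_sub_one_lt hz.1
  have h3 : Real.exp z < Real.exp y := Real.exp_lt_exp.2 hz.2
  nlinarith [Real.exp_pos z, mul_pos (sub_pos.2 h1) (sub_pos.2 h3),
    mul_pos (Real.exp_pos z) (sub_pos.2 h2)]

/-- The difference `(1 - t) ^ a - t ^ a`. -/
noncomputable def polDiff (a t : ℝ) : ℝ := (1 - t) ^ a - t ^ a

/-- The quotient of two such differences. -/
noncomputable def polRatio (a b t : ℝ) : ℝ := polDiff a t / polDiff b t

lemma polDiff_pos {a t : ℝ} (ha : 0 < a) (ht0 : 0 ≤ t) (ht : t < 1 / 2) : 0 < polDiff a t :=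
  sub_pos.2 (Real.rpow_lt_rpow ht0 (by linarith) ha)

lemma hasDerivAt_polDiff (a : ℝ) {t : ℝ} (ht0 : 0 < t) (ht1 : t < 1) :
    HasDerivAt (polDiff a) (-(a * ((1 - t) ^ (a - 1) + t ^ (a - 1)))) t := by
  have h1 := ((hasDerivAt_id t).const_sub 1).rpow_const (p := a) (Or.inl (by simp; linarith))
  have h2 := (hasDerivAt_id t).rpow_const (p := a) (Or.inl ht0.ne')
  refine (h1.sub h2).congr_deriv ?_
  simp only [id]
  ring

/-- With `y = log((1 - t) / t)`, the logarithmic derivative of `polDiff a` times `-y(1 - t)` is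
`h(ay)`, where `h(z) = z(e^z + e^y) / (e^z - 1)` is the decreasing function above. Monotonicity of
`polRatio a b` becomes a comparison of `h(ay)` with `h(by)`. -/
lemma polDiff_deriv_eq (a : ℝ) {t : ℝ} (ht0 : 0 < t) (ht : t < 1 / 2) (ha : 0 < a) :
    a * ((1 - t) ^ (a - 1) + t ^ (a - 1)) * (Real.log ((1 - t) / t) * (1 - t)) =
      polDiff a t * ((a * Real.log ((1 - t) / t)) *
        (Real.exp (a * Real.log ((1 - t) / t)) + Real.exp (Real.log ((1 - t) / t))) /
        (Real.exp (a * Real.log ((1 - t) / t)) - 1)) := by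
  have h1t : 0 < 1 - t := by linarith
  have hY : 1 < (1 - t) / t := by rw [lt_div_iff₀ ht0]; linarith
  have hexp : Real.exp (a * Real.log ((1 - t) / t)) = (1 - t) ^ a / t ^ a := by
    rw [mul_comm, ← Real.rpow_def_of_pos (by positivity), Real.div_rpow h1t.le ht0.le]
  have hta : 0 < t ^ a := Real.rpow_pos_of_pos ht0 a
  have hp := polDiff_pos ha ht0.le ht
  have hne : (1 - t) ^ a / t ^ a - 1 ≠ 0 := by
    have : (1 - t) ^ a / t ^ a - 1 = polDiff a t / t ^ a := by
      rw [polDiff]; field_simp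
    rw [this]
    positivity
  rw [hexp, Real.exp_log (by positivity), Real.rpow_sub_one h1t.ne', Real.rpow_sub_one ht0.ne',
    polDiff]
  rw [polDiff] at hp
  generalize Real.log ((1 - t) / t) = L
  field_simp

/-- `polRatio a b` has positive derivative if `b < a ≤ 1`. -/
lemma exists_hasDerivAt_polRatio_pos {a b t : ℝ} (hb : 0 < b) (hba : b < a) (ha : a ≤ 1)
    (ht0 : 0 < t) (ht : t < 1 / 2) : ∃ r, 0 < r ∧ HasDerivAt (polRatio a b) r t := by
  have hb0 := polDiff_pos hb ht0.le ht
  have ha0 := polDiff_pos (hb.trans hba) ht0.le ht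
  refine ⟨_, ?_, (hasDerivAt_polDiff a ht0 (by linarith)).div
    (hasDerivAt_polDiff b ht0 (by linarith)) hb0.ne'⟩
  refine div_pos ?_ (by positivity)
  have hy : 0 < Real.log ((1 - t) / t) := Real.log_pos (by rw [lt_div_iff₀ ht0]; linarith)
  -- The assumption `a ≤ 1` enters here: both arguments of the decreasing function must lie in `(0,
  -- y]`.
  have hanti := strictAntiOn_mul_exp_add_div (y := Real.log ((1 - t) / t))
    (a := b * Real.log ((1 - t) / t)) ⟨by positivity, by nlinarith⟩
    (b := a * Real.log ((1 - t) / t)) ⟨mul_pos (hb.trans hba) hy, by nlinarith⟩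
    (by gcongr)
  have ea := polDiff_deriv_eq a ht0 ht (hb.trans hba)
  have eb := polDiff_deriv_eq b ht0 ht hb
  simp only at hanti
  generalize a * Real.log ((1 - t) / t) * (Real.exp (a * Real.log ((1 - t) / t)) +
    Real.exp (Real.log ((1 - t) / t))) / (Real.exp (a * Real.log ((1 - t) / t)) - 1) = A at *
  generalize b * Real.log ((1 - t) / t) * (Real.exp (b * Real.log ((1 - t) / t)) +
    Real.exp (Real.log ((1 - t) / t))) / (Real.exp (b * Real.log ((1 - t) / t)) - 1) = B at *
  have hL : 0 < Real.log ((1 - t) / t) * (1 - t) := mul_pos hy (by linarith)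
  generalize Real.log ((1 - t) / t) * (1 - t) = L at *
  generalize a * ((1 - t) ^ (a - 1) + t ^ (a - 1)) = P at *
  generalize b * ((1 - t) ^ (b - 1) + t ^ (b - 1)) = Q at *
  generalize polDiff a t = x at *
  generalize polDiff b t = z at *
  refine pos_of_mul_pos_left (b := L) ?_ hL.le
  have : (-P * z - x * -Q) * L = x * z * (B - A) := by
    linear_combination (-z) * ea + x * eb
  rw [this]
  exact mul_pos (mul_pos ha0 hb0) (sub_pos.2 hanti)

lemma continuous_polDiff {a : ℝ} (ha : 0 < a) : Continuous (polDiff a) := by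
  unfold polDiff
  exact ((continuous_const.sub continuous_id).rpow_const fun _ => Or.inr ha.le).sub
    (continuous_id.rpow_const fun _ => Or.inr ha.le)

variable {a b : ℝ}

lemma continuousOn_polRatio (hb : 0 < b) (ha : 0 < a) :
    ContinuousOn (polRatio a b) (Set.Ico 0 (1 / 2)) :=
  (continuous_polDiff ha).continuousOn.div (continuous_polDiff hb).continuousOn
    fun _ ht => (polDiff_pos hb ht.1 ht.2).ne'

lemma strictMonoOn_polRatio (hb : 0 < b) (hba : b < a) (ha : a ≤ 1) :
    StrictMonoOn (polRatio a b) (Set.Ico 0 (1 / 2)) := by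
  refine strictMonoOn_of_deriv_pos (convex_Ico _ _) (continuousOn_polRatio hb (hb.trans hba))
    fun t ht => ?_
  rw [interior_Ico] at ht
  obtain ⟨r, hr, hd⟩ := exists_hasDerivAt_polRatio_pos hb hba ha ht.1 ht.2
  rwa [hd.deriv]

lemma polRatio_zero (hb : 0 < b) (ha : 0 < a) : polRatio a b 0 = 1 := by
  simp [polRatio, polDiff, Real.zero_rpow hb.ne', Real.zero_rpow ha.ne']

/-- Numerator and denominator vanish at `1 / 2`; dividing both by `t - 1 / 2` turns them into
slopes, which converge to the derivatives. -/
lemma tendsto_polRatio_half (hb : 0 < b) :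
    Filter.Tendsto (polRatio a b) (nhdsWithin (1 / 2) (Set.Iio (1 / 2)))
      (nhds (a / b * 2 ^ (b - a))) := by
  have slope_lim : ∀ c : ℝ, Filter.Tendsto (fun t => polDiff c t / (t - 1 / 2))
      (nhdsWithin (1 / 2) (Set.Iio (1 / 2))) (nhds (-(c * (2 * (1 / 2) ^ (c - 1))))) := by
    intro c
    have h := (hasDerivAt_polDiff c (t := 1 / 2) (by norm_num) (by norm_num)).tendsto_slope
    have h' := h.mono_left (nhdsWithin_mono _
      (show Set.Iio (1 / 2 : ℝ) ⊆ {1 / 2}ᶜ from fun x hx => (Set.mem_Iio.1 hx).ne))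
    have hz : polDiff c (1 / 2) = 0 := by norm_num [polDiff]
    convert h' using 2
    · rw [slope_def_field, hz, sub_zero]
    · rw [show (1 : ℝ) - 1 / 2 = 1 / 2 by norm_num]
      ring
  have hne : -(b * (2 * (1 / 2 : ℝ) ^ (b - 1))) ≠ 0 := by
    have : (0 : ℝ) < (1 / 2) ^ (b - 1) := by positivity
    have : 0 < b * (2 * (1 / 2 : ℝ) ^ (b - 1)) := by positivity
    linarith
  have h := (slope_lim a).div (slope_lim b) hne
  have hval : -(a * (2 * (1 / 2 : ℝ) ^ (a - 1))) / -(b * (2 * (1 / 2 : ℝ) ^ (b - 1))) =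
      a / b * 2 ^ (b - a) := by
    have e : (1 / 2 : ℝ) ^ (a - 1) = 2 ^ (b - a) * (1 / 2) ^ (b - 1) := by
      rw [one_div, Real.inv_rpow two_pos.le, Real.inv_rpow two_pos.le, ← Real.rpow_neg two_pos.le,
        ← Real.rpow_neg two_pos.le, ← Real.rpow_add two_pos]
      congr 1
      ring
    rw [e]
    field_simp
  rw [hval] at h
  refine h.congr' ?_
  filter_upwards [self_mem_nhdsWithin] with t ht
  have : t - 1 / 2 ≠ 0 := sub_ne_zero.2 (Set.mem_Iio.1 ht).ne
  simp only [Pi.div_apply]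
  rw [polRatio, div_div_div_cancel_right₀ this]

lemma polRatio_lt (hb : 0 < b) (hba : b < a) (ha : a ≤ 1) {t : ℝ} (ht : t ∈ Set.Ico 0 (1 / 2)) :
    polRatio a b t < a / b * 2 ^ (b - a) := by
  have hmono := strictMonoOn_polRatio hb hba ha
  -- A point strictly between `t` and `1 / 2` keeps the inequality strict in the limit.
  have hm : (t + 1 / 2) / 2 ∈ Set.Ico (0 : ℝ) (1 / 2) :=
    ⟨by linarith [ht.1], by linarith [ht.2]⟩
  refine (hmono ht hm (by linarith [ht.2])).trans_le ?_
  refine ge_of_tendsto (tendsto_polRatio_half hb) ?_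
  filter_upwards [Ioo_mem_nhdsLT hm.2] with x hx
  exact (hmono hm ⟨hm.1.trans hx.1.le, hx.2⟩ hx.1).le

lemma one_lt_polRatio (hb : 0 < b) (hba : b < a) (ha : a ≤ 1) {t : ℝ}
    (ht : t ∈ Set.Ioo 0 (1 / 2)) : 1 < polRatio a b t := by
  rw [← polRatio_zero hb (hb.trans hba)]
  exact strictMonoOn_polRatio hb hba ha ⟨le_rfl, by norm_num⟩ ⟨ht.1.le, ht.2⟩ ht.1

lemma exists_polRatio_eq (hb : 0 < b) (hba : b < a) {c : ℝ} (hc1 : 1 < c)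
    (hc : c < a / b * 2 ^ (b - a)) : ∃ t ∈ Set.Ioo (0 : ℝ) (1 / 2), polRatio a b t = c := by
  -- At `1 / 2` the quotient is `0 / 0` and not continuous, so the intermediate value theorem is
  -- applied up to a nearby `x` where it already exceeds `c`.
  have hev := (tendsto_polRatio_half (a := a) hb).eventually (lt_mem_nhds hc)
  obtain ⟨x, hx, hx2⟩ := (hev.and (Ioo_mem_nhdsLT (show (0 : ℝ) < 1 / 2 by norm_num))).exists
  have hcont : ContinuousOn (polRatio a b) (Set.Icc 0 x) :=
    (continuousOn_polRatio hb (hb.trans hba)).mono fun y hy => ⟨hy.1, hy.2.trans_lt hx2.2⟩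
  obtain ⟨t, ht, hte⟩ := intermediate_value_Ioo hx2.1.le hcont
    (show c ∈ Set.Ioo _ _ from ⟨by rwa [polRatio_zero hb (hb.trans hba)], hx⟩)
  exact ⟨t, ⟨ht.1, ht.2.trans hx2.2⟩, hte⟩

end Ratio

/-! ### Optimal polarisations -/

section Polarisation

/-- The energy as a function of the polarisation, with general coefficients and exponents. -/
noncomputable def polEnergy (A p B q t : ℝ) : ℝ :=
  A * (t ^ p + (1 - t) ^ p) - B * (t ^ q + (1 - t) ^ q)

variable {A p B q : ℝ}

lemma continuous_polEnergy (hp : 0 < p) (hq : 0 < q) : Continuous (polEnergy A p B q) := by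
  have h : ∀ c : ℝ, 0 < c → Continuous fun t : ℝ => t ^ c + (1 - t) ^ c := fun c hc =>
    (continuous_id.rpow_const fun _ => Or.inr hc.le).add
      ((continuous_const.sub continuous_id).rpow_const fun _ => Or.inr hc.le)
  exact ((h p hp).const_mul A).sub ((h q hq).const_mul B)

lemma hasDerivAt_polEnergy {t : ℝ} (ht0 : 0 < t) (ht1 : t < 1) :
    HasDerivAt (polEnergy A p B q)
      (B * q * polDiff (q - 1) t - A * p * polDiff (p - 1) t) t := by
  have h : ∀ c : ℝ, HasDerivAt (fun t : ℝ => t ^ c + (1 - t) ^ c) (-(c * polDiff (c - 1) t)) t := by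
    intro c
    have h1 := ((hasDerivAt_id t).const_sub 1).rpow_const (p := c) (Or.inl (by simp; linarith))
    have h2 := (hasDerivAt_id t).rpow_const (p := c) (Or.inl ht0.ne')
    refine (h2.add h1).congr_deriv ?_
    simp only [id, polDiff]
    ring
  refine (((h p).const_mul A).sub ((h q).const_mul B)).congr_deriv ?_
  ring

/-- If the derivative changes sign at most once, from positive to negative, the minimum is attained
only at the end points. -/
lemma min_lt_polEnergy {a b : ℝ} (hp : 0 < p) (hq : 0 < q) (hA : 0 < A * p) (hb : 0 < b)
    (hba : b < a) (ha : a ≤ 1) (hqb : q - 1 = b) (hpa : polDiff (p - 1) = polDiff a) {t : ℝ}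
    (ht : t ∈ Set.Ioo (0 : ℝ) (1 / 2)) :
    min (polEnergy A p B q 0) (polEnergy A p B q (1 / 2)) < polEnergy A p B q t := by
  by_contra! hcon
  obtain ⟨h0, h1⟩ := le_min_iff.1 hcon
  have hcont := continuous_polEnergy (A := A) (B := B) hp hq
  have hder : ∀ x ∈ Set.Ioo (0 : ℝ) (1 / 2), HasDerivAt (polEnergy A p B q)
      (polDiff b x * (B * q - A * p * polRatio a b x)) x := by
    intro x hx
    have hpos := polDiff_pos hb hx.1.le hx.2
    refine (hasDerivAt_polEnergy hx.1 (by linarith [hx.2])).congr_deriv ?_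
    rw [hqb, hpa, polRatio]
    field_simp
  -- If `t` did as well as both ends, the mean value theorem would give a derivative `≤ 0` to the
  -- left of `t` and one `≥ 0` to the right, although the factor `B * q - A * p * polRatio a b`
  -- strictly decreases.
  obtain ⟨x, hx, hxe⟩ := exists_hasDerivAt_eq_slope _ _ ht.1 hcont.continuousOn
    fun x hx => hder x ⟨hx.1, hx.2.trans ht.2⟩
  obtain ⟨y, hy, hye⟩ := exists_hasDerivAt_eq_slope _ _ ht.2 hcont.continuousOn
    fun x hx => hder x ⟨ht.1.trans hx.1, hx.2⟩
  have hx' : x ∈ Set.Ico (0 : ℝ) (1 / 2) := ⟨hx.1.le, hx.2.trans ht.2⟩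
  have hy' : y ∈ Set.Ico (0 : ℝ) (1 / 2) := ⟨(ht.1.trans hy.1).le, hy.2⟩
  have hxs : polDiff b x * (B * q - A * p * polRatio a b x) ≤ 0 := by
    rw [hxe]
    exact div_nonpos_of_nonpos_of_nonneg (sub_nonpos.2 h0) (sub_nonneg.2 ht.1.le)
  have hys : 0 ≤ polDiff b y * (B * q - A * p * polRatio a b y) := by
    rw [hye]
    exact div_nonneg (sub_nonneg.2 h1) (sub_nonneg.2 ht.2.le)
  have e1 := nonpos_of_mul_nonpos_right hxs (polDiff_pos hb hx'.1 hx'.2)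
  have e2 := nonneg_of_mul_nonneg_right hys (polDiff_pos hb hy'.1 hy'.2)
  have hlt := strictMonoOn_polRatio hb hba ha hx' hy' (hx.2.trans hy.1)
  nlinarith

/-- For `B * q > 0` the derivative has the sign of `polRatio a b - c`, so it can only pass from
negative to positive. In the application `c` is `polCoupling`. -/
lemma hasDerivAt_polEnergy_ratio {a b c : ℝ} (hBq : B * q ≠ 0) (hb : 0 < b)
    (hqa : q - 1 = a) (hpb : p - 1 = b) (hc : c = A * p / (B * q)) {x : ℝ}
    (hx : x ∈ Set.Ioo (0 : ℝ) (1 / 2)) : HasDerivAt (polEnergy A p B q)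
      (B * q * polDiff b x * (polRatio a b x - c)) x := by
  have hpos := polDiff_pos hb hx.1.le hx.2
  have hB : B ≠ 0 := left_ne_zero_of_mul hBq
  have hq : q ≠ 0 := right_ne_zero_of_mul hBq
  refine (hasDerivAt_polEnergy hx.1 (by linarith [hx.2])).congr_deriv ?_
  rw [hqa, hpb, hc, polRatio]
  field_simp

/-! ### Energies whose exchange exponent exceeds the kinetic one. -/

section Smooth

variable {a b c : ℝ}

lemma strictMonoOn_polEnergy (hp : 0 < p) (hq : 0 < q) (hBq : 0 < B * q) (hb : 0 < b) (hba : b < a)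
    (ha : a ≤ 1) (hqa : q - 1 = a) (hpb : p - 1 = b) (hc : c = A * p / (B * q))
    (hc1 : c ≤ 1) :
    StrictMonoOn (polEnergy A p B q) (Set.Icc 0 (1 / 2)) := by
  refine strictMonoOn_of_deriv_pos (convex_Icc _ _) (continuous_polEnergy hp hq).continuousOn
    fun x hx => ?_
  rw [interior_Icc] at hx
  rw [(hasDerivAt_polEnergy_ratio hBq.ne' hb hqa hpb hc hx).deriv]
  exact mul_pos (mul_pos hBq (polDiff_pos hb hx.1.le hx.2))
    (sub_pos.2 (hc1.trans_lt (one_lt_polRatio hb hba ha hx)))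

lemma strictAntiOn_polEnergy (hp : 0 < p) (hq : 0 < q) (hBq : 0 < B * q) (hb : 0 < b) (hba : b < a)
    (ha : a ≤ 1) (hqa : q - 1 = a) (hpb : p - 1 = b) (hc : c = A * p / (B * q))
    (hcL : a / b * 2 ^ (b - a) ≤ c) :
    StrictAntiOn (polEnergy A p B q) (Set.Icc 0 (1 / 2)) := by
  refine strictAntiOn_of_deriv_neg (convex_Icc _ _) (continuous_polEnergy hp hq).continuousOn
    fun x hx => ?_
  rw [interior_Icc] at hx
  rw [(hasDerivAt_polEnergy_ratio hBq.ne' hb hqa hpb hc hx).deriv]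
  exact mul_neg_of_pos_of_neg (mul_pos hBq (polDiff_pos hb hx.1.le hx.2))
    (sub_neg.2 ((polRatio_lt hb hba ha ⟨hx.1.le, hx.2⟩).trans_le hcL))

lemma polEnergy_lt_of_polRatio_eq {t x : ℝ}
    (hp : 0 < p) (hq : 0 < q) (hBq : 0 < B * q) (hb : 0 < b) (hba : b < a)
    (ha : a ≤ 1) (hqa : q - 1 = a) (hpb : p - 1 = b) (hc : c = A * p / (B * q))
    (ht : t ∈ Set.Ioo (0 : ℝ) (1 / 2))
    (htc : polRatio a b t = c) (hx : x ∈ Set.Icc (0 : ℝ) (1 / 2)) (hxt : x ≠ t) :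
    polEnergy A p B q t < polEnergy A p B q x := by
  have hcont := continuous_polEnergy (A := A) (B := B) hp hq
  have hmono := strictMonoOn_polRatio hb hba ha
  rcases hxt.lt_or_gt with h | h
  · have hanti : StrictAntiOn (polEnergy A p B q) (Set.Icc 0 t) := by
      refine strictAntiOn_of_deriv_neg (convex_Icc _ _) hcont.continuousOn fun y hy => ?_
      rw [interior_Icc] at hy
      have hy2 : y < 1 / 2 := hy.2.trans ht.2
      rw [(hasDerivAt_polEnergy_ratio hBq.ne' hb hqa hpb hc ⟨hy.1, hy2⟩).deriv]
      refine mul_neg_of_pos_of_neg (mul_pos hBq (polDiff_pos hb hy.1.le hy2)) (sub_neg.2 ?_)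
      rw [← htc]
      exact hmono ⟨hy.1.le, hy2⟩ ⟨ht.1.le, ht.2⟩ hy.2
    exact hanti ⟨hx.1, h.le⟩ ⟨ht.1.le, le_rfl⟩ h
  · have hmono' : StrictMonoOn (polEnergy A p B q) (Set.Icc t (1 / 2)) := by
      refine strictMonoOn_of_deriv_pos (convex_Icc _ _) hcont.continuousOn fun y hy => ?_
      rw [interior_Icc] at hy
      have hy0 : 0 < y := ht.1.trans hy.1
      rw [(hasDerivAt_polEnergy_ratio hBq.ne' hb hqa hpb hc ⟨hy0, hy.2⟩).deriv]
      refine mul_pos (mul_pos hBq (polDiff_pos hb hy0.le hy.2)) (sub_pos.2 ?_)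
      rw [← htc]
      exact hmono ⟨ht.1.le, ht.2⟩ ⟨hy0.le, hy.2⟩ hy.1
    exact hmono' ⟨le_rfl, ht.2.le⟩ ⟨h.le, hx.2⟩ h

end Smooth

variable {d : ℕ} {s ρ t : ℝ}

lemma mixedEnergy_eq_polEnergy (hρ : 0 ≤ ρ) (ht : t ∈ Set.Icc (0 : ℝ) 1) :
    mixedEnergy d s ρ t = polEnergy (kappaConst d * ρ ^ (1 + 2 / (d : ℝ))) (1 + 2 / (d : ℝ))
      (lambdaConst d s * ρ ^ (1 + s / (d : ℝ))) (1 + s / (d : ℝ)) t := by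
  have h1 : 0 ≤ 1 - t := sub_nonneg.2 ht.2
  rw [mixedEnergy, mixedKinetic, mixedExchange, polEnergy, Real.mul_rpow ht.1 hρ,
    Real.mul_rpow h1 hρ, Real.mul_rpow ht.1 hρ, Real.mul_rpow h1 hρ]
  ring

lemma mem_Icc_one_of_half (ht : t ∈ Set.Icc (0 : ℝ) (1 / 2)) : t ∈ Set.Icc (0 : ℝ) 1 :=
  ⟨ht.1, by linarith [ht.2]⟩

/-! #### The first-order case -/

/-- The exponent `2 / d` may be replaced by one in `(s / d, 1]`. -/
lemma exists_polDiff_eq (hd : d ≠ 0) (hs : s < min 2 (d : ℝ)) :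
    ∃ a, s / d < a ∧ a ≤ 1 ∧ polDiff (2 / (d : ℝ)) = polDiff a := by
  have hd0 : (0 : ℝ) < d := by positivity
  rcases Nat.lt_or_ge d 2 with h | h
  · have h1 : d = 1 := by omega
    subst h1
    -- For `d = 1` the exponent `2 / d = 2` is outside the range of the monotonicity lemma, but `(1
    -- - t)² - t² = (1 - t) - t`, so `1` serves instead.
    refine ⟨1, ?_, le_rfl, ?_⟩
    · simpa using hs.trans_le (min_le_right _ _)
    · funext t
      simp only [polDiff, Nat.cast_one, div_one, Real.rpow_one, Real.rpow_two]
      ring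
  · have h2 : (2 : ℝ) ≤ d := by exact_mod_cast h
    exact ⟨2 / d, by gcongr; exact hs.trans_le (min_le_left _ _), by rwa [div_le_one hd0], rfl⟩

lemma min_lt_mixedEnergy (hd : d ≠ 0) (hs : 0 < s) (hs2 : s < min 2 (d : ℝ))
    (hρ : 0 < ρ) (ht : t ∈ Set.Ioo (0 : ℝ) (1 / 2)) :
    min (mixedEnergy d s ρ 0) (mixedEnergy d s ρ (1 / 2)) < mixedEnergy d s ρ t := by
  obtain ⟨a, hba, ha, hpa⟩ := exists_polDiff_eq hd hs2
  have hd0 : (0 : ℝ) < d := by positivity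
  have hκ := kappaConst_pos hd
  rw [mixedEnergy_eq_polEnergy hρ.le ⟨ht.1.le, by linarith [ht.2]⟩,
    mixedEnergy_eq_polEnergy hρ.le ⟨le_rfl, zero_le_one⟩,
    mixedEnergy_eq_polEnergy hρ.le ⟨by norm_num, by norm_num⟩]
  exact min_lt_polEnergy (by positivity) (by positivity) (by positivity)
    (show 0 < s / d by positivity) hba ha (by ring) (by rw [← hpa]; congr 1; ring) ht

lemma IsOptimalPolarisation.eq_zero_or_half (hd : d ≠ 0) (hs : 0 < s)
    (hs2 : s < min 2 (d : ℝ)) (hρ : 0 < ρ) (ht : IsOptimalPolarisation d s ρ t) :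
    t = 0 ∨ t = 1 / 2 := by
  by_contra! hne
  have hlt := min_lt_mixedEnergy hd hs hs2 hρ
    ⟨lt_of_le_of_ne ht.1.1 hne.1.symm, lt_of_le_of_ne ht.1.2 hne.2⟩
  exact absurd hlt (not_lt.2 (le_min (ht.2 0 ⟨le_rfl, by norm_num⟩)
    (ht.2 (1 / 2) ⟨by norm_num, le_rfl⟩)))

lemma isOptimalPolarisation_zero_iff (hd : d ≠ 0) (hs : 0 < s)
    (hs2 : s < min 2 (d : ℝ)) (hρ : 0 < ρ) : IsOptimalPolarisation d s ρ 0 ↔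
      mixedEnergy d s ρ 0 ≤ mixedEnergy d s ρ (1 / 2) := by
  refine ⟨fun h => h.2 _ ⟨by norm_num, le_rfl⟩, fun h => ⟨⟨le_rfl, by norm_num⟩, fun t ht => ?_⟩⟩
  rcases eq_or_ne t 0 with rfl | h0
  · exact le_rfl
  rcases eq_or_ne t (1 / 2) with rfl | h1
  · exact h
  have := min_lt_mixedEnergy hd hs hs2 hρ
    ⟨lt_of_le_of_ne ht.1 h0.symm, lt_of_le_of_ne ht.2 h1⟩
  rw [min_eq_left h] at this
  exact this.le

lemma isOptimalPolarisation_half_iff (hd : d ≠ 0) (hs : 0 < s)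
    (hs2 : s < min 2 (d : ℝ)) (hρ : 0 < ρ) : IsOptimalPolarisation d s ρ (1 / 2) ↔
      mixedEnergy d s ρ (1 / 2) ≤ mixedEnergy d s ρ 0 := by
  refine ⟨fun h => h.2 _ ⟨le_rfl, by norm_num⟩, fun h => ⟨⟨by norm_num, le_rfl⟩, fun t ht => ?_⟩⟩
  rcases eq_or_ne t 0 with rfl | h0
  · exact h
  rcases eq_or_ne t (1 / 2) with rfl | h1
  · exact le_rfl
  have := min_lt_mixedEnergy hd hs hs2 hρ
    ⟨lt_of_le_of_ne ht.1 h0.symm, lt_of_le_of_ne ht.2 h1⟩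
  rw [min_eq_right h] at this
  exact this.le

lemma mixedEnergy_zero (hd : d ≠ 0) (hs : 0 < s) (ρ : ℝ) : mixedEnergy d s ρ 0 =
    kappaConst d * ρ ^ (1 + 2 / (d : ℝ)) - lambdaConst d s * ρ ^ (1 + s / (d : ℝ)) := by
  have hd0 : (0 : ℝ) < d := by positivity
  rw [mixedEnergy, mixedKinetic, mixedExchange, zero_mul, sub_zero, one_mul,
    Real.zero_rpow (by positivity), Real.zero_rpow (by positivity)]
  ring

lemma mixedEnergy_half (hρ : 0 ≤ ρ) : mixedEnergy d s ρ (1 / 2) =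
    kappaConst d * 2 ^ (-2 / (d : ℝ)) * ρ ^ (1 + 2 / (d : ℝ)) -
      lambdaConst d s * 2 ^ (-s / (d : ℝ)) * ρ ^ (1 + s / (d : ℝ)) := by
  have e : ∀ c : ℝ, (1 / 2 * ρ) ^ (1 + c / (d : ℝ)) =
      2 ^ (-c / (d : ℝ)) * ρ ^ (1 + c / (d : ℝ)) / 2 := by
    intro c
    rw [Real.mul_rpow (by norm_num) hρ, one_div, Real.inv_rpow two_pos.le,
      ← Real.rpow_neg two_pos.le, neg_add, Real.rpow_add two_pos, Real.rpow_neg_one, neg_div]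
    ring
  rw [mixedEnergy, mixedKinetic, mixedExchange, show (1 : ℝ) - 1 / 2 = 1 / 2 by norm_num, e, e]
  ring

lemma one_sub_two_rpow_pos {x : ℝ} (hx : x < 0) : 0 < 1 - (2 : ℝ) ^ x :=
  sub_pos.2 (Real.rpow_lt_one_of_one_lt_of_neg one_lt_two hx)

lemma rhoC_pos (hd : d ≠ 0) (hs : 0 < s) (hsd : s < d) : 0 < rhoC d s := by
  have hd0 : (0 : ℝ) < d := by positivity
  have hκ := kappaConst_pos hd
  have hl := lambdaConst_pos hd hs hsd
  have h1 : 0 < 1 - (2 : ℝ) ^ (-s / (d : ℝ)) :=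
    one_sub_two_rpow_pos (div_neg_of_neg_of_pos (by linarith) hd0)
  have h2 : 0 < 1 - (2 : ℝ) ^ (-2 / (d : ℝ)) :=
    one_sub_two_rpow_pos (div_neg_of_neg_of_pos (by linarith) hd0)
  unfold rhoC
  positivity

/-- This is the equality of the ferromagnetic and paramagnetic energies at `rhoC`, divided by `ρ ^
(1 + s / d)`. -/
lemma rhoC_rpow (hd : d ≠ 0) (hs : 0 < s) (hsd : s < d) (hs2 : s < 2) :
    kappaConst d * (1 - (2 : ℝ) ^ (-2 / (d : ℝ))) * rhoC d s ^ ((2 - s) / (d : ℝ)) =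
      lambdaConst d s * (1 - (2 : ℝ) ^ (-s / (d : ℝ))) := by
  have hd0 : (0 : ℝ) < d := by positivity
  have hκ := kappaConst_pos hd
  have hl := lambdaConst_pos hd hs hsd
  have h1 : 0 < 1 - (2 : ℝ) ^ (-s / (d : ℝ)) :=
    one_sub_two_rpow_pos (div_neg_of_neg_of_pos (by linarith) hd0)
  have h2 : 0 < 1 - (2 : ℝ) ^ (-2 / (d : ℝ)) :=
    one_sub_two_rpow_pos (div_neg_of_neg_of_pos (by linarith) hd0)
  have h3 : (2 - s : ℝ) ≠ 0 := by linarith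
  rw [rhoC, ← Real.rpow_mul (by positivity), div_mul_div_cancel₀ h3, div_self hd0.ne',
    Real.rpow_one]
  generalize (1 - (2 : ℝ) ^ (-2 / (d : ℝ))) = u at *
  generalize (1 - (2 : ℝ) ^ (-s / (d : ℝ))) = w at *
  field_simp

/-- The energy gap between the ferromagnetic and the paramagnetic state. -/
lemma mixedEnergy_zero_sub_half (hd : d ≠ 0) (hs : 0 < s) (hsd : s < d) (hs2 : s < 2) (hρ : 0 < ρ) :
    mixedEnergy d s ρ 0 - mixedEnergy d s ρ (1 / 2) =
      kappaConst d * (1 - (2 : ℝ) ^ (-2 / (d : ℝ))) * ρ ^ (1 + s / (d : ℝ)) *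
        (ρ ^ ((2 - s) / (d : ℝ)) - rhoC d s ^ ((2 - s) / (d : ℝ))) := by
  have e : ρ ^ (1 + 2 / (d : ℝ)) = ρ ^ (1 + s / (d : ℝ)) * ρ ^ ((2 - s) / (d : ℝ)) := by
    rw [← Real.rpow_add hρ]
    congr 1
    ring
  rw [mixedEnergy_zero hd hs, mixedEnergy_half hρ.le, e]
  linear_combination (ρ ^ (1 + s / (d : ℝ))) * rhoC_rpow hd hs hsd hs2

lemma mixedEnergy_zero_lt_half_iff (hd : d ≠ 0) (hs : 0 < s) (hsd : s < d) (hs2 : s < 2)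
    (hρ : 0 < ρ) : mixedEnergy d s ρ 0 < mixedEnergy d s ρ (1 / 2) ↔ ρ < rhoC d s := by
  have hd0 : (0 : ℝ) < d := by positivity
  have hκ := kappaConst_pos hd
  have h2 : 0 < 1 - (2 : ℝ) ^ (-2 / (d : ℝ)) :=
    one_sub_two_rpow_pos (div_neg_of_neg_of_pos (by linarith) hd0)
  have hσ : 0 < (2 - s) / (d : ℝ) := div_pos (by linarith) hd0
  have hpos : 0 < kappaConst d * (1 - (2 : ℝ) ^ (-2 / (d : ℝ))) * ρ ^ (1 + s / (d : ℝ)) := by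
    positivity
  rw [← sub_neg, mixedEnergy_zero_sub_half hd hs hsd hs2 hρ, ← Real.rpow_lt_rpow_iff hρ.le
    (rhoC_pos hd hs hsd).le hσ, ← sub_neg (b := rhoC d s ^ ((2 - s) / (d : ℝ)))]
  exact ⟨fun h => by_contra fun h' => absurd h (not_lt.2 (mul_nonneg hpos.le (not_lt.1 h'))),
    fun h => mul_neg_of_pos_of_neg hpos h⟩

lemma mixedEnergy_zero_eq_half (hd : d ≠ 0) (hs : 0 < s) (hsd : s < d) (hs2 : s < 2) :
    mixedEnergy d s (rhoC d s) 0 = mixedEnergy d s (rhoC d s) (1 / 2) := by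
  rw [← sub_eq_zero, mixedEnergy_zero_sub_half hd hs hsd hs2 (rhoC_pos hd hs hsd), sub_self,
    mul_zero]

lemma mixedEnergy_half_lt_zero_of_rhoC_lt (hd : d ≠ 0) (hs : 0 < s) (hsd : s < d) (hs2 : s < 2)
    (hρ : rhoC d s < ρ) : mixedEnergy d s ρ (1 / 2) < mixedEnergy d s ρ 0 := by
  have hρ0 := (rhoC_pos hd hs hsd).trans hρ
  have hd0 : (0 : ℝ) < d := by positivity
  have hκ := kappaConst_pos hd
  have h2 : 0 < 1 - (2 : ℝ) ^ (-2 / (d : ℝ)) :=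
    one_sub_two_rpow_pos (div_neg_of_neg_of_pos (by linarith) hd0)
  have hσ : 0 < (2 - s) / (d : ℝ) := div_pos (by linarith) hd0
  rw [← sub_pos, mixedEnergy_zero_sub_half hd hs hsd hs2 hρ0]
  have := Real.rpow_lt_rpow (rhoC_pos hd hs hsd).le hρ hσ
  have := sub_pos.2 this
  positivity

/-! #### Differentiability of the ground state energy -/

lemma hasDerivAt_rpow_sub_rpow (c₁ c₂ p q : ℝ) {x : ℝ} (hx : 0 < x) :
    HasDerivAt (fun ρ : ℝ => c₁ * ρ ^ p - c₂ * ρ ^ q)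
      (c₁ * (p * x ^ (p - 1)) - c₂ * (q * x ^ (q - 1))) x :=
  ((Real.hasDerivAt_rpow_const (Or.inl hx.ne')).const_mul c₁).sub
    ((Real.hasDerivAt_rpow_const (Or.inl hx.ne')).const_mul c₂)

/-- Gluing two differences of powers at a point where they agree. -/
lemma glue_rpow_sub_rpow {c₁ c₂ e₁ e₂ p q r : ℝ} (hr : 0 < r)
    (heq : c₁ * r ^ p - c₂ * r ^ q = e₁ * r ^ p - e₂ * r ^ q)
    (hpq : p ≠ q) (hce : c₁ ≠ e₁) :
    let E : ℝ → ℝ := fun ρ => if ρ ≤ r then c₁ * ρ ^ p - c₂ * ρ ^ q else e₁ * ρ ^ p - e₂ * ρ ^ q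
    (∀ ρ : ℝ, 0 < ρ → ρ ≠ r → DifferentiableAt ℝ E ρ) ∧
      ∃ a b : ℝ, HasDerivWithinAt E a (Set.Iic r) r ∧ HasDerivWithinAt E b (Set.Ici r) r ∧
        Filter.Tendsto (deriv E) (nhdsWithin r (Set.Iio r)) (nhds a) ∧
        Filter.Tendsto (deriv E) (nhdsWithin r (Set.Ioi r)) (nhds b) ∧ a ≠ b := by
  intro E
  have hlt : ∀ ρ : ℝ, 0 < ρ → ρ < r →
      HasDerivAt E (c₁ * (p * ρ ^ (p - 1)) - c₂ * (q * ρ ^ (q - 1))) ρ := fun ρ hρ hρr =>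
    (hasDerivAt_rpow_sub_rpow c₁ c₂ p q hρ).congr_of_eventuallyEq (by
      filter_upwards [Iio_mem_nhds hρr] with x hx
      exact if_pos (Set.mem_Iio.1 hx).le)
  have hgt : ∀ ρ : ℝ, r < ρ →
      HasDerivAt E (e₁ * (p * ρ ^ (p - 1)) - e₂ * (q * ρ ^ (q - 1))) ρ := fun ρ hρr =>
    (hasDerivAt_rpow_sub_rpow e₁ e₂ p q (hr.trans hρr)).congr_of_eventuallyEq (by
      filter_upwards [Ioi_mem_nhds hρr] with x hx
      exact if_neg (not_le.2 hx))
  have hlim : ∀ c₁ c₂ : ℝ, Filter.Tendsto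
      (fun ρ : ℝ => c₁ * (p * ρ ^ (p - 1)) - c₂ * (q * ρ ^ (q - 1))) (nhds r)
      (nhds (c₁ * (p * r ^ (p - 1)) - c₂ * (q * r ^ (q - 1)))) := by
    intro c₁ c₂
    have h : ∀ u : ℝ, ContinuousAt (fun ρ : ℝ => ρ ^ u) r := fun u =>
      Real.continuousAt_rpow_const r u (Or.inl hr.ne')
    exact ((((h _).const_mul p).const_mul c₁).sub (((h _).const_mul q).const_mul c₂))
  refine ⟨fun ρ hρ hne => ?_, c₁ * (p * r ^ (p - 1)) - c₂ * (q * r ^ (q - 1)),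
    e₁ * (p * r ^ (p - 1)) - e₂ * (q * r ^ (q - 1)), ?_, ?_, ?_, ?_, ?_⟩
  · rcases hne.lt_or_gt with h | h
    · exact (hlt ρ hρ h).differentiableAt
    · exact (hgt ρ h).differentiableAt
  · exact (hasDerivAt_rpow_sub_rpow c₁ c₂ p q hr).hasDerivWithinAt.congr
      (fun x hx => if_pos hx) (if_pos le_rfl)
  · refine (hasDerivAt_rpow_sub_rpow e₁ e₂ p q hr).hasDerivWithinAt.congr (fun x hx => ?_)
      ((if_pos le_rfl).trans heq)
    rcases (Set.mem_Ici.1 hx).eq_or_lt with rfl | h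
    · exact (if_pos le_rfl).trans heq
    · exact if_neg (not_le.2 h)
  · refine ((hlim c₁ c₂).mono_left nhdsWithin_le_nhds).congr' ?_
    filter_upwards [Ioo_mem_nhdsLT hr] with x hx
    exact (hlt x hx.1 hx.2).deriv.symm
  · refine ((hlim e₁ e₂).mono_left nhdsWithin_le_nhds).congr' ?_
    filter_upwards [self_mem_nhdsWithin] with x hx
    exact (hgt x hx).deriv.symm
  -- Multiplied by `r`, equality of slopes reads `(c₁ - e₁) p r^p = (c₂ - e₂) q r^q`; combined with
  -- equality of values it gives `(c₁ - e₁)(p - q) r^p = 0`.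
  · intro h
    rw [Real.rpow_sub_one hr.ne', Real.rpow_sub_one hr.ne'] at h
    have h1 : (c₁ - e₁) * (p * r ^ p) = (c₂ - e₂) * (q * r ^ q) := by
      field_simp at h
      linarith
    have h2 : (c₁ - e₁) * r ^ p = (c₂ - e₂) * r ^ q := by linarith
    have h3 : (c₁ - e₁) * (r ^ p * (p - q)) = 0 := by linear_combination h1 - q * h2
    have hrp : r ^ p ≠ 0 := (Real.rpow_pos_of_pos hr p).ne'
    exact mul_ne_zero (sub_ne_zero.2 hce) (mul_ne_zero hrp (sub_ne_zero.2 hpq)) h3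

end Polarisation

/-! ### The smooth transition -/

/-- A solution `t` of `f (t x) = g x` with values in an open set on which `f` is injective is as
smooth as `f` and `g`, where `f' ≠ 0`. -/
lemma contDiffAt_of_comp_eq {n : WithTop ℕ∞} (hn : n ≠ 0) {f g t : ℝ → ℝ} {x r : ℝ} {I : Set ℝ}
    (hI : IsOpen I) (hinj : Set.InjOn f I) (hf : ContDiffAt ℝ n f (t x)) (hr : r ≠ 0)
    (hf' : HasDerivAt f r (t x)) (hg : ContDiffAt ℝ n g x)
    (ht : ∀ᶠ y in nhds x, t y ∈ I ∧ f (t y) = g y) : ContDiffAt ℝ n t x := by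
  have hx := ht.self_of_nhds
  have hfd : HasFDerivAt f
      ((ContinuousLinearEquiv.unitsEquivAut ℝ (Units.mk0 r hr) : ℝ ≃L[ℝ] ℝ) : ℝ →L[ℝ] ℝ) (t x) := by
    refine hf'.hasFDerivAt.congr_fderiv ?_
    ext
    simp
  have hstrict := hf.hasStrictFDerivAt' hfd hn
  have hinv : ContDiffAt ℝ n (hf.localInverse hfd hn) (g x) := by
    rw [← hx.2]
    exact hf.to_localInverse hfd hn
  have hval : hf.localInverse hfd hn (g x) = t x := by
    rw [← hx.2]
    exact hf.localInverse_apply_image hfd hn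
  have hcomp : ContDiffAt ℝ n (fun y => hf.localInverse hfd hn (g y)) x := hinv.comp x hg
  refine hcomp.congr_of_eventuallyEq ?_
  -- Continuity of `t` is not assumed: near `x` the local inverse also takes values in `I`, and
  -- injectivity of `f` there identifies it with `t`.
  have h1 : ∀ᶠ y in nhds x, hf.localInverse hfd hn (g y) ∈ I :=
    hcomp.continuousAt.eventually_mem (hI.mem_nhds (by rw [hval]; exact hx.1))
  have h2 : ∀ᶠ y in nhds x, f (hf.localInverse hfd hn (g y)) = g y := by
    refine hg.continuousAt.eventually (p := fun z => f (hf.localInverse hfd hn z) = z) ?_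
    rw [← hx.2]
    exact hstrict.eventually_right_inverse
  filter_upwards [ht, h1, h2] with y hy1 hy2 hy3
  exact hinj hy1.1 hy2 (hy1.2.trans hy3.symm)

lemma contDiffAt_polRatio {a b t : ℝ} {n : WithTop ℕ∞} (hb : 0 < b)
    (ht : t ∈ Set.Ioo (0 : ℝ) (1 / 2)) : ContDiffAt ℝ n (polRatio a b) t := by
  have h : ∀ c : ℝ, ContDiffAt ℝ n (polDiff c) t := fun c =>
    ((contDiffAt_const.sub contDiffAt_id).rpow_const_of_ne
      (by simp only [id]; linarith [ht.2])).sub (contDiffAt_id.rpow_const_of_ne ht.1.ne')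
  exact (h a).div (h b) (polDiff_pos hb ht.1.le ht.2).ne'

/-- The ratio of the exchange and kinetic scales that determines the optimal polarisation. -/
noncomputable def polCoupling (d : ℕ) (s ρ : ℝ) : ℝ :=
  kappaConst d / lambdaConst d s * (((d : ℝ) + 2) / ((d : ℝ) + s)) * ρ ^ ((2 - s) / (d : ℝ))

section Smooth

variable {d : ℕ} {s ρ t : ℝ}

lemma polCoupling_eq (hd : d ≠ 0) (hs : 0 < s) (hsd : s < d) (hρ : 0 < ρ) : polCoupling d s ρ =
    kappaConst d * ρ ^ (1 + 2 / (d : ℝ)) * (1 + 2 / (d : ℝ)) /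
      (lambdaConst d s * ρ ^ (1 + s / (d : ℝ)) * (1 + s / (d : ℝ))) := by
  have hd0 : (0 : ℝ) < d := by positivity
  have hl := lambdaConst_pos hd hs hsd
  have e : ρ ^ (1 + 2 / (d : ℝ)) = ρ ^ (1 + s / (d : ℝ)) * ρ ^ ((2 - s) / (d : ℝ)) := by
    rw [← Real.rpow_add hρ]
    congr 1
    ring
  have hpos : 0 < ρ ^ (1 + s / (d : ℝ)) := by positivity
  rw [polCoupling, e]
  generalize ρ ^ (1 + s / (d : ℝ)) = u at *
  generalize ρ ^ ((2 - s) / (d : ℝ)) = v at *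
  field_simp

lemma polCoupling_const_pos (hd : d ≠ 0) (hs : 0 < s) (hsd : s < d) :
    0 < kappaConst d / lambdaConst d s * (((d : ℝ) + 2) / ((d : ℝ) + s)) := by
  have hd0 : (0 : ℝ) < d := by positivity
  have hκ := kappaConst_pos hd
  have hl := lambdaConst_pos hd hs hsd
  positivity

lemma strictAntiOn_polCoupling (hd : d ≠ 0) (hs : 2 < s) (hsd : s < d) :
    StrictAntiOn (polCoupling d s) (Set.Ioi 0) := by
  have hd0 : (0 : ℝ) < d := by positivity
  intro x hx y hy hxy
  exact mul_lt_mul_of_pos_left (Real.rpow_lt_rpow_of_neg hx hxy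
    (div_neg_of_neg_of_pos (by linarith) hd0)) (polCoupling_const_pos hd (by linarith) hsd)

lemma contDiffAt_polCoupling {n : WithTop ℕ∞} (hρ : 0 < ρ) :
    ContDiffAt ℝ n (polCoupling d s) ρ :=
  contDiffAt_const.mul (contDiffAt_id.rpow_const_of_ne hρ.ne')

lemma rhoCMax_pos (hd : d ≠ 0) (hs : 0 < s) (hsd : s < d) : 0 < rhoCMax d s :=
  Real.rpow_pos_of_pos (polCoupling_const_pos hd hs hsd) _

lemma rhoCMin_pos (hd : d ≠ 0) (hs : 0 < s) (hsd : s < d) : 0 < rhoCMin d s := by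
  have hd0 : (0 : ℝ) < d := by positivity
  have hκ := kappaConst_pos hd
  have hl := lambdaConst_pos hd hs hsd
  unfold rhoCMin
  positivity

/-- With `a = s / d` and `b = 2 / d`, `polRatio a b` runs from `1` at `t = 0` to the limit `(a / b)
2^(b - a)` at `1 / 2`. The critical densities are where the coupling takes these values, the larger
value at the smaller density. -/
lemma polCoupling_rhoCMax (hd : d ≠ 0) (hs : 2 < s) (hsd : s < d) :
    polCoupling d s (rhoCMax d s) = 1 := by
  have hd0 : (0 : ℝ) < d := by positivity
  have hX := polCoupling_const_pos hd (by linarith) hsd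
  have h2 : s - 2 ≠ 0 := by linarith
  have e : (d : ℝ) / (s - 2) * ((2 - s) / d) = -1 := by
    field_simp
    ring
  rw [polCoupling, rhoCMax, ← Real.rpow_mul hX.le, e, Real.rpow_neg_one, mul_inv_cancel₀ hX.ne']

lemma polCoupling_rhoCMin (hd : d ≠ 0) (hs : 2 < s) (hsd : s < d) :
    polCoupling d s (rhoCMin d s) =
      s / d / (2 / (d : ℝ)) * (2 : ℝ) ^ (2 / (d : ℝ) - s / (d : ℝ)) := by
  have hd0 : (0 : ℝ) < d := by positivity
  have hs0 : 0 < s := by linarith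
  have hκ := kappaConst_pos hd
  have hl := lambdaConst_pos hd hs0 hsd
  have h2 : s - 2 ≠ 0 := by linarith
  have e : (d : ℝ) / (s - 2) * ((2 - s) / d) = -1 := by
    field_simp
    ring
  rw [polCoupling, rhoCMin, Real.mul_rpow two_pos.le (by positivity),
    ← Real.rpow_mul (by positivity), e, Real.rpow_neg_one, ← sub_div]
  generalize (2 : ℝ) ^ ((2 - s) / (d : ℝ)) = u
  field_simp

lemma rhoCMin_lt_rhoCMax (hd : d ≠ 0) (hs : 2 < s) (hsd : s < d) : rhoCMin d s < rhoCMax d s := by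
  have hd0 : (0 : ℝ) < d := by positivity
  have hs0 : 0 < s := by linarith
  have hb : 0 < 2 / (d : ℝ) := by positivity
  have hba : 2 / (d : ℝ) < s / d := by gcongr
  have ha : s / d ≤ 1 := (div_le_one hd0).2 hsd.le
  refine ((strictAntiOn_polCoupling hd hs hsd).lt_iff_gt (rhoCMax_pos hd hs0 hsd)
    (rhoCMin_pos hd hs0 hsd)).1 ?_
  rw [polCoupling_rhoCMax hd hs hsd, polCoupling_rhoCMin hd hs hsd]
  -- Any interior value of `polRatio` separates its two end values; `1 / 4` is an arbitrary choice.
  exact (one_lt_polRatio hb hba ha (t := 1 / 4) ⟨by norm_num, by norm_num⟩).trans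
    (polRatio_lt hb hba ha ⟨by norm_num, by norm_num⟩)

lemma isOptimalPolarisation_iff_eq {t₀ : ℝ} (ht₀ : t₀ ∈ Set.Icc (0 : ℝ) (1 / 2))
    (h : ∀ x ∈ Set.Icc (0 : ℝ) (1 / 2), x ≠ t₀ → mixedEnergy d s ρ t₀ < mixedEnergy d s ρ x) :
    IsOptimalPolarisation d s ρ t ↔ t = t₀ := by
  constructor
  · intro ht
    by_contra hne
    exact absurd (h t ht.1 hne) (not_lt.2 (ht.2 t₀ ht₀))
  · rintro rfl
    refine ⟨ht₀, fun x hx => ?_⟩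
    rcases eq_or_ne x t with rfl | hne
    · exact le_rfl
    · exact (h x hx hne).le

lemma isOptimalPolarisation_iff_eq_half (hd : d ≠ 0) (hs : 2 < s) (hsd : s < d) (hρ : 0 < ρ)
    (h : ρ ≤ rhoCMin d s) : IsOptimalPolarisation d s ρ t ↔ t = 1 / 2 := by
  have hd0 : (0 : ℝ) < d := by positivity
  have hs0 : 0 < s := by linarith
  have hl := lambdaConst_pos hd hs0 hsd
  have hcL := (strictAntiOn_polCoupling hd hs hsd).antitoneOn hρ (rhoCMin_pos hd hs0 hsd) h
  rw [polCoupling_rhoCMin hd hs hsd] at hcL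
  have hhalf : (1 / 2 : ℝ) ∈ Set.Icc (0 : ℝ) (1 / 2) := ⟨by norm_num, le_rfl⟩
  refine isOptimalPolarisation_iff_eq hhalf fun x hx hne => ?_
  rw [mixedEnergy_eq_polEnergy hρ.le (mem_Icc_one_of_half hx),
    mixedEnergy_eq_polEnergy hρ.le (mem_Icc_one_of_half hhalf)]
  exact strictAntiOn_polEnergy (by positivity) (by positivity) (by positivity)
    (show 0 < 2 / (d : ℝ) by positivity) (show 2 / (d : ℝ) < s / d by gcongr)
    ((div_le_one hd0).2 hsd.le) (by ring) (by ring) (polCoupling_eq hd hs0 hsd hρ) hcL hx hhalf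
    (lt_of_le_of_ne hx.2 hne)

lemma isOptimalPolarisation_iff_eq_zero (hd : d ≠ 0) (hs : 2 < s) (hsd : s < d)
    (h : rhoCMax d s ≤ ρ) : IsOptimalPolarisation d s ρ t ↔ t = 0 := by
  have hd0 : (0 : ℝ) < d := by positivity
  have hs0 : 0 < s := by linarith
  have hl := lambdaConst_pos hd hs0 hsd
  have hρ := (rhoCMax_pos hd hs0 hsd).trans_le h
  have hc1 := (strictAntiOn_polCoupling hd hs hsd).antitoneOn (rhoCMax_pos hd hs0 hsd) hρ h
  rw [polCoupling_rhoCMax hd hs hsd] at hc1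
  have hzero : (0 : ℝ) ∈ Set.Icc (0 : ℝ) (1 / 2) := ⟨le_rfl, by norm_num⟩
  refine isOptimalPolarisation_iff_eq hzero fun x hx hne => ?_
  rw [mixedEnergy_eq_polEnergy hρ.le (mem_Icc_one_of_half hx),
    mixedEnergy_eq_polEnergy hρ.le (mem_Icc_one_of_half hzero)]
  exact strictMonoOn_polEnergy (by positivity) (by positivity) (by positivity)
    (show 0 < 2 / (d : ℝ) by positivity) (show 2 / (d : ℝ) < s / d by gcongr)
    ((div_le_one hd0).2 hsd.le) (by ring) (by ring) (polCoupling_eq hd hs0 hsd hρ) hc1 hzero hx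
    (lt_of_le_of_ne hx.1 hne.symm)

lemma isOptimalPolarisation_iff_eq_of_polRatio_eq {t₀ : ℝ} (hd : d ≠ 0) (hs : 2 < s) (hsd : s < d)
    (hρ : 0 < ρ) (ht₀ : t₀ ∈ Set.Ioo (0 : ℝ) (1 / 2))
    (h : polRatio (s / d) (2 / d) t₀ = polCoupling d s ρ) :
    IsOptimalPolarisation d s ρ t ↔ t = t₀ := by
  have hd0 : (0 : ℝ) < d := by positivity
  have hs0 : 0 < s := by linarith
  have hl := lambdaConst_pos hd hs0 hsd
  have hmem : t₀ ∈ Set.Icc (0 : ℝ) (1 / 2) := ⟨ht₀.1.le, ht₀.2.le⟩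
  refine isOptimalPolarisation_iff_eq hmem fun x hx hne => ?_
  rw [mixedEnergy_eq_polEnergy hρ.le (mem_Icc_one_of_half hx),
    mixedEnergy_eq_polEnergy hρ.le (mem_Icc_one_of_half hmem)]
  exact polEnergy_lt_of_polRatio_eq (by positivity) (by positivity) (by positivity)
    (show 0 < 2 / (d : ℝ) by positivity) (show 2 / (d : ℝ) < s / d by gcongr)
    ((div_le_one hd0).2 hsd.le) (by ring) (by ring) (polCoupling_eq hd hs0 hsd hρ) ht₀ h hx hne

/-- The optimal polarisation between the two critical densities. -/
lemma exists_smooth_polarisation (hd : d ≠ 0) (hs : 2 < s) (hsd : s < d) : ∃ t : ℝ → ℝ,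
    (∀ ρ ∈ Set.Ioo (rhoCMin d s) (rhoCMax d s), t ρ ∈ Set.Ioo (0 : ℝ) (1 / 2) ∧
      ∀ t', IsOptimalPolarisation d s ρ t' ↔ t' = t ρ) ∧
    ContDiffOn ℝ ((⊤ : ℕ∞) : WithTop ℕ∞) t (Set.Ioo (rhoCMin d s) (rhoCMax d s)) ∧
    Filter.Tendsto t (nhdsWithin (rhoCMin d s) (Set.Ioi (rhoCMin d s))) (nhds (1 / 2)) ∧
    Filter.Tendsto t (nhdsWithin (rhoCMax d s) (Set.Iio (rhoCMax d s))) (nhds 0) := by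
  have hd0 : (0 : ℝ) < d := by positivity
  have hs0 : 0 < s := by linarith
  have hb : 0 < 2 / (d : ℝ) := by positivity
  have hba : 2 / (d : ℝ) < s / d := by gcongr
  have ha : s / d ≤ 1 := (div_le_one hd0).2 hsd.le
  have hmin := rhoCMin_pos hd hs0 hsd
  have hmax := rhoCMax_pos hd hs0 hsd
  have hlt := rhoCMin_lt_rhoCMax hd hs hsd
  have hanti := strictAntiOn_polCoupling hd hs hsd
  have hmono := strictMonoOn_polRatio hb hba ha
  have hpos : ∀ ρ ∈ Set.Ioo (rhoCMin d s) (rhoCMax d s), 0 < ρ := fun ρ hρ => hmin.trans hρ.1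
  have hex : ∀ ρ : ℝ, ∃ t : ℝ, ρ ∈ Set.Ioo (rhoCMin d s) (rhoCMax d s) →
      t ∈ Set.Ioo (0 : ℝ) (1 / 2) ∧ polRatio (s / d) (2 / d) t = polCoupling d s ρ := by
    intro ρ
    by_cases hρ : ρ ∈ Set.Ioo (rhoCMin d s) (rhoCMax d s)
    · have h1 := hanti (hpos ρ hρ) hmax hρ.2
      have h2 := hanti hmin (hpos ρ hρ) hρ.1
      rw [polCoupling_rhoCMax hd hs hsd] at h1
      rw [polCoupling_rhoCMin hd hs hsd] at h2
      obtain ⟨t, ht, hte⟩ := exists_polRatio_eq hb hba h1 h2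
      exact ⟨t, fun _ => ⟨ht, hte⟩⟩
    -- Outside the interval of densities the value is arbitrary; no conclusion depends on it.
    · exact ⟨0, fun h => absurd h hρ⟩
  choose t ht using hex
  refine ⟨t, fun ρ hρ => ⟨(ht ρ hρ).1, fun t' => isOptimalPolarisation_iff_eq_of_polRatio_eq hd hs
    hsd (hpos ρ hρ) (ht ρ hρ).1 (ht ρ hρ).2⟩, fun ρ hρ => ?_, ?_, ?_⟩
  · obtain ⟨htI, -⟩ := ht ρ hρ
    obtain ⟨r, hr, hder⟩ := exists_hasDerivAt_polRatio_pos hb hba ha htI.1 htI.2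
    refine (contDiffAt_of_comp_eq (by simp) isOpen_Ioo
      (hmono.injOn.mono (Set.Ioo_subset_Ico_self)) (contDiffAt_polRatio hb htI) hr.ne' hder
      (contDiffAt_polCoupling (d := d) (s := s) (hpos ρ hρ)) ?_).contDiffWithinAt
    filter_upwards [Ioo_mem_nhds hρ.1 hρ.2] with y hy using ht y hy
  · refine tendsto_order.2 ⟨fun x hx => ?_, fun x hx => ?_⟩
    -- As `polRatio` is monotone only on `[0, 1 / 2)`, the level `x` is first raised to at least
    -- `0`. Near `rhoCMin` the coupling exceeds `polRatio` at this level, which pushes `t ρ` above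
    -- it.
    · have hm : max x 0 ∈ Set.Ico (0 : ℝ) (1 / 2) :=
        ⟨le_max_right _ _, max_lt hx (by norm_num)⟩
      have hR := polRatio_lt hb hba ha hm
      rw [← polCoupling_rhoCMin hd hs hsd] at hR
      have hev := ((contDiffAt_polCoupling (n := 0) hmin).continuousAt.eventually
        (lt_mem_nhds hR)).filter_mono (nhdsWithin_le_nhds (s := Set.Ioi (rhoCMin d s)))
      filter_upwards [hev, Ioo_mem_nhdsGT hlt] with ρ h1 hρ
      obtain ⟨htI, hte⟩ := ht ρ hρ
      rw [← hte] at h1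
      exact (le_max_left x 0).trans_lt ((hmono.lt_iff_lt hm ⟨htI.1.le, htI.2⟩).1 h1)
    · filter_upwards [Ioo_mem_nhdsGT hlt] with ρ hρ
      exact (ht ρ hρ).1.2.trans hx
  · refine tendsto_order.2 ⟨fun x hx => ?_, fun x hx => ?_⟩
    · filter_upwards [Ioo_mem_nhdsLT hlt] with ρ hρ
      exact hx.trans (ht ρ hρ).1.1
    -- Lowering the level to at most `1 / 4` keeps it inside the interval, where `polRatio` exceeds
    -- the value `1` of the coupling at `rhoCMax`.
    · have hm : min x (1 / 4) ∈ Set.Ioo (0 : ℝ) (1 / 2) :=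
        ⟨lt_min hx (by norm_num), (min_le_right _ _).trans_lt (by norm_num)⟩
      have hR := one_lt_polRatio hb hba ha hm
      replace hR := (polCoupling_rhoCMax hd hs hsd).trans_lt hR
      have hev := ((contDiffAt_polCoupling (n := 0) hmax).continuousAt.eventually
        (gt_mem_nhds hR)).filter_mono (nhdsWithin_le_nhds (s := Set.Iio (rhoCMax d s)))
      filter_upwards [hev, Ioo_mem_nhdsLT hlt] with ρ h1 hρ
      obtain ⟨htI, hte⟩ := ht ρ hρ
      rw [← hte] at h1
      exact ((hmono.lt_iff_lt ⟨htI.1.le, htI.2⟩ ⟨hm.1.le, hm.2⟩).1 h1).trans_le (min_le_left _ _)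

end Smooth

/-! ### From optimal polarisations to minimising states. -/

section Minimisers

variable {d : ℕ} {s ρ t₀ : ℝ} {γ : DensityMatrix d}

lemma isHFMinimiser_iff_of_unique (hd : d ≠ 0) (hs : 0 < s) (hsd : s < d) (hρ : 0 < ρ)
    (h : ∀ t, IsOptimalPolarisation d s ρ t ↔ t = t₀) :
    IsHFMinimiser d (rieszInteraction d s) ρ γ ↔
      ∃ U ∈ Matrix.specialUnitaryGroup (Fin 2) ℂ, γ =ᵐ[volume] mixedState d ρ t₀ U := by
  rw [isHFMinimiser_iff hd hs hsd hρ]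
  constructor
  · rintro ⟨t, ht, hU⟩
    rwa [(h t).1 ht] at hU
  · exact fun hU => ⟨t₀, (h t₀).2 rfl, hU⟩

/-- Comparing energies of mixed states directly avoids having to show that a state determines its
polarisation, as a deduction from `isHFMinimiser_iff` would require. -/
lemma isOptimalPolarisation_of_isHFMinimiser_mixedState (hd : d ≠ 0) (hs : 0 < s) (hsd : s < d)
    (hρ : 0 < ρ) {t : ℝ} (ht : t ∈ Set.Icc (0 : ℝ) (1 / 2)) {U : Matrix (Fin 2) (Fin 2) ℂ}
    (hU : U ∈ Matrix.specialUnitaryGroup (Fin 2) ℂ)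
    (h : IsHFMinimiser d (rieszInteraction d s) ρ (mixedState d ρ t U)) :
    IsOptimalPolarisation d s ρ t := by
  refine ⟨ht, fun t' ht' => ?_⟩
  have hle := h.2 _ (isHFState_mixedState hd hρ.le (mem_Icc_one_of_half ht') hU)
  rw [hfEnergy_mixedState hd hs hsd hρ.le (mem_Icc_one_of_half ht) hU,
    hfEnergy_mixedState hd hs hsd hρ.le (mem_Icc_one_of_half ht') hU] at hle
  exact_mod_cast hle

end Minimisers

theorem theorem3 (d : ℕ) (hd : 1 ≤ d) (s : ℝ) (hs : 0 < s) (hsd : s < d) :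
    -- first-order phase transition
    (s < min 2 (d : ℝ) →
      0 < rhoC d s ∧
      (∀ ρ : ℝ, 0 < ρ → ρ < rhoC d s → ∀ γ : DensityMatrix d,
        (IsHFMinimiser d (rieszInteraction d s) ρ γ ↔
          ∃ ν : EuclideanSpace ℂ (Fin 2), ‖ν‖ = 1 ∧ γ =ᵐ[volume] ferroState d ρ ν)) ∧
      (∀ ρ : ℝ, rhoC d s < ρ → ∀ γ : DensityMatrix d,
        (IsHFMinimiser d (rieszInteraction d s) ρ γ ↔ γ =ᵐ[volume] paraState d ρ)) ∧
      (∀ γ : DensityMatrix d,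
        (IsHFMinimiser d (rieszInteraction d s) (rhoC d s) γ ↔
          (∃ ν : EuclideanSpace ℂ (Fin 2), ‖ν‖ = 1 ∧ γ =ᵐ[volume] ferroState d (rhoC d s) ν) ∨
            γ =ᵐ[volume] paraState d (rhoC d s))) ∧
      (∃ E : ℝ → ℝ,
        (∀ ρ : ℝ, 0 < ρ → hfGroundEnergy d (rieszInteraction d s) ρ = (E ρ : EReal)) ∧
        (∀ ρ : ℝ, 0 < ρ → ρ ≠ rhoC d s → DifferentiableAt ℝ E ρ) ∧
        ∃ a b : ℝ,
          HasDerivWithinAt E a (Set.Iic (rhoC d s)) (rhoC d s) ∧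
          HasDerivWithinAt E b (Set.Ici (rhoC d s)) (rhoC d s) ∧
          Filter.Tendsto (deriv E) (nhdsWithin (rhoC d s) (Set.Iio (rhoC d s))) (nhds a) ∧
          Filter.Tendsto (deriv E) (nhdsWithin (rhoC d s) (Set.Ioi (rhoC d s))) (nhds b) ∧
          a ≠ b)) ∧
    -- second-order (smooth) phase transition
    (3 ≤ d → min 2 (d : ℝ) < s →
      0 < rhoCMin d s ∧ rhoCMin d s < rhoCMax d s ∧
      (∀ ρ : ℝ, 0 < ρ → ρ ≤ rhoCMin d s → ∀ γ : DensityMatrix d,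
        (IsHFMinimiser d (rieszInteraction d s) ρ γ ↔ γ =ᵐ[volume] paraState d ρ)) ∧
      (∃ t : ℝ → ℝ,
        (∀ ρ ∈ Set.Ioo (rhoCMin d s) (rhoCMax d s),
          t ρ ∈ Set.Ioo (0 : ℝ) (1 / 2) ∧
          (∀ γ : DensityMatrix d,
            (IsHFMinimiser d (rieszInteraction d s) ρ γ ↔
              ∃ U ∈ Matrix.specialUnitaryGroup (Fin 2) ℂ,
                γ =ᵐ[volume] mixedState d ρ (t ρ) U)) ∧
          (∀ t' ∈ Set.Icc (0 : ℝ) (1 / 2),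
            (∃ U ∈ Matrix.specialUnitaryGroup (Fin 2) ℂ,
              IsHFMinimiser d (rieszInteraction d s) ρ (mixedState d ρ t' U)) → t' = t ρ)) ∧
        ContDiffOn ℝ ((⊤ : ℕ∞) : WithTop ℕ∞) t (Set.Ioo (rhoCMin d s) (rhoCMax d s)) ∧
        Filter.Tendsto t (nhdsWithin (rhoCMin d s) (Set.Ioi (rhoCMin d s))) (nhds (1 / 2)) ∧
        Filter.Tendsto t (nhdsWithin (rhoCMax d s) (Set.Iio (rhoCMax d s))) (nhds 0)) ∧
      (∀ ρ : ℝ, rhoCMax d s ≤ ρ → ∀ γ : DensityMatrix d,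
        (IsHFMinimiser d (rieszInteraction d s) ρ γ ↔
          ∃ ν : EuclideanSpace ℂ (Fin 2), ‖ν‖ = 1 ∧ γ =ᵐ[volume] ferroState d ρ ν))) := by
  have hd0 : d ≠ 0 := by omega
  refine ⟨fun hs2 => ?_, fun hd3 hs2' => ?_⟩
  · have hs2' : s < 2 := hs2.trans_le (min_le_left _ _)
    have hc := rhoC_pos hd0 hs hsd
    have hzero : ∀ ρ : ℝ, 0 < ρ → ρ ≤ rhoC d s → IsOptimalPolarisation d s ρ 0 := by
      intro ρ hρ hle
      refine (isOptimalPolarisation_zero_iff hd0 hs hs2 hρ).2 ?_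
      rcases hle.eq_or_lt with rfl | hlt
      · exact (mixedEnergy_zero_eq_half hd0 hs hsd hs2').le
      · exact ((mixedEnergy_zero_lt_half_iff hd0 hs hsd hs2' hρ).2 hlt).le
    have hhalf : ∀ ρ : ℝ, rhoC d s ≤ ρ → IsOptimalPolarisation d s ρ (1 / 2) := by
      intro ρ hle
      refine (isOptimalPolarisation_half_iff hd0 hs hs2 (hc.trans_le hle)).2 ?_
      rcases hle.eq_or_lt with rfl | hlt
      · exact (mixedEnergy_zero_eq_half hd0 hs hsd hs2').ge
      · exact (mixedEnergy_half_lt_zero_of_rhoC_lt hd0 hs hsd hs2' hlt).le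
    refine ⟨hc, fun ρ hρ hlt γ => ?_, fun ρ hlt γ => ?_, fun γ => ?_, ?_⟩
    · rw [← exists_ae_eq_mixedState_zero_iff hd0]
      refine isHFMinimiser_iff_of_unique hd0 hs hsd hρ fun t => ⟨fun ht => ?_, ?_⟩
      · refine (ht.eq_zero_or_half hd0 hs hs2 hρ).resolve_right ?_
        rintro rfl
        exact absurd ((isOptimalPolarisation_half_iff hd0 hs hs2 hρ).1 ht)
          (not_le.2 ((mixedEnergy_zero_lt_half_iff hd0 hs hsd hs2' hρ).2 hlt))
      · rintro rfl
        exact hzero ρ hρ hlt.le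
    · have hρ := hc.trans hlt
      rw [← exists_ae_eq_mixedState_half_iff]
      refine isHFMinimiser_iff_of_unique hd0 hs hsd hρ fun t => ⟨fun ht => ?_, ?_⟩
      · refine (ht.eq_zero_or_half hd0 hs hs2 hρ).resolve_left ?_
        rintro rfl
        exact absurd ((isOptimalPolarisation_zero_iff hd0 hs hs2 hρ).1 ht)
          (not_le.2 (mixedEnergy_half_lt_zero_of_rhoC_lt hd0 hs hsd hs2' hlt))
      · rintro rfl
        exact hhalf ρ hlt.le
    · rw [isHFMinimiser_iff hd0 hs hsd hc, ← exists_ae_eq_mixedState_zero_iff hd0,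
        ← exists_ae_eq_mixedState_half_iff]
      constructor
      · rintro ⟨t, ht, hU⟩
        rcases ht.eq_zero_or_half hd0 hs hs2 hc with rfl | rfl
        · exact Or.inl hU
        · exact Or.inr hU
      · rintro (hU | hU)
        · exact ⟨0, hzero _ hc le_rfl, hU⟩
        · exact ⟨1 / 2, hhalf _ le_rfl, hU⟩
    · have hdpos : (0 : ℝ) < d := by positivity
      have hκ := kappaConst_pos hd0
      have h2 : 0 < 1 - (2 : ℝ) ^ (-2 / (d : ℝ)) :=
        one_sub_two_rpow_pos (div_neg_of_neg_of_pos (by linarith) hdpos)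
      have hpq : 1 + 2 / (d : ℝ) ≠ 1 + s / (d : ℝ) := by
        have : s / (d : ℝ) < 2 / d := by gcongr
        linarith
      have hcrit := mixedEnergy_zero_eq_half hd0 hs hsd hs2'
      rw [mixedEnergy_zero hd0 hs, mixedEnergy_half hc.le] at hcrit
      -- The witness is the glued function of `glue_rpow_sub_rpow`: the ferromagnetic energy up to
      -- `rhoC`, the paramagnetic one beyond. The slopes differ because the kinetic coefficients `κ`
      -- and `κ 2^(-2/d)` do.
      refine ⟨_, fun ρ hρ => ?_, glue_rpow_sub_rpow hc hcrit hpq ?_⟩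
      · split_ifs with hle
        · rw [hfGroundEnergy_eq hd0 hs hsd hρ (hzero ρ hρ hle), mixedEnergy_zero hd0 hs]
        · rw [hfGroundEnergy_eq hd0 hs hsd hρ (hhalf ρ (not_le.1 hle).le), mixedEnergy_half hρ.le]
      · nlinarith
  · have hs2 : 2 < s := by
      have h3 : (3 : ℝ) ≤ d := by exact_mod_cast hd3
      rwa [min_eq_left (by linarith)] at hs2'
    have hmin := rhoCMin_pos hd0 hs hsd
    obtain ⟨t, ht, hsmooth, hlim₁, hlim₂⟩ := exists_smooth_polarisation hd0 hs2 hsd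
    refine ⟨hmin, rhoCMin_lt_rhoCMax hd0 hs2 hsd, fun ρ hρ hle γ => ?_,
      ⟨t, fun ρ hρ => ?_, hsmooth, hlim₁, hlim₂⟩, fun ρ hle γ => ?_⟩
    · rw [← exists_ae_eq_mixedState_half_iff]
      exact isHFMinimiser_iff_of_unique hd0 hs hsd hρ fun t =>
        isOptimalPolarisation_iff_eq_half hd0 hs2 hsd hρ hle
    · have hρ0 := hmin.trans hρ.1
      refine ⟨(ht ρ hρ).1, fun γ => isHFMinimiser_iff_of_unique hd0 hs hsd hρ0 (ht ρ hρ).2, ?_⟩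
      rintro t' ht' ⟨U, hU, h⟩
      exact ((ht ρ hρ).2 t').1
        (isOptimalPolarisation_of_isHFMinimiser_mixedState hd0 hs hsd hρ0 ht' hU h)
    · rw [← exists_ae_eq_mixedState_zero_iff hd0]
      exact isHFMinimiser_iff_of_unique hd0 hs hsd ((rhoCMax_pos hd0 hs hsd).trans_le hle)
        fun t => isOptimalPolarisation_iff_eq_zero hd0 hs2 hsd hle
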